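/- Let $M\in\{2,3,4,5,6,7,8,9,10,12,13,16,18,25\}$ (the integers $M>1$ for which $X_0(M)$ has genus zero), and let $t$ be the following Hauptmodul of $\Gamma_0(M)$, where $\eta$ is the Dedekind eta function and $\eta_k:=\eta(k\tau)$ for $\tau\in\mathbb H$: $$\begin{array}{llll} M=2:\ \eta_1^{24}/\eta_2^{24}, & M=3:\ \eta_1^{12}/\eta_3^{12}, & M=4:\ \eta_1^{8}/\eta_4^{8}, & M=5:\ \eta_1^{6}/\eta_5^{6},\\ M=6:\ \dfrac{\eta_1^{5}\eta_3}{\eta_2\eta_6^{5}}, & M=7:\ \eta_1^4/\eta_7^4, & M=8:\ \dfrac{\eta_1^4\eta_4^2}{\eta_2^2\eta_8^4}, & M=9:\ \eta_1^3/\eta_9^3,\\ M=10:\ \dfrac{\eta_1^3\eta_5}{\eta_2\eta_{10}^3}, & M=12:\ \dfrac{\eta_1^3\eta_4\eta_6^2}{\eta_2^2\eta_3\eta_{12}^3}, & M=13:\ \eta_1^2/\eta_{13}^2, & M=16:\ \dfrac{\eta_1^2\eta_8}{\eta_2\eta_{16}^2},\\ M=18:\ \dfrac{\eta_1^2\eta_6\eta_9}{\eta_2\eta_3\eta_{18}^2},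 & M=25:\ \eta_1/\eta_{25}. & & \end{array}$$ For an elliptic curve $E$ over $\mathbb C$ and a cyclic subgroup $C\subset E$ of order $M$, put $t(E,C):=t(\tau)$ for any $\tau\in\mathbb H$ with $(E,C)\cong(\mathbb C/\Lambda_\tau,\langle \tfrac1M+\Lambda_\tau\rangle)$, where $\Lambda_\tau=\mathbb Z+\mathbb Z\tau$. Let $N\ge 1$ be an integer. Let $I_N(E,C)$ be the set of triples $(f,E_1,C_1)$, where $C_1\subset E_1$ is a cyclic subgroup of order $M$ of an elliptic curve over $\mathbb C$ and $f\colon E_1\to E$ is an isogeny of degree $N$ with $f(C_1)=C$, modulo the equivalence $(f_1,E_1,C_1)\cong(f_2,E_2,C_2)$ if there is an isogeny $g\colon E_1\to E_2$ with $f_1=f_2\circ g$ and $g(C_1)=C_2$. Let $P_N(E,C)\subset I_N(E,C)$ be the subset of the classes in which $f$ has cyclic kernel. If $\gcd(M,N)=1$, then there are unique polynomials $\Phi_N^{\Gamma_0(M)},\Psi_N^{\Gamma_0(M)}\in\mathbb C[X,Y]$ such that for all pairs $(E,C)$, $(E',C')$ as above $$\Phi_N^{\Gamma_0(M)}\bigl(t(E,C),t(E',C')\bigr)=\prod_{[f,E_1',C_1']\in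 I_N(E',C')}\bigl(t(E,C)-t(E_1',C_1')\bigr),$$ $$\Psi_N^{\Gamma_0(M)}\bigl(t(E,C),t(E',C')\bigr)=\prod_{[f,E_1',C_1']\in P_N(E',C')}\bigl(t(E,C)-t(E_1',C_1')\bigr).$$ They have integer coefficients, that is, $\Phi_N^{\Gamma_0(M)},\Psi_N^{\Gamma_0(M)}\in\mathbb Z[X,Y]$, and $$\deg_X\Phi_N^{\Gamma_0(M)}=\deg_Y\Phi_N^{\Gamma_0(M)},\qquad \deg_X\Psi_N^{\Gamma_0(M)}=\deg_Y\Psi_N^{\Gamma_0(M)}=[\mathrm{SL}_2(\mathbb Z):\Gamma_0(N)].$$ -/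

import Mathlib

open scoped ModularForm UpperHalfPlane

noncomputable section

/-- An elliptic curve over `ℂ`, presented as a complex torus `ℂ / Λ`, where `Λ = ℤ ω₁ + ℤ ω₂` for
some `ω₁, ω₂` that are linearly independent over `ℝ`. -/
structure ComplexEllipticCurve where
  lattice : AddSubgroup ℂ
  exists_periods : ∃ ω₁ ω₂ : ℂ, LinearIndependent ℝ ![ω₁, ω₂] ∧
    lattice = AddSubgroup.closure {ω₁, ω₂}

namespace ComplexEllipticCurve

/-- The group of points `ℂ / Λ`. -/
abbrev Point (E : ComplexEllipticCurve) : Type := ℂ ⧸ E.lattice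

/-- The elliptic curve `E_τ = ℂ / (ℤ + ℤ τ)`. -/
def ofUpperHalfPlane (τ : ℍ) : ComplexEllipticCurve where
  lattice := AddSubgroup.closure {1, (τ : ℂ)}
  exists_periods := by
    refine ⟨1, τ, ?_, rfl⟩
    rw [LinearIndependent.pair_iff]
    intro s t h
    have him := congrArg Complex.im h
    have hre := congrArg Complex.re h
    have ht : t = 0 := by simpa [τ.im_pos.ne'] using him
    subst ht
    exact ⟨by simpa using hre, rfl⟩

/-- An isogeny of elliptic curves over `ℂ`: a surjective group homomorphism with finite kernel
`ℂ / Λ₁ → ℂ / Λ₂` that is holomorphic, i.e. that lifts to a holomorphic map of the universal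
coverings `ℂ → ℂ`. -/
structure Isogeny (E₁ E₂ : ComplexEllipticCurve) where
  hom : E₁.Point →+ E₂.Point
  surjective : Function.Surjective hom
  finite_ker : Finite hom.ker
  holomorphic : ∃ F : ℂ → ℂ, Differentiable ℂ F ∧
    ∀ z : ℂ, hom (QuotientAddGroup.mk z) = QuotientAddGroup.mk (F z)

namespace Isogeny

variable {E₁ E₂ E₃ : ComplexEllipticCurve}

/-- The degree of an isogeny is the order of its kernel. -/
def degree (f : Isogeny E₁ E₂) : ℕ := Nat.card f.hom.ker

/-- An isogeny is cyclic if its kernel is a cyclic group. -/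
def IsCyclic (f : Isogeny E₁ E₂) : Prop := IsAddCyclic f.hom.ker

/-- The identity isogeny. -/
def refl (E : ComplexEllipticCurve) : Isogeny E E where
  hom := AddMonoidHom.id _
  surjective := fun x => ⟨x, rfl⟩
  finite_ker := by
    have : (AddMonoidHom.id E.Point).ker = ⊥ :=
      (AddMonoidHom.ker_eq_bot_iff _).2 fun _ _ h => h
    rw [this]
    infer_instance
  holomorphic := ⟨id, differentiable_id, fun _ => rfl⟩

/-- The composition of two isogenies. -/
def comp (g : Isogeny E₂ E₃) (f : Isogeny E₁ E₂) : Isogeny E₁ E₃ where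
  hom := g.hom.comp f.hom
  surjective := g.surjective.comp f.surjective
  finite_ker := by
    have hg : (g.hom.ker : Set E₂.Point).Finite := g.finite_ker
    have hf : (f.hom.ker : Set E₁.Point).Finite := f.finite_ker
    refine Set.Finite.subset (hg.preimage' (f := f.hom) fun b _ => ?_) fun x hx => hx
    obtain ⟨a, rfl⟩ := f.surjective b
    refine (hf.image fun x => a + x).subset fun x hx => ⟨x - a, ?_, by simp⟩
    have hx' : f.hom x = f.hom a := hx
    simp [AddMonoidHom.mem_ker, hx']
  holomorphic := by
    obtain ⟨F, hF, hFf⟩ := f.holomorphic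
    obtain ⟨G, hG, hGg⟩ := g.holomorphic
    exact ⟨G ∘ F, hG.comp hF, fun z => by simp [hFf, hGg]⟩

/-- Every isogeny is induced by multiplication by a complex number. -/
lemma exists_mul (f : Isogeny E₁ E₂) : ∃ α : ℂ, ∀ z : ℂ,
    f.hom (QuotientAddGroup.mk z) = QuotientAddGroup.mk (α * z) := by
  obtain ⟨F, hF, hFf⟩ := f.holomorphic
  have hcount : (E₂.lattice : Set ℂ).Countable := by
    obtain ⟨ω₁, ω₂, -, h⟩ := E₂.exists_periods
    refine (Set.countable_range fun p : ℤ × ℤ => p.1 • ω₁ + p.2 • ω₂).mono fun x hx => ?_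
    rw [h, SetLike.mem_coe, AddSubgroup.mem_closure_pair] at hx
    obtain ⟨m, n, rfl⟩ := hx
    exact ⟨(m, n), rfl⟩
  have hadd : ∀ w z, F (z + w) - F z - F w = F (0 + w) - F 0 - F w := by
    intro w z
    have hc : Continuous fun z => F (z + w) - F z - F w := by
      have := hF.continuous
      fun_prop
    have hz : ∀ z, (QuotientAddGroup.mk (F (z + w) - F z - F w) : E₂.Point) = 0 := by
      intro z
      simp only [QuotientAddGroup.mk_sub, ← hFf, QuotientAddGroup.mk_add, map_add]
      abel
    have hsub : (fun z => F (z + w) - F z - F w) '' Set.univ ⊆ (E₂.lattice : Set ℂ) := by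
      rintro _ ⟨z, -, rfl⟩
      exact (QuotientAddGroup.eq_zero_iff _).1 (hz z)
    exact hcount.isTotallyDisconnected _ hsub (isPreconnected_univ.image _ hc.continuousOn)
      (Set.mem_image_of_mem _ (Set.mem_univ z)) (Set.mem_image_of_mem _ (Set.mem_univ 0))
  have hderiv : ∀ w, deriv F w = deriv F 0 := by
    intro w
    have h : (fun z => F (z + w)) = fun z => F z + (F w + (F (0 + w) - F 0 - F w)) := by
      funext z
      linear_combination hadd w z
    have h2 := congrFun (congrArg deriv h) 0
    rw [deriv_comp_add_const, deriv_add_const, zero_add] at h2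
    exact h2
  refine ⟨deriv F 0, fun z => ?_⟩
  have hconst : ∀ z, F z - deriv F 0 * z = F 0 - deriv F 0 * 0 := by
    intro z
    refine is_const_of_deriv_eq_zero (f := fun z => F z - deriv F 0 * z) (by fun_prop)
      (fun w => ?_) z 0
    rw [deriv_fun_sub (hF w) (by fun_prop), hderiv w, deriv_const_mul_field]
    simp
  have h0 : (QuotientAddGroup.mk (F 0) : E₂.Point) = 0 := by
    rw [← hFf, QuotientAddGroup.mk_zero, map_zero]
  have hz : F z = deriv F 0 * z + F 0 := by linear_combination hconst z
  rw [hFf, hz, QuotientAddGroup.mk_add, h0, add_zero]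

/-- The inverse of an injective isogeny. -/
def inverse (f : Isogeny E₁ E₂) (hf : Function.Injective f.hom) : Isogeny E₂ E₁ where
  hom := (AddEquiv.ofBijective f.hom ⟨hf, f.surjective⟩).symm.toAddMonoidHom
  surjective := (AddEquiv.ofBijective f.hom ⟨hf, f.surjective⟩).symm.surjective
  finite_ker := by
    rw [(AddMonoidHom.ker_eq_bot_iff _).2
      (AddEquiv.ofBijective f.hom ⟨hf, f.surjective⟩).symm.injective]
    infer_instance
  holomorphic := by
    obtain ⟨α, hα⟩ := f.exists_mul
    refine ⟨fun z => α⁻¹ * z, by fun_prop, fun z => ?_⟩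
    refine (AddEquiv.symm_apply_eq _).2 ?_
    change QuotientAddGroup.mk z = f.hom (QuotientAddGroup.mk (α⁻¹ * z))
    rw [hα]
    by_cases h : α = 0
    · obtain ⟨x, hx⟩ := f.surjective (QuotientAddGroup.mk z)
      obtain ⟨w, rfl⟩ := QuotientAddGroup.mk_surjective x
      rw [← hx, hα, h, zero_mul, zero_mul]
    · rw [mul_inv_cancel_left₀ h]

@[simp] lemma hom_inverse_apply (f : Isogeny E₁ E₂) (hf : Function.Injective f.hom)
    (y : E₂.Point) : f.hom ((f.inverse hf).hom y) = y :=
  (AddEquiv.ofBijective f.hom ⟨hf, f.surjective⟩).apply_symm_apply y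

@[simp] lemma inverse_hom_apply (f : Isogeny E₁ E₂) (hf : Function.Injective f.hom)
    (x : E₁.Point) : (f.inverse hf).hom (f.hom x) = x :=
  (AddEquiv.ofBijective f.hom ⟨hf, f.surjective⟩).symm_apply_apply x

lemma inverse_injective (f : Isogeny E₁ E₂) (hf : Function.Injective f.hom) :
    Function.Injective (f.inverse hf).hom :=
  Function.LeftInverse.injective (f.hom_inverse_apply hf)

/-- An isogeny through which an isogeny of the same degree factors is injective. -/
lemma injective_of_comp {g : Isogeny E₁ E₂} {f₁ : Isogeny E₁ E₃} {f₂ : Isogeny E₂ E₃}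
    (h : f₁.hom = f₂.hom.comp g.hom) (hd : f₁.degree = f₂.degree) :
    Function.Injective g.hom := by
  have := f₁.finite_ker
  have := f₂.finite_ker
  have hmem : ∀ x : E₁.Point, x ∈ f₁.hom.ker ↔ g.hom x ∈ f₂.hom.ker := by
    intro x
    simp [AddMonoidHom.mem_ker, h]
  let k : f₁.hom.ker → f₂.hom.ker := fun x => ⟨g.hom x, (hmem x).1 x.2⟩
  have hk : Function.Surjective k := by
    rintro ⟨y, hy⟩
    obtain ⟨x, rfl⟩ := g.surjective y
    exact ⟨⟨x, (hmem x).2 hy⟩, rfl⟩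
  have hinj : Function.Injective k :=
    ((Nat.bijective_iff_surjective_and_card k).2 ⟨hk, hd⟩).1
  refine (injective_iff_map_eq_zero _).2 fun x hx => ?_
  have hx1 : x ∈ f₁.hom.ker := (hmem x).2 (by rw [hx]; exact zero_mem _)
  have h2 : k ⟨x, hx1⟩ = k 0 := Subtype.ext (by simp [k, hx])
  exact congrArg Subtype.val (hinj h2)

end Isogeny
end ComplexEllipticCurve

open ComplexEllipticCurve

/-- The eta quotient `t` attached to those `M > 1` for which `X₀(M)` has genus zero (the value for
all other `M` is a dummy). -/
def etaHauptmodul (M : ℕ) (τ : ℍ) : ℂ :=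
  match M with
  | 2 => η τ ^ 24 / η (2 * τ) ^ 24
  | 3 => η τ ^ 12 / η (3 * τ) ^ 12
  | 4 => η τ ^ 8 / η (4 * τ) ^ 8
  | 5 => η τ ^ 6 / η (5 * τ) ^ 6
  | 6 => η τ ^ 5 * η (3 * τ) / (η (2 * τ) * η (6 * τ) ^ 5)
  | 7 => η τ ^ 4 / η (7 * τ) ^ 4
  | 8 => η τ ^ 4 * η (4 * τ) ^ 2 / (η (2 * τ) ^ 2 * η (8 * τ) ^ 4)
  | 9 => η τ ^ 3 / η (9 * τ) ^ 3
  | 10 => η τ ^ 3 * η (5 * τ) / (η (2 * τ) * η (10 * τ) ^ 3)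
  | 12 => η τ ^ 3 * η (4 * τ) * η (6 * τ) ^ 2 / (η (2 * τ) ^ 2 * η (3 * τ) * η (12 * τ) ^ 3)
  | 13 => η τ ^ 2 / η (13 * τ) ^ 2
  | 16 => η τ ^ 2 * η (8 * τ) / (η (2 * τ) * η (16 * τ) ^ 2)
  | 18 => η τ ^ 2 * η (6 * τ) * η (9 * τ) / (η (2 * τ) * η (3 * τ) * η (18 * τ) ^ 2)
  | 25 => η τ / η (25 * τ)
  | _ => 0

/-- An elliptic curve with level structure for `Γ₀(M)`: a pair `(E, C)` of an elliptic curve `E`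
over `ℂ` and a cyclic subgroup `C` of `E` of order `M`. -/
structure Gamma0Curve (M : ℕ) where
  curve : ComplexEllipticCurve
  C : AddSubgroup curve.Point
  isAddCyclic : IsAddCyclic C
  card_eq : Nat.card C = M

namespace Gamma0Curve

variable {M : ℕ}

/-- `(E, C)` is isomorphic to `(E_τ, ⟨1 / M + Λ_τ⟩)`, i.e. the class of `(E, C)` corresponds to the
point of `Y₀(M) = Γ₀(M) \ ℍ` represented by `τ`. -/
def IsRepresentedBy (X : Gamma0Curve M) (τ : ℍ) : Prop :=
  ∃ g : Isogeny X.curve (ofUpperHalfPlane τ), Function.Injective g.hom ∧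
    X.C.map g.hom = AddSubgroup.zmultiples (QuotientAddGroup.mk (1 / (M : ℂ)))

/-- The value `t(E, C) = t(τ)`, where `τ` is any point of the upper half plane with
`(E, C) ≅ (E_τ, ⟨1 / M + Λ_τ⟩)`. -/
def t (X : Gamma0Curve M) : ℂ :=
  etaHauptmodul M (Classical.epsilon X.IsRepresentedBy)

/-- `t(E, C)` depends only on the isomorphism class of `(E, C)`. -/
lemma t_eq_of_iso {X Y : Gamma0Curve M} (g : Isogeny X.curve Y.curve)
    (hg : Function.Injective g.hom) (hC : X.C.map g.hom = Y.C) : X.t = Y.t := by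
  have h : X.IsRepresentedBy = Y.IsRepresentedBy := by
    funext τ
    refine propext ⟨?_, ?_⟩
    · rintro ⟨f, hf, hfC⟩
      refine ⟨f.comp (g.inverse hg), hf.comp (g.inverse_injective hg), ?_⟩
      rw [← hfC, ← hC, AddSubgroup.map_map]
      congr 1
      ext x
      simp [Isogeny.comp]
    · rintro ⟨f, hf, hfC⟩
      refine ⟨f.comp g, hf.comp hg, ?_⟩
      rw [← hfC, ← hC, AddSubgroup.map_map]
      rfl
  simp only [t, h]

/-- The triples `(f, E₁, C₁)` consisting of `(E₁, C₁)` with level structure for `Γ₀(M)` and an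
isogeny `f : E₁ → E` of degree `N` with `f(C₁) = C`. -/
structure IsogenyTo (N : ℕ) (X : Gamma0Curve M) where
  source : Gamma0Curve M
  isog : Isogeny source.curve X.curve
  degree_eq : isog.degree = N
  map_C : source.C.map isog.hom = X.C

/-- `(f₁, E₁, C₁) ≅ (f₂, E₂, C₂)` if there is an isogeny `g : E₁ → E₂` with `f₁ = f₂ ∘ g` and
`g(C₁) = C₂`. -/
def IsogenyTo.Equivalent {N : ℕ} {X : Gamma0Curve M} (A B : X.IsogenyTo N) : Prop :=
  ∃ g : Isogeny A.source.curve B.source.curve,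
    A.isog.hom = B.isog.hom.comp g.hom ∧ A.source.C.map g.hom = B.source.C

lemma IsogenyTo.injective {N : ℕ} {X : Gamma0Curve M} {A B : X.IsogenyTo N}
    {g : Isogeny A.source.curve B.source.curve} (h : A.isog.hom = B.isog.hom.comp g.hom) :
    Function.Injective g.hom :=
  Isogeny.injective_of_comp h (A.degree_eq.trans B.degree_eq.symm)

instance IsogenyTo.setoid (N : ℕ) (X : Gamma0Curve M) : Setoid (X.IsogenyTo N) where
  r := IsogenyTo.Equivalent
  iseqv :=
    { refl := fun A => ⟨Isogeny.refl _, rfl, AddSubgroup.map_id _⟩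
      symm := by
        rintro A B ⟨g, h, hC⟩
        refine ⟨g.inverse (IsogenyTo.injective h), ?_, ?_⟩
        · ext x
          simp [h]
        · rw [← hC, AddSubgroup.map_map]
          convert AddSubgroup.map_id _
          ext x
          simp
      trans := by
        rintro A B D ⟨g, h, hC⟩ ⟨k, h', hC'⟩
        refine ⟨k.comp g, ?_, ?_⟩
        · rw [h, h']
          rfl
        · rw [← hC', ← hC, AddSubgroup.map_map]
          rfl }

/-- The set `I_N(E, C)` of equivalence classes `[f, E₁, C₁]`. -/
def IsogenyClasses (N : ℕ) (X : Gamma0Curve M) : Type :=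
  Quotient (IsogenyTo.setoid N X)

/-- The set `P_N(E, C)` of the classes `[f, E₁, C₁]` in which `f` is a cyclic isogeny. -/
def cyclicIsogenyClasses (N : ℕ) (X : Gamma0Curve M) : Set (X.IsogenyClasses N) :=
  {c | ∃ A : X.IsogenyTo N, A.isog.IsCyclic ∧ Quotient.mk _ A = c}

/-- The value `t(E₁, C₁)` of a class `[f, E₁, C₁]`. -/
def IsogenyClasses.t {N : ℕ} {X : Gamma0Curve M} (c : X.IsogenyClasses N) : ℂ :=
  Quotient.lift (fun A : X.IsogenyTo N => A.source.t)
    (by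
      rintro A B ⟨g, h, hC⟩
      exact t_eq_of_iso g (IsogenyTo.injective h) hC) c

/-- The value at `((E, C), (E', C'))` of `Φ_N`, i.e. the product of `t(E, C) - t(E₁', C₁')` over
all classes `[f, E₁', C₁']` in `I_N(E', C')`. -/
def phiValue (N : ℕ) (X X' : Gamma0Curve M) : ℂ :=
  ∏ᶠ c : X'.IsogenyClasses N, (X.t - c.t)

/-- The value at `((E, C), (E', C'))` of `Ψ_N`, i.e. the product of `t(E, C) - t(E₁', C₁')` over
all classes `[f, E₁', C₁']` in `P_N(E', C')`. -/
def psiValue (N : ℕ) (X X' : Gamma0Curve M) : ℂ :=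
  ∏ᶠ c ∈ X'.cyclicIsogenyClasses N, (X.t - c.t)

end Gamma0Curve

/-- `P ∈ ℂ[X, Y]` (with `X`, `Y` the variables with index `0`, `1`) is the modular polynomial
`Φ_N` for `Γ₀(M)`: its value at `(t(E, C), t(E', C'))` is that of `Φ_N` for all `(E, C)` and
`(E', C')`. -/
def IsModularPolynomialPhi (M N : ℕ) (P : MvPolynomial (Fin 2) ℂ) : Prop :=
  ∀ X X' : Gamma0Curve M, MvPolynomial.eval ![X.t, X'.t] P = X.phiValue N X'

/-- `P ∈ ℂ[X, Y]` (with `X`, `Y` the variables with index `0`, `1`) is the modular polynomial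
`Ψ_N` for `Γ₀(M)`: its value at `(t(E, C), t(E', C'))` is that of `Ψ_N` for all `(E, C)` and
`(E', C')`. -/
def IsModularPolynomialPsi (M N : ℕ) (P : MvPolynomial (Fin 2) ℂ) : Prop :=
  ∀ X X' : Gamma0Curve M, MvPolynomial.eval ![X.t, X'.t] P = X.psiValue N X'

end

/-!
Write `t` for the Hauptmodul of level `M`, an eta quotient, and `q = exp (2πiτ)`. The classes in
`I_N(E_τ, ⟨1 / M⟩)` correspond to the sublattices of index `N` of `Λ_τ`: as `M` and `N` are coprime,
the level structure on the source of an isogeny is determined by that on the target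
(`Gamma0Curve.IsogenyTo.HasLattice.equivalent`). The sublattices have Hermite bases, so they
correspond to the triples `(a, b, d)` with `a d = N` and `0 ≤ b < d`, and the source of the isogeny
with triple `(a, b, d)` is represented by `(a τ + b) / d`. The kernel is cyclic if and only if
`gcd(a, b, d) = 1`, and these primitive triples correspond to the cosets of `Γ₀(N)` in `SL₂(ℤ)`
(`card_primitiveIndex`). The values of `Φ_N` and `Ψ_N` are thus those of the polynomial
`∏ (X - t((a τ + b) / d))` over all triples, or over the primitive ones, at `X = t(E, C)`.

The coefficients of this polynomial, for all triples, are holomorphic on `ℍ`, invariant under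
`Γ₀(M)`, and bounded at the cusps other than `∞`. Their Laurent series in `q` have integer
coefficients: for fixed `d` the product over `b` is, after clearing denominators, a norm from power
series in `q ^ (1 / d)` to power series in `q`, and such norms can be written as resultants over the
ring of integral power series (`exists_norm_series`). As `t = q⁻¹ + ⋯` has integer coefficients and
its only pole is at `∞`, subtracting multiples of powers of `t` shows that a function of this kind
is an integral polynomial in `t` (`exists_polynomial_of_intSeries`), of degree the order of its
pole. This gives `Φ_N`. The sum `σ(N)` of the divisors `a` bounds the order of the pole of all
coefficients, and it is attained by the constant coefficient, so the two degrees of `Φ_N` are both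
`σ(N)`. Sorting the triples by their greatest common divisor gives `Φ_N = ∏ Ψ_{N / e²}` over the `e`
with `e² ∣ N`; division by a monic polynomial then gives `Ψ_N`, and additivity of degrees its degree
in `Y` (`exists_primitiveModularPolynomial`). Uniqueness holds since `t` takes infinitely many
values.

All this rests on the invariance of the eta quotients under `Γ₀(M)` (`Gamma0_le_etaStabilizer`). The
modular discriminant shows that `t` is multiplied by a root of unity under `γ ∈ Γ₀(M)`. This root of
unity is `1` if `γ` is elliptic, as `γ` has a fixed point and `t` has no zeros, and if `γ` is
parabolic, as the orders of `t` at the cusps are integers. A descent on the lower left entry shows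
that products of such elements and of `-1` exhaust `Γ₀(M)`; the descent amounts to a covering of the
unit interval by finitely many intervals, for which a check is possible for each `M`.
-/

open ComplexEllipticCurve
open Filter Topology UpperHalfPlane
open scoped MatrixGroups Real

/-! ### The eta quotients of genus zero -/

/-- The eta quotient `∏ η(k z) ^ r` attached to a list of pairs `(k, r)`. -/
noncomputable def etaQuotient (L : List (ℕ × ℤ)) (z : ℂ) : ℂ :=
  (L.map fun p => η (p.1 * z) ^ p.2).prod

/-- The pairs `(k, r)` with `t = ∏ η(k τ) ^ r` for the Hauptmodul `t` of level `M`; the empty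
list is a dummy for the other `M`. -/
def etaExponents (M : ℕ) : List (ℕ × ℤ) :=
  match M with
  | 2 => [(1, 24), (2, -24)]
  | 3 => [(1, 12), (3, -12)]
  | 4 => [(1, 8), (4, -8)]
  | 5 => [(1, 6), (5, -6)]
  | 6 => [(1, 5), (3, 1), (2, -1), (6, -5)]
  | 7 => [(1, 4), (7, -4)]
  | 8 => [(1, 4), (4, 2), (2, -2), (8, -4)]
  | 9 => [(1, 3), (9, -3)]
  | 10 => [(1, 3), (5, 1), (2, -1), (10, -3)]
  | 12 => [(1, 3), (4, 1), (6, 2), (2, -2), (3, -1), (12, -3)]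
  | 13 => [(1, 2), (13, -2)]
  | 16 => [(1, 2), (8, 1), (2, -1), (16, -2)]
  | 18 => [(1, 2), (6, 1), (9, 1), (2, -1), (3, -1), (18, -2)]
  | 25 => [(1, 1), (25, -1)]
  | _ => []

/-- The levels `M > 1` for which `X₀(M)` has genus zero. -/
abbrev genusZeroLevels : Finset ℕ := {2, 3, 4, 5, 6, 7, 8, 9, 10, 12, 13, 16, 18, 25}

lemma etaHauptmodul_eq_etaQuotient {M : ℕ} (hM : M ∈ genusZeroLevels) (τ : ℍ) :
    etaHauptmodul M τ = etaQuotient (etaExponents M) τ := by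
  simp only [genusZeroLevels, Finset.mem_insert, Finset.mem_singleton] at hM
  rcases hM with
    rfl | rfl | rfl | rfl | rfl | rfl | rfl | rfl | rfl | rfl | rfl | rfl | rfl | rfl <;>
  · simp only [etaHauptmodul, etaQuotient, etaExponents, List.map_cons, List.map_nil,
      List.prod_cons, List.prod_nil, Nat.cast_one, one_mul, mul_one, Nat.cast_ofNat, zpow_neg,
      zpow_ofNat, pow_one, div_eq_mul_inv, mul_inv, mul_assoc]

/-- The order at the cusp `a / c` of the eta quotient `∏ η(k τ) ^ r`, multiplied by `24 M` and
divided by the width; here `g` may be `c` or `gcd(c, M)`. -/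
def cuspOrder (L : List (ℕ × ℤ)) (M g : ℕ) : ℤ :=
  (L.map fun p => p.2 * ((Nat.gcd p.1 g ^ 2 * (M / p.1) : ℕ) : ℤ)).sum

lemma etaExponents_dvd : ∀ M ∈ genusZeroLevels, ∀ p ∈ etaExponents M, 0 < p.1 ∧ p.1 ∣ M := by
  decide

lemma etaExponents_sum : ∀ M ∈ genusZeroLevels, ((etaExponents M).map Prod.snd).sum = 0 := by
  decide

lemma etaExponents_weighted_sum :
    ∀ M ∈ genusZeroLevels, ((etaExponents M).map fun p => (p.1 : ℤ) * p.2).sum = -24 := by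
  decide

/-- At every cusp the Hauptmodul has integral order, and at the cusps inequivalent to `∞` it has no
pole; here `M / gcd(M, g²)` is the width of the cusps `a / c` with `gcd(c, M) = g`. -/
lemma etaExponents_cuspOrder : ∀ M ∈ genusZeroLevels, ∀ g ∈ Finset.range (M + 1), g ∣ M →
    (24 * M : ℤ) ∣ cuspOrder (etaExponents M) M g * ((M / Nat.gcd M (g ^ 2) : ℕ) : ℤ) ∧
      (g ≠ M → 0 ≤ cuspOrder (etaExponents M) M g) := by
  decide +kernel

/-! ### Transformation of eta quotients up to roots of unity -/

lemma im_affine_pos {A D : ℕ} (hA : 0 < A) (hD : 0 < D) (B : ℤ) {z : ℂ} (hz : 0 < z.im) :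
    0 < ((A * z + B) / D : ℂ).im := by
  have hD0 : (D : ℂ) ≠ 0 := by exact_mod_cast hD.ne'
  rw [show (A * z + B) / D = ((A / D : ℝ) : ℂ) * z + ((B / D : ℝ) : ℂ) by push_cast; field_simp]
  simp only [Complex.add_im, Complex.im_ofReal_mul, Complex.ofReal_im,
    add_zero]
  positivity

lemma int_mul_add_ne_zero {c d : ℤ} (h : c ≠ 0 ∨ d ≠ 0) {z : ℂ} (hz : 0 < z.im) :
    (c * z + d : ℂ) ≠ 0 := by
  intro h0
  have h1 := congrArg Complex.im h0
  have h2 := congrArg Complex.re h0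
  simp only [Complex.add_im, Complex.mul_im, Complex.intCast_re, Complex.intCast_im, zero_mul,
    add_zero, Complex.zero_im, mul_eq_zero, hz.ne', or_false, Int.cast_eq_zero] at h1
  subst h1
  simp at h2
  simp_all

/-- The modularity of the discriminant `η ^ 24`. -/
lemma eta_moebius_pow {a b c d : ℤ} (h : a * d - b * c = 1) {z : ℂ} (hz : 0 < z.im) :
    η ((a * z + b) / (c * z + d)) ^ 24 = (c * z + d) ^ 12 * η z ^ 24 := by
  let γ : SL(2, ℤ) := ⟨!![a, b; c, d], by simpa [Matrix.det_fin_two] using h⟩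
  have h1 := SlashInvariantForm.slash_action_eqn' CuspForm.discriminant
    (γ := Matrix.SpecialLinearGroup.mapGL ℝ γ) (MonoidHom.mem_range.2 ⟨γ, rfl⟩) ⟨z, hz⟩
  simp only [CuspForm.coe_discriminant, ModularForm.discriminant] at h1
  have h2 : ((Matrix.SpecialLinearGroup.mapGL ℝ γ • (⟨z, hz⟩ : ℍ) : ℍ) : ℂ) =
      (a * z + b) / (c * z + d) := by
    refine (coe_specialLinearGroup_apply γ ⟨z, hz⟩).trans ?_
    simp [γ]
  rw [h2] at h1
  have h3 : (Matrix.SpecialLinearGroup.mapGL ℝ γ) 1 0 = c := rfl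
  have h4 : (Matrix.SpecialLinearGroup.mapGL ℝ γ) 1 1 = d := rfl
  rw [h3, h4] at h1
  rw [h1]
  push_cast
  norm_cast

/-- For `σ = (a b; c d)` in `SL₂(ℤ)`, the matrix `(k 0; 0 1) σ` is the product of an element of
`SL₂(ℤ)` and an upper triangular matrix `(A B; 0 D)`, whence a formula for `η(k σ z)` up to roots
of unity. -/
lemma eta_mul_moebius_pow {k : ℕ} (hk : 0 < k) {a b c d : ℤ} (hdet : a * d - b * c = 1) :
    ∃ A D : ℕ, ∃ B : ℤ, 0 < A ∧ 0 < D ∧ A * D = k ∧ A = Nat.gcd k c.natAbs ∧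
      ∀ z : ℂ, 0 < z.im → η (k * ((a * z + b) / (c * z + d))) ^ 24 =
        ((c * z + d) / D) ^ 12 * η ((A * z + B) / D) ^ 24 := by
  obtain ⟨A, hA⟩ : ∃ A, A = Nat.gcd k c.natAbs := ⟨_, rfl⟩
  have hA0 : 0 < A := hA ▸ Nat.gcd_pos_of_pos_left _ hk
  obtain ⟨D, hD⟩ : A ∣ k := hA ▸ Nat.gcd_dvd_left _ _
  obtain ⟨r, hr⟩ : (A : ℤ) ∣ c := Int.natCast_dvd.2 (hA ▸ Nat.gcd_dvd_right _ _)
  have hD0 : 0 < D := by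
    rcases Nat.eq_zero_or_pos D with rfl | h
    · omega
    · exact h
  have hA0' : (A : ℤ) ≠ 0 := by exact_mod_cast hA0.ne'
  have hk' : (k : ℤ) = A * D := by exact_mod_cast hD
  have hcop : IsCoprime ((D : ℤ) * a) r := by
    refine IsCoprime.mul_left ?_ ⟨d, -b * A, by rw [hr] at hdet; linear_combination hdet⟩
    have h1 : (A : ℤ) = k * k.gcdA c.natAbs + (c.natAbs : ℤ) * k.gcdB c.natAbs := by
      rw [hA]; exact Nat.gcd_eq_gcd_ab _ _
    have hs : (c.natAbs : ℤ) = c.sign * (A * r) := by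
      rw [← hr, Int.sign_mul_self_eq_abs, Int.natCast_natAbs]
    refine ⟨k.gcdA c.natAbs, c.sign * k.gcdB c.natAbs, ?_⟩
    apply mul_left_cancel₀ hA0'
    rw [hs, hk'] at h1
    linear_combination -h1
  obtain ⟨v, w, hvw⟩ := hcop
  refine ⟨A, D, v * k * b + w * d, hA0, hD0, hD.symm, hA, fun z hz => ?_⟩
  have hD0' : (D : ℂ) ≠ 0 := by exact_mod_cast hD0.ne'
  have key := eta_moebius_pow (a := D * a) (b := -w) (c := r) (d := v)
    (by linear_combination hvw) (im_affine_pos hA0 hD0 (v * k * b + w * d) hz)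
  have hkC : (k : ℂ) = A * D := by exact_mod_cast hD
  have hrC : (c : ℂ) = A * r := by exact_mod_cast hr
  have hvwC : (v : ℂ) * (D * a) + w * r = 1 := by exact_mod_cast hvw
  have hdetC : (a : ℂ) * d - b * c = 1 := by exact_mod_cast hdet
  rw [hrC] at hdetC
  have hden : (r : ℂ) * ((A * z + (v * k * b + w * d : ℤ)) / D) + v = (c * z + d) / D := by
    push_cast
    field_simp
    rw [hkC, hrC]
    linear_combination d * hvwC - (D * v : ℂ) * hdetC
  have hcd : c ≠ 0 ∨ d ≠ 0 := by
    by_contra! h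
    simp [h.1, h.2] at hdet
  have hden0 : (c * z + d : ℂ) ≠ 0 := int_mul_add_ne_zero hcd hz
  rw [hden] at key
  rw [← key]
  congr 2
  rw [mul_div_assoc', div_eq_div_iff hden0 (div_ne_zero hden0 hD0')]
  push_cast
  field_simp
  rw [hkC]
  linear_combination (c * z + d : ℂ) * (-(A * D * b : ℂ) * hvwC - D * w * hdetC)

/-- A continuous function on the upper half plane one of whose powers is constant is constant. -/
lemma eq_const_of_pow_eq_const {f : ℍ → ℂ} (hf : Continuous f) {n : ℕ} (hn : 0 < n) {K : ℂ}
    (h : ∀ z, f z ^ n = K) (z w : ℍ) : f z = f w := by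
  have hfin : (Set.range f).Finite := by
    refine (Polynomial.nthRoots n K).toFinset.finite_toSet.subset ?_
    rintro _ ⟨z, rfl⟩
    simpa [Polynomial.mem_nthRoots hn] using h z
  exact hfin.countable.isTotallyDisconnected _ subset_rfl
    (isPreconnected_range hf) ⟨z, rfl⟩ ⟨w, rfl⟩

lemma continuous_eta_comp {g : ℍ → ℂ} (hg : Continuous g) (hpos : ∀ z, 0 < (g z).im) :
    Continuous fun z => η (g z) := by
  refine continuous_iff_continuousAt.2 fun z =>
    ContinuousAt.comp (g := ModularForm.eta) ?_ hg.continuousAt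
  exact (ModularForm.differentiableAt_eta_of_mem_upperHalfPlaneSet (hpos z)).continuousAt

/-- The Euler product is continuous at `q = 0`. -/
lemma tendsto_tprod_one_sub_pow_zero :
    Tendsto (fun q : ℂ => ∏' n : ℕ, (1 - q ^ (n + 1))) (𝓝 0) (𝓝 1) := by
  have h := (ModularForm.differentiableOn_tprod_one_sub_pow.differentiableAt
    (Metric.ball_mem_nhds 0 one_pos)).continuousAt.tendsto
  simpa using h

/-- `η(z) ~ exp(2πi z / 24)` as `Im z → ∞`, here for `z` replaced by `(A z + B) / D`. -/
lemma tendsto_eta_affine {A D : ℕ} (hA : 0 < A) (hD : 0 < D) (B : ℤ) :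
    Tendsto (fun z : ℍ => η ((A * z + B) / D) *
      Complex.exp (-(2 * π * Complex.I * ((A * z + B) / D) / 24)))
      atImInfty (𝓝 1) := by
  have h1 : ∀ z : ℍ, η ((A * z + B) / D) *
      Complex.exp (-(2 * π * Complex.I * ((A * z + B) / D) / 24)) =
      ∏' n : ℕ, (1 - Function.Periodic.qParam 1 ((A * z + B) / D) ^ (n + 1)) := by
    intro z
    rw [ModularForm.eta, Function.Periodic.qParam]
    push_cast
    rw [mul_right_comm, ← Complex.exp_add]
    simp
  simp_rw [h1]
  refine tendsto_tprod_one_sub_pow_zero.comp ?_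
  rw [tendsto_zero_iff_norm_tendsto_zero]
  have h2 : ∀ z : ℍ, ‖Function.Periodic.qParam 1 ((A * z + B) / D : ℂ)‖ =
      Real.exp (-(2 * π * A / D) * z.im) := by
    intro z
    have hD0 : (D : ℂ) ≠ 0 := by exact_mod_cast hD.ne'
    rw [Function.Periodic.norm_qParam]
    rw [show (A * (z : ℂ) + B) / D = ((A / D : ℝ) : ℂ) * z + ((B / D : ℝ) : ℂ) by
      push_cast; field_simp]
    simp only [Complex.add_im, Complex.im_ofReal_mul, Complex.ofReal_im,
      add_zero]
    congr 1
    rw [UpperHalfPlane.coe_im]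
    ring
  simp_rw [h2]
  have h3 : Tendsto (fun z : ℍ => z.im) atImInfty atTop := tendsto_comap
  have hpos : 0 < 2 * π * A / D := by positivity
  refine Real.tendsto_exp_atBot.comp ?_
  exact h3.const_mul_atTop_of_neg (by linarith)

lemma etaQuotient_nil (z : ℂ) : etaQuotient [] z = 1 := by simp [etaQuotient]

lemma etaQuotient_cons (p : ℕ × ℤ) (L : List (ℕ × ℤ)) (z : ℂ) :
    etaQuotient (p :: L) z = η (p.1 * z) ^ p.2 * etaQuotient L z := by simp [etaQuotient]

/-- The exponent `κ` in the leading term `exp(2πi κ z)` of the eta quotient at the cusp `a / c`. -/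
noncomputable def cuspExponent (L : List (ℕ × ℤ)) (c : ℕ) : ℂ :=
  (L.map fun p => (p.2 : ℂ) * ((Nat.gcd p.1 c : ℂ) ^ 2 / p.1) / 24).sum

lemma cuspExponent_cons (p : ℕ × ℤ) (L : List (ℕ × ℤ)) (c : ℕ) :
    cuspExponent (p :: L) c =
      (p.2 : ℂ) * ((Nat.gcd p.1 c : ℂ) ^ 2 / p.1) / 24 + cuspExponent L c := by
  simp [cuspExponent]

lemma zpow_pow_comm (x : ℂ) (r : ℤ) (n : ℕ) : (x ^ r) ^ n = (x ^ n) ^ r := by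
  rw [← zpow_natCast, ← zpow_natCast, ← zpow_mul, ← zpow_mul, mul_comm]

lemma automorphy_factor_mul {j : ℂ} (hj : j ≠ 0) (D e K G : ℂ) (r s : ℤ) :
    ((j / D) ^ 12 * e) ^ r * (K * j ^ (12 * s) * G) =
      (D⁻¹ ^ 12) ^ r * K * j ^ (12 * (r + s)) * (e ^ r * G) := by
  have h : j ^ (12 * (r + s)) = (j ^ 12) ^ r * j ^ (12 * s) := by
    rw [mul_add, zpow_add₀ hj, zpow_mul]
    norm_cast
  rw [h, div_eq_mul_inv, mul_pow, mul_zpow, mul_zpow]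
  ring

/-- The expansion of an eta quotient at a cusp, up to roots of unity. -/
lemma etaQuotient_moebius_pow {a b c d : ℤ} (hdet : a * d - b * c = 1) (L : List (ℕ × ℤ))
    (hL : ∀ p ∈ L, 0 < p.1) :
    ∃ G : ℍ → ℂ, ∃ K C : ℂ, K ≠ 0 ∧ C ≠ 0 ∧ Continuous G ∧ (∀ z, G z ≠ 0) ∧
      (∀ z : ℍ, etaQuotient L ((a * z + b) / (c * z + d)) ^ 24 =
        K * (c * z + d) ^ (12 * (L.map Prod.snd).sum) * G z ^ 24) ∧
      Tendsto (fun z : ℍ => G z * Complex.exp (-(2 * π * Complex.I * cuspExponent L c.natAbs * z)))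
        atImInfty (𝓝 C) := by
  have hcd : c ≠ 0 ∨ d ≠ 0 := by
    by_contra! h
    simp [h.1, h.2] at hdet
  induction L with
  | nil =>
    refine ⟨fun _ => 1, 1, 1, one_ne_zero, one_ne_zero, continuous_const, fun _ => one_ne_zero,
      fun z => by simp [etaQuotient_nil], ?_⟩
    simp [cuspExponent]
  | cons p L ih =>
    obtain ⟨G, K, C, hK, hC, hGc, hG0, hG, hlim⟩ := ih fun p hp => hL p (List.mem_cons_of_mem _ hp)
    have hp := hL p List.mem_cons_self
    obtain ⟨A, D, B, hA, hD, hAD, hAg, heta⟩ := eta_mul_moebius_pow hp hdet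
    have hD0 : (D : ℂ) ≠ 0 := by exact_mod_cast hD.ne'
    have hA0 : (A : ℂ) ≠ 0 := by exact_mod_cast hA.ne'
    have hp0 : (p.1 : ℂ) = A * D := by exact_mod_cast hAD.symm
    have hpos : ∀ z : ℍ, 0 < ((A * z + B) / D : ℂ).im := fun z => im_affine_pos hA hD B z.im_pos
    have hη : ∀ z : ℍ, η ((A * z + B) / D) ≠ 0 := fun z => ModularForm.eta_ne_zero (hpos z)
    refine ⟨fun z => η ((A * z + B) / D) ^ p.2 * G z, ((D : ℂ)⁻¹ ^ 12) ^ p.2 * K,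
      Complex.exp (2 * π * Complex.I * (B / D) / 24) ^ p.2 * C,
      mul_ne_zero (zpow_ne_zero _ (pow_ne_zero _ (inv_ne_zero hD0))) hK,
      mul_ne_zero (zpow_ne_zero _ (Complex.exp_ne_zero _)) hC, ?_,
      fun z => mul_ne_zero (zpow_ne_zero _ (hη z)) (hG0 z), fun z => ?_, ?_⟩
    · refine Continuous.mul
        (Continuous.zpow₀ (continuous_eta_comp ?_ hpos) _ fun z => Or.inl (hη z)) hGc
      have := UpperHalfPlane.continuous_coe
      fun_prop
    · have h0 : (c * z + d : ℂ) ≠ 0 := int_mul_add_ne_zero hcd z.im_pos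
      rw [etaQuotient_cons, mul_pow, mul_pow, zpow_pow_comm, zpow_pow_comm, heta z z.im_pos, hG z,
        List.map_cons, List.sum_cons]
      exact automorphy_factor_mul h0 _ _ _ _ _ _
    · have h1 := (tendsto_eta_affine hA hD B).zpow₀ p.2 (Or.inl one_ne_zero)
      have h2 := (h1.mul hlim).const_mul (Complex.exp (2 * π * Complex.I * (B / D) / 24) ^ p.2)
      rw [one_zpow, one_mul] at h2
      refine h2.congr fun z => ?_
      rw [cuspExponent_cons, ← hAg, hp0, mul_zpow, ← Complex.exp_int_mul, ← Complex.exp_int_mul]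
      have h3 : Complex.exp (-(2 * π * Complex.I *
          (p.2 * ((A : ℂ) ^ 2 / (A * D)) / 24 + cuspExponent L c.natAbs) * z)) =
          Complex.exp (p.2 * (2 * π * Complex.I * (B / D) / 24)) *
          Complex.exp (p.2 * (-(2 * π * Complex.I * ((A * z + B) / D) / 24))) *
          Complex.exp (-(2 * π * Complex.I * cuspExponent L c.natAbs * z)) := by
        rw [← Complex.exp_add, ← Complex.exp_add]
        congr 1
        field_simp
        ring
      rw [h3]
      ring

lemma continuous_etaQuotient_comp (L : List (ℕ × ℤ)) (hL : ∀ p ∈ L, 0 < p.1) {g : ℍ → ℂ}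
    (hg : Continuous g) (hpos : ∀ z, 0 < (g z).im) : Continuous fun z => etaQuotient L (g z) := by
  induction L with
  | nil => simpa only [etaQuotient_nil] using (continuous_const : Continuous fun _ : ℍ => (1 : ℂ))
  | cons p L ih =>
    simp only [etaQuotient_cons]
    have h : ∀ z, 0 < (p.1 * g z).im := fun z => by
      have := hL p List.mem_cons_self
      have := hpos z
      rw [← Complex.ofReal_natCast, Complex.im_ofReal_mul]
      positivity
    exact ((continuous_eta_comp (by fun_prop) h).zpow₀ _
      fun z => Or.inl (ModularForm.eta_ne_zero (h z))).mul
        (ih fun p hp => hL p (List.mem_cons_of_mem _ hp))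

lemma differentiableOn_etaQuotient (L : List (ℕ × ℤ)) (hL : ∀ p ∈ L, 0 < p.1) :
    DifferentiableOn ℂ (etaQuotient L) {z | 0 < z.im} := by
  induction L with
  | nil => simp [funext etaQuotient_nil]
  | cons p L ih =>
    rw [funext (etaQuotient_cons p L)]
    refine DifferentiableOn.mul (fun z hz => ?_) (ih fun p hp => hL p (List.mem_cons_of_mem _ hp))
    have h : 0 < (p.1 * z).im := by
      have := hL p List.mem_cons_self
      have : 0 < z.im := hz
      rw [← Complex.ofReal_natCast, Complex.im_ofReal_mul]
      positivity
    have h1 : DifferentiableAt ℂ (fun z => η (p.1 * z)) z :=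
      (ModularForm.differentiableAt_eta_of_mem_upperHalfPlaneSet h).comp z (by fun_prop)
    exact (h1.zpow (Or.inl (ModularForm.eta_ne_zero h))).differentiableWithinAt

lemma etaQuotient_ne_zero (L : List (ℕ × ℤ)) (hL : ∀ p ∈ L, 0 < p.1) {z : ℂ} (hz : 0 < z.im) :
    etaQuotient L z ≠ 0 := by
  induction L with
  | nil => simp [etaQuotient_nil]
  | cons p L ih =>
    rw [etaQuotient_cons]
    refine mul_ne_zero (zpow_ne_zero _ (ModularForm.eta_ne_zero ?_))
      (ih fun p hp => hL p (List.mem_cons_of_mem _ hp))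
    have := hL p List.mem_cons_self
    have h : 0 < (p.1 * z).im := by
      rw [← Complex.ofReal_natCast, Complex.im_ofReal_mul]
      positivity
    exact h

lemma coe_smul_eq (σ : SL(2, ℤ)) (z : ℍ) :
    ((σ • z : ℍ) : ℂ) = ((σ 0 0 : ℤ) * z + (σ 0 1 : ℤ)) / ((σ 1 0 : ℤ) * z + (σ 1 1 : ℤ)) := by
  rw [coe_specialLinearGroup_apply]
  simp

lemma det_eq (σ : SL(2, ℤ)) : σ 0 0 * σ 1 1 - σ 0 1 * σ 1 0 = 1 := by
  rw [← Matrix.det_fin_two]; exact σ.det_coe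

lemma smul_denom_ne_zero (σ : SL(2, ℤ)) (z : ℍ) : ((σ 1 0 : ℤ) * z + (σ 1 1 : ℤ) : ℂ) ≠ 0 := by
  refine int_mul_add_ne_zero ?_ z.im_pos
  by_contra! h
  have := det_eq σ
  simp [h.1, h.2] at this

lemma continuous_coe_smul (σ : SL(2, ℤ)) : Continuous fun z : ℍ => ((σ • z : ℍ) : ℂ) := by
  simp_rw [coe_smul_eq]
  have := UpperHalfPlane.continuous_coe
  exact Continuous.div (by fun_prop) (by fun_prop) (smul_denom_ne_zero σ)

/-- The leading term of a weight zero eta quotient at a cusp. -/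
lemma tendsto_etaQuotient_smul (L : List (ℕ × ℤ)) (hL : ∀ p ∈ L, 0 < p.1)
    (hsum : (L.map Prod.snd).sum = 0) (σ : SL(2, ℤ)) :
    ∃ C : ℂ, C ≠ 0 ∧ Tendsto (fun z : ℍ => etaQuotient L (σ • z : ℍ) *
      Complex.exp (-(2 * π * Complex.I * cuspExponent L (σ 1 0).natAbs * z))) atImInfty (𝓝 C) := by
  obtain ⟨G, K, C, hK, hC, hGc, hG0, hG, hlim⟩ := etaQuotient_moebius_pow (det_eq σ) L hL
  have hcont : Continuous fun z : ℍ => etaQuotient L (σ • z : ℍ) / G z :=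
    (continuous_etaQuotient_comp L hL
      (continuous_coe_smul σ) fun z => (σ • z).im_pos).div
      hGc hG0
  have hpow : ∀ z : ℍ, (etaQuotient L (σ • z : ℍ) / G z) ^ 24 = K := by
    intro z
    rw [div_pow, coe_smul_eq, hG z, hsum, mul_zero, zpow_zero, mul_one,
      mul_div_cancel_right₀ _ (pow_ne_zero _ (hG0 z))]
  have hconst := eq_const_of_pow_eq_const hcont (by norm_num) hpow
  refine ⟨etaQuotient L (σ • UpperHalfPlane.I : ℍ) / G UpperHalfPlane.I * C,
    mul_ne_zero (fun h => hK ?_) hC, (hlim.const_mul _).congr fun z => ?_⟩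
  · rw [← hpow UpperHalfPlane.I, h]; simp
  · rw [hconst UpperHalfPlane.I z, ← mul_assoc, div_mul_cancel₀ _ (hG0 z)]

/-- A weight zero eta quotient whose factors `η(k z)` have `k ∣ M` is an eigenfunction of the
elements of `Γ₀(M)`. -/
lemma exists_character (L : List (ℕ × ℤ)) {M : ℕ} (hL : ∀ p ∈ L, 0 < p.1 ∧ p.1 ∣ M)
    (hsum : (L.map Prod.snd).sum = 0) {γ : SL(2, ℤ)} (hγ : (M : ℤ) ∣ γ 1 0) :
    ∃ χ : ℂ, ∀ z : ℍ, etaQuotient L (γ • z : ℍ) = χ * etaQuotient L z := by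
  have hL' : ∀ p ∈ L, 0 < p.1 := fun p hp => (hL p hp).1
  have hdet := det_eq γ
  have hcd : γ 1 0 ≠ 0 ∨ γ 1 1 ≠ 0 := by
    by_contra! h
    simp [h.1, h.2] at hdet
  have hpow : ∀ (L : List (ℕ × ℤ)), (∀ p ∈ L, 0 < p.1 ∧ p.1 ∣ M) → ∀ z : ℍ,
      etaQuotient L (γ • z : ℍ) ^ 24 =
      ((γ 1 0 : ℤ) * z + (γ 1 1 : ℤ)) ^ (12 * (L.map Prod.snd).sum) * etaQuotient L z ^ 24 := by
    intro L hL z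
    have h0 : ((γ 1 0 : ℤ) * z + (γ 1 1 : ℤ) : ℂ) ≠ 0 := int_mul_add_ne_zero hcd z.im_pos
    induction L with
    | nil => simp [etaQuotient_nil]
    | cons p L ih =>
      obtain ⟨hp, hpM⟩ := hL p List.mem_cons_self
      obtain ⟨c, hc⟩ : (p.1 : ℤ) ∣ γ 1 0 := (Int.natCast_dvd_natCast.2 hpM).trans hγ
      have h2 := eta_moebius_pow (a := γ 0 0) (b := p.1 * γ 0 1) (c := c) (d := γ 1 1)
        (by rw [hc] at hdet; linear_combination hdet) (z := (p.1 : ℂ) * (z : ℂ)) (by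
          rw [← Complex.ofReal_natCast, Complex.im_ofReal_mul]
          have := z.im_pos
          positivity)
      have h3 : (c : ℂ) * (p.1 * z) = (γ 1 0 : ℤ) * z := by
        rw [hc]; push_cast; ring
      rw [h3] at h2
      have h4 : ((γ 0 0 : ℤ) * ((p.1 : ℂ) * (z : ℂ)) + (p.1 * γ 0 1 : ℤ)) /
          ((γ 1 0 : ℤ) * z + (γ 1 1 : ℤ)) =
          ((p.1 : ℂ) * ((γ • z : ℍ) : ℂ)) := by
        rw [coe_smul_eq]
        push_cast
        ring
      rw [h4] at h2
      have h5 := automorphy_factor_mul h0 1 (η (p.1 * z) ^ 24) 1 (etaQuotient L z ^ 24) p.2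
        (L.map Prod.snd).sum
      rw [etaQuotient_cons, mul_pow, ih fun p hp => hL p (List.mem_cons_of_mem _ hp), zpow_pow_comm,
        h2, etaQuotient_cons, mul_pow, zpow_pow_comm, List.map_cons, List.sum_cons]
      simpa using h5
  have hne : ∀ z : ℍ, etaQuotient L z ≠ 0 := fun z => etaQuotient_ne_zero L hL' z.im_pos
  have hcont : Continuous fun z : ℍ => etaQuotient L (γ • z : ℍ) / etaQuotient L z :=
    (continuous_etaQuotient_comp L hL'
      (continuous_coe_smul γ) fun z => (γ • z).im_pos).div
      (continuous_etaQuotient_comp L hL' UpperHalfPlane.continuous_coe fun z => z.im_pos) hne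
  have hconst := eq_const_of_pow_eq_const hcont (n := 24) (by norm_num) (K := 1) fun z => by
    rw [div_pow, hpow L hL z, hsum, mul_zero, zpow_zero, one_mul, div_self (pow_ne_zero _ (hne z))]
  refine ⟨etaQuotient L (γ • UpperHalfPlane.I : ℍ) / etaQuotient L UpperHalfPlane.I, fun z => ?_⟩
  rw [hconst UpperHalfPlane.I z, div_mul_cancel₀ _ (hne z)]

/-! ### Elliptic and parabolic elements fix an eta quotient -/

/-- The group of all `γ ∈ SL₂(ℤ)` that fix an eta quotient. -/
def etaStabilizer (L : List (ℕ × ℤ)) : Subgroup SL(2, ℤ) where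
  carrier := {γ | ∀ z : ℍ, etaQuotient L (γ • z : ℍ) = etaQuotient L z}
  mul_mem' := fun {γ δ} hγ hδ z => by
    rw [mul_smul]
    exact (hγ _).trans (hδ z)
  one_mem' := fun z => by rw [one_smul]
  inv_mem' := fun {γ} hγ z => by
    have := hγ (γ⁻¹ • z)
    rw [smul_inv_smul] at this
    exact this.symm

lemma mem_etaStabilizer {L : List (ℕ × ℤ)} {γ : SL(2, ℤ)} :
    γ ∈ etaStabilizer L ↔ ∀ z : ℍ, etaQuotient L (γ • z : ℍ) = etaQuotient L z := Iff.rfl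

/-- Elliptic elements, those with trace of absolute value at most `1`, have a fixed point in the
upper half plane. -/
lemma exists_fixed_point {γ : SL(2, ℤ)} (h : |γ 0 0 + γ 1 1| ≤ 1) : ∃ z : ℍ, γ • z = z := by
  have hdet := det_eq γ
  obtain ⟨a, ha⟩ : ∃ a, a = γ 0 0 := ⟨_, rfl⟩
  obtain ⟨b, hb⟩ : ∃ b, b = γ 0 1 := ⟨_, rfl⟩
  obtain ⟨c, hc⟩ : ∃ c, c = γ 1 0 := ⟨_, rfl⟩
  obtain ⟨d, hd⟩ : ∃ d, d = γ 1 1 := ⟨_, rfl⟩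
  rw [← ha, ← hb, ← hc, ← hd] at hdet
  rw [← ha, ← hd] at h
  obtain ⟨h1, h2⟩ := abs_le.1 h
  have hc0 : c ≠ 0 := by
    rintro rfl
    have : (a + d) ^ 2 ≤ 1 := by nlinarith
    have h4 : (a - d) ^ 2 + 4 = (a + d) ^ 2 := by linear_combination -4 * hdet
    nlinarith [sq_nonneg (a - d)]
  have hdisc : (0 : ℝ) < 4 - (a + d) ^ 2 := by
    have : (a + d) ^ 2 ≤ 1 := by nlinarith
    have : ((a + d : ℤ) : ℝ) ^ 2 ≤ 1 := by exact_mod_cast this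
    push_cast at this
    linarith
  have hcR : (c : ℝ) ≠ 0 := by exact_mod_cast hc0
  have hsq := Real.sq_sqrt hdisc.le
  have hpos := Real.sqrt_pos.2 hdisc
  set s := Real.sqrt (4 - (a + d) ^ 2) with hs
  let z : ℍ := ⟨⟨(a - d) / (2 * c), s / (2 * |(c : ℝ)|)⟩, by
    have := abs_pos.2 hcR
    show 0 < s / (2 * |(c : ℝ)|)
    positivity⟩
  have hquad : (c : ℂ) * (z : ℂ) ^ 2 + (d - a) * z - b = 0 := by
    have habs : |(c : ℝ)| ^ 2 = c ^ 2 := sq_abs _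
    have hdetR : (a : ℝ) * d - b * c = 1 := by exact_mod_cast hdet
    have habs0 : |(c : ℝ)| ≠ 0 := abs_ne_zero.2 hcR
    have e1 : (z : ℂ).re = (a - d) / (2 * c) := rfl
    have e2 : (z : ℂ).im = s / (2 * |(c : ℝ)|) := rfl
    have e3 : (s / (2 * |(c : ℝ)|)) ^ 2 = s ^ 2 / (4 * c ^ 2) := by
      rw [div_pow, mul_pow, habs]; norm_num
    apply Complex.ext
    · simp only [pow_two, Complex.sub_re, Complex.add_re, Complex.mul_re, Complex.intCast_re,
        Complex.intCast_im, Complex.sub_im, Complex.mul_im, Complex.zero_re, e1, e2]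
      have : (c : ℝ) * (((a : ℝ) - d) / (2 * c) * ((a - d) / (2 * c)) -
          s / (2 * |(c : ℝ)|) * (s / (2 * |(c : ℝ)|))) + (d - a) * ((a - d) / (2 * c)) - b = 0 := by
        rw [← pow_two (s / (2 * |(c : ℝ)|)), e3, hsq]
        field_simp
        linear_combination 16 * hdetR
      linear_combination this
    · simp only [pow_two, Complex.sub_re, Complex.add_im, Complex.mul_re, Complex.intCast_re,
        Complex.intCast_im, Complex.sub_im, Complex.mul_im, Complex.zero_im, e1, e2]
      field_simp
      ring
  refine ⟨z, UpperHalfPlane.ext ?_⟩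
  rw [coe_smul_eq, div_eq_iff (smul_denom_ne_zero γ z), ← ha, ← hb, ← hc, ← hd]
  linear_combination -hquad

/-- A matrix of trace `2` in `SL₂(ℤ)` is conjugate in `SL₂(ℤ)` to a power of `T`. -/
lemma exists_conj_T_zpow {γ : SL(2, ℤ)} (h : γ 0 0 + γ 1 1 = 2) :
    ∃ (σ : SL(2, ℤ)) (n : ℤ), γ * σ = σ * ModularGroup.T ^ n := by
  have hdet := det_eq γ
  obtain ⟨x, hx⟩ : ∃ x, γ 0 0 = 1 + x := ⟨γ 0 0 - 1, by ring⟩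
  obtain ⟨y, hy⟩ : ∃ y, γ 0 1 = y := ⟨_, rfl⟩
  obtain ⟨z, hz⟩ : ∃ z, γ 1 0 = z := ⟨_, rfl⟩
  have hw : γ 1 1 = 1 - x := by linarith
  rw [hx, hy, hz, hw] at hdet
  have hxyz : x ^ 2 + y * z = 0 := by linear_combination -hdet
  by_cases hz0 : z = 0
  · have hx0 : x = 0 := by
      rw [hz0, mul_zero, add_zero] at hxyz
      exact pow_eq_zero_iff two_ne_zero |>.1 hxyz
    refine ⟨1, y, ?_⟩
    rw [mul_one, one_mul]
    ext i j
    rw [ModularGroup.coe_T_zpow]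
    fin_cases i <;> fin_cases j <;> simp [hx, hy, hz, hw, hx0, hz0]
  · obtain ⟨g, a, c, hg, hac, hxa, hzc⟩ : ∃ g a c : ℤ, 0 < g ∧ IsCoprime a c ∧
        x = g * a ∧ z = g * c := by
      have hg : 0 < Int.gcd x z := Int.gcd_pos_of_ne_zero_right _ hz0
      refine ⟨Int.gcd x z, x / Int.gcd x z, z / Int.gcd x z, by exact_mod_cast hg,
        Int.isCoprime_iff_gcd_eq_one.2 (Int.gcd_ediv_gcd_ediv_gcd hg), ?_, ?_⟩
      · exact (Int.mul_ediv_cancel' (Int.gcd_dvd_left _ _)).symm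
      · exact (Int.mul_ediv_cancel' (Int.gcd_dvd_right _ _)).symm
    have hg0 := hg.ne'
    have h1 : g * a ^ 2 = c * -y := by
      apply mul_left_cancel₀ hg0
      rw [hxa, hzc] at hxyz
      linear_combination hxyz
    obtain ⟨m, hm⟩ : c ∣ g := (hac.symm.pow_right (n := 2)).dvd_of_dvd_mul_right ⟨_, h1⟩
    have hc0 : c ≠ 0 := by
      rintro rfl
      exact hz0 (by rw [hzc, mul_zero])
    have hy' : y = -m * a ^ 2 := by
      apply mul_left_cancel₀ hc0
      rw [hm] at h1
      linear_combination h1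
    obtain ⟨u, v, huv⟩ := hac
    let σ : SL(2, ℤ) := ⟨!![a, -v; c, u], by rw [Matrix.det_fin_two_of]; linear_combination huv⟩
    refine ⟨σ, -m, ?_⟩
    ext i j
    rw [Matrix.SpecialLinearGroup.coe_mul, Matrix.SpecialLinearGroup.coe_mul,
      ModularGroup.coe_T_zpow, Matrix.mul_apply, Matrix.mul_apply, Fin.sum_univ_two,
      Fin.sum_univ_two]
    fin_cases i <;> fin_cases j <;> simp [σ, hx, hy, hz, hw, hxa, hzc, hm, hy']
    · ring
    · linear_combination -(m * a : ℤ) * huv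
    · ring
    · linear_combination -(m * c : ℤ) * huv

lemma cuspExponent_eq_cuspOrder {L : List (ℕ × ℤ)} {M : ℕ} (hM : 0 < M)
    (hL : ∀ p ∈ L, 0 < p.1 ∧ p.1 ∣ M) (c : ℕ) :
    cuspExponent L c = cuspOrder L M (Nat.gcd c M) / (24 * M) := by
  have hM0 : (M : ℂ) ≠ 0 := by exact_mod_cast hM.ne'
  induction L with
  | nil => simp [cuspExponent, cuspOrder]
  | cons p L ih =>
    obtain ⟨hp, k, hk⟩ := hL p List.mem_cons_self
    have hp0 : (p.1 : ℂ) ≠ 0 := by exact_mod_cast hp.ne'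
    have hk0 : (k : ℂ) ≠ 0 := by
      rintro h
      rw [hk] at hM0
      simp [h] at hM0
    have hgcd : Nat.gcd p.1 (Nat.gcd c M) = Nat.gcd p.1 c := by
      rw [Nat.gcd_comm c M, ← Nat.gcd_assoc, Nat.gcd_eq_left (⟨k, hk⟩ : p.1 ∣ M)]
    rw [cuspExponent_cons, ih fun p hp => hL p (List.mem_cons_of_mem _ hp)]
    simp only [cuspOrder, List.map_cons, List.sum_cons, hgcd]
    rw [show M / p.1 = k by rw [hk, Nat.mul_div_cancel_left _ hp]]
    push_cast
    rw [add_div, hk]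
    push_cast
    congr 1
    field_simp

/-- Elements of trace `2` in `Γ₀(M)` fix the eta quotient if its order at every cusp is an
integer. -/
lemma parabolic_mem_etaStabilizer {L : List (ℕ × ℤ)} {M : ℕ} (hM : 0 < M)
    (hL : ∀ p ∈ L, 0 < p.1 ∧ p.1 ∣ M) (hsum : (L.map Prod.snd).sum = 0)
    (hcusp : ∀ g ∈ Finset.range (M + 1), g ∣ M →
      (24 * M : ℤ) ∣ cuspOrder L M g * ((M / Nat.gcd M (g ^ 2) : ℕ) : ℤ))
    {γ : SL(2, ℤ)} (hγ : (M : ℤ) ∣ γ 1 0) (htr : γ 0 0 + γ 1 1 = 2) : γ ∈ etaStabilizer L := by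
  have hL' : ∀ p ∈ L, 0 < p.1 := fun p hp => (hL p hp).1
  obtain ⟨χ, hχ⟩ := exists_character L hL hsum hγ
  obtain ⟨σ, n, hσ⟩ := exists_conj_T_zpow htr
  obtain ⟨C, hC, hlim⟩ := tendsto_etaQuotient_smul L hL' hsum σ
  set κ := cuspExponent L (σ 1 0).natAbs with hκ
  have hshift : Tendsto (fun z : ℍ => ModularGroup.T ^ n • z) atImInfty atImInfty := by
    simp only [modular_T_zpow_smul]
    refine tendsto_comap_iff.2 ?_
    have : (UpperHalfPlane.im ∘ fun z : ℍ => ((n : ℝ) +ᵥ z : ℍ)) = UpperHalfPlane.im := by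
      funext z
      simp
    rw [this]
    exact tendsto_comap
  have h1 := hlim.comp hshift
  have h2 : χ * Complex.exp (-(2 * π * Complex.I * κ * n)) = 1 := by
    have h3 := (hlim.const_mul (χ * Complex.exp (-(2 * π * Complex.I * κ * n))))
    have h4 := tendsto_nhds_unique (h1.congr fun z => ?_) h3
    · exact mul_right_cancel₀ hC (by rw [one_mul, ← h4])
    · have e1 : σ • ModularGroup.T ^ n • z = γ • σ • z := by
        rw [← mul_smul, ← mul_smul, hσ]
      simp only [Function.comp_apply]
      rw [e1, hχ, modular_T_zpow_smul, coe_vadd,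
        show (-(2 * π * Complex.I * κ * (((n : ℝ) : ℂ) + z))) =
          -(2 * π * Complex.I * κ * n) + -(2 * π * Complex.I * κ * z) by push_cast; ring,
        Complex.exp_add]
      ring
  obtain ⟨m, hm⟩ : ∃ m : ℤ, κ * n = m := by
    obtain ⟨c, hc⟩ : ∃ c, c = σ 1 0 := ⟨_, rfl⟩
    have hdvd : (M : ℤ) ∣ n * c ^ 2 := by
      have h10 : γ 1 0 = -(n * c ^ 2) := by
        have e : γ = σ * ModularGroup.T ^ n * σ⁻¹ := by rw [← hσ, mul_inv_cancel_right]
        rw [e, Matrix.SpecialLinearGroup.coe_mul, Matrix.SpecialLinearGroup.coe_mul,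
          ModularGroup.coe_T_zpow, Matrix.SpecialLinearGroup.coe_inv, Matrix.adjugate_fin_two,
          Matrix.mul_apply, Fin.sum_univ_two, Matrix.mul_apply, Fin.sum_univ_two,
          Matrix.mul_apply, Fin.sum_univ_two]
        simp [← hc]
        ring
      rw [h10] at hγ
      simpa using hγ
    set g := Nat.gcd c.natAbs M with hg
    have hgM : g ∣ M := Nat.gcd_dvd_right _ _
    have hMn : M ∣ n.natAbs * Nat.gcd M (g ^ 2) := by
      have h5 : M ∣ n.natAbs * c.natAbs ^ 2 := by
        rw [← Int.natAbs_pow, ← Int.natAbs_mul]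
        exact Int.natCast_dvd.1 hdvd
      have h6 : M ∣ n.natAbs * Nat.gcd M (c.natAbs ^ 2) := by
        rw [← Nat.gcd_mul_left]
        exact Nat.dvd_gcd (dvd_mul_left _ _) h5
      refine h6.trans (Nat.mul_dvd_mul_left _ (Nat.dvd_gcd (Nat.gcd_dvd_left _ _) ?_))
      rw [pow_two, pow_two, hg, Nat.gcd_comm c.natAbs M]
      exact Nat.gcd_mul_right_dvd_mul_gcd _ _ _
    have hG0 : 0 < Nat.gcd M (g ^ 2) := Nat.gcd_pos_of_pos_left _ hM
    obtain ⟨w, hw⟩ : Nat.gcd M (g ^ 2) ∣ M := Nat.gcd_dvd_left _ _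
    have hwn : (w : ℤ) ∣ n := by
      refine Int.natCast_dvd.2 ?_
      refine Nat.dvd_of_mul_dvd_mul_left hG0 ?_
      rw [← hw, mul_comm]
      exact hMn
    obtain ⟨n', hn'⟩ := hwn
    obtain ⟨m, hm⟩ := hcusp g (Finset.mem_range.2 (Nat.lt_succ_of_le (Nat.le_of_dvd hM hgM))) hgM
    rw [show M / Nat.gcd M (g ^ 2) = w by
      conv_lhs => rw [hw]
      rw [← hw]
      exact Nat.div_eq_of_eq_mul_right hG0 hw] at hm
    refine ⟨m * n', ?_⟩
    have hM0 : (M : ℂ) ≠ 0 := by exact_mod_cast hM.ne'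
    have hmC : (cuspOrder L M g : ℂ) * w = 24 * M * m := by exact_mod_cast hm
    rw [hκ, ← hc, cuspExponent_eq_cuspOrder hM hL, ← hg, hn']
    push_cast
    rw [div_mul_eq_mul_div, div_eq_iff (by simpa using hM0)]
    linear_combination (n' : ℂ) * hmC
  have h7 : Complex.exp (-(2 * π * Complex.I * κ * n)) = 1 := by
    rw [show -(2 * π * Complex.I * κ * n) = ((-m : ℤ) : ℂ) * (2 * π * Complex.I) by
      push_cast; rw [← hm]; ring]
    exact Complex.exp_int_mul_two_pi_mul_I _
  rw [h7, mul_one] at h2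
  intro z
  rw [hχ, h2, one_mul]

lemma neg_mem_etaStabilizer {L : List (ℕ × ℤ)} {γ : SL(2, ℤ)} :
    -γ ∈ etaStabilizer L ↔ γ ∈ etaStabilizer L := by
  simp only [mem_etaStabilizer, ModularGroup.SL_neg_smul]

/-- Elliptic and parabolic elements of `Γ₀(M)` fix the eta quotient. -/
lemma mem_etaStabilizer_of_trace {L : List (ℕ × ℤ)} {M : ℕ} (hM : 0 < M)
    (hL : ∀ p ∈ L, 0 < p.1 ∧ p.1 ∣ M) (hsum : (L.map Prod.snd).sum = 0)
    (hcusp : ∀ g ∈ Finset.range (M + 1), g ∣ M →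
      (24 * M : ℤ) ∣ cuspOrder L M g * ((M / Nat.gcd M (g ^ 2) : ℕ) : ℤ))
    {γ : SL(2, ℤ)} (hγ : (M : ℤ) ∣ γ 1 0) (htr : |γ 0 0 + γ 1 1| ≤ 2) : γ ∈ etaStabilizer L := by
  obtain ⟨h1, h2⟩ := abs_le.1 htr
  rcases h2.eq_or_lt with h2 | h2
  · exact parabolic_mem_etaStabilizer hM hL hsum hcusp hγ h2
  rcases h1.eq_or_lt with h1 | h1
  · rw [← neg_mem_etaStabilizer]
    refine parabolic_mem_etaStabilizer hM hL hsum hcusp ?_ ?_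
    · simpa using hγ
    · simp
      linarith
  · obtain ⟨χ, hχ⟩ := exists_character L hL hsum hγ
    obtain ⟨z, hz⟩ := exists_fixed_point (γ := γ) (abs_le.2 ⟨by linarith, by linarith⟩)
    have h3 := hχ z
    rw [hz] at h3
    have hne := etaQuotient_ne_zero L (fun p hp => (hL p hp).1) z.im_pos
    have h4 : χ = 1 := mul_right_cancel₀ hne (by rw [← h3, one_mul])
    intro w
    rw [hχ, h4, one_mul]

/-! ### Invariance of the Hauptmoduln under `Γ₀(M)` -/

lemma mul_lower_left (γ δ : SL(2, ℤ)) : (γ * δ) 1 0 = γ 1 0 * δ 0 0 + γ 1 1 * δ 1 0 := by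
  rw [Matrix.SpecialLinearGroup.coe_mul, Matrix.mul_apply, Fin.sum_univ_two]

/-- A criterion for `Γ₀(M)` to fix an eta quotient: the lower left entry of every element of
`Γ₀(M)` can be made smaller by multiplication with an element that fixes the eta quotient. -/
lemma Gamma0_le_etaStabilizer_of_descent {L : List (ℕ × ℤ)} {M : ℕ}
    (hT : ∀ n : ℤ, ModularGroup.T ^ n ∈ etaStabilizer L)
    (hstep : ∀ c d : ℤ, 0 < c → (M : ℤ) ∣ c → 0 ≤ d → d < c → IsCoprime c d →
      ∃ δ ∈ etaStabilizer L, (M : ℤ) ∣ δ 1 0 ∧ |c * δ 0 0 + d * δ 1 0| < c)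
    {γ : SL(2, ℤ)} (hγ : (M : ℤ) ∣ γ 1 0) : γ ∈ etaStabilizer L := by
  induction h : (γ 1 0).natAbs using Nat.strong_induction_on generalizing γ with
  | _ k ih =>
  have main : ∀ γ : SL(2, ℤ), (M : ℤ) ∣ γ 1 0 → (γ 1 0).natAbs = k → 0 < γ 1 0 →
      γ ∈ etaStabilizer L := by
    intro γ hγ hk hpos
    set n := -(γ 1 1 / γ 1 0) with hn
    have h10 : (γ * ModularGroup.T ^ n) 1 0 = γ 1 0 := by
      rw [mul_lower_left, ModularGroup.coe_T_zpow]
      simp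
    have h11 : (γ * ModularGroup.T ^ n) 1 1 = γ 1 1 % γ 1 0 := by
      rw [Matrix.SpecialLinearGroup.coe_mul, Matrix.mul_apply, Fin.sum_univ_two,
        ModularGroup.coe_T_zpow, Int.emod_def]
      simp [hn]
      ring
    have hdet := det_eq (γ * ModularGroup.T ^ n)
    obtain ⟨δ, hδ, hδM, hlt⟩ := hstep _ (γ 1 1 % γ 1 0) hpos hγ (Int.emod_nonneg _ hpos.ne')
      (Int.emod_lt_of_pos _ hpos) (by
        rw [h10, h11] at hdet
        exact ⟨-(γ * ModularGroup.T ^ n) 0 1, (γ * ModularGroup.T ^ n) 0 0, by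
          linear_combination hdet⟩)
    have h3 : (γ * ModularGroup.T ^ n * δ) 1 0 = γ 1 0 * δ 0 0 + γ 1 1 % γ 1 0 * δ 1 0 := by
      rw [mul_lower_left, h10, h11]
    have h4 : γ * ModularGroup.T ^ n * δ ∈ etaStabilizer L := by
      refine ih _ ?_ ?_ rfl
      · rw [← hk, h3]
        zify
        rw [abs_of_pos hpos]
        exact hlt
      · rw [h3]
        exact dvd_add (dvd_mul_of_dvd_left hγ _) (dvd_mul_of_dvd_right hδM _)
    exact (Subgroup.mul_mem_cancel_right _ (hT n)).1 ((Subgroup.mul_mem_cancel_right _ hδ).1 h4)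
  rcases lt_trichotomy (γ 1 0) 0 with hc | hc | hc
  · rw [← neg_mem_etaStabilizer]
    refine main _ ?_ ?_ ?_
    · simpa using hγ
    · simpa using h
    · simpa using hc
  · obtain ⟨n, hn⟩ := ModularGroup.exists_eq_T_zpow_of_c_eq_zero hc
    intro z
    rw [hn]
    exact hT n z
  · exact main γ hγ h hc

/-- The eta quotient is fixed by an element of `SL₂(ℤ)` with first column `(a, c)`. -/
def FixedColumn (L : List (ℕ × ℤ)) (a c : ℤ) : Prop :=
  ∃ δ ∈ etaStabilizer L, δ 0 0 = a ∧ δ 1 0 = c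

/-- If `d / c` is in lowest terms, `M ∣ c` and `d / c = j / (M s)` with `s ≤ 2`, then `j / (M s)` is
in lowest terms, or `s = 2` and it is so after cancelling the factor `2`. -/
lemma false_of_mul_eq_of_not_coprime {c d : ℤ} {M s j : ℕ} (hs : s = 1 ∨ s = 2) (hM : 0 < M)
    (hc : 0 < c) (hMc : (M : ℤ) ∣ c) (hcd : IsCoprime c d) (h : (M * s : ℤ) * d = j * c)
    (hj : ¬ Nat.Coprime j (M * s)) (hj2 : s = 2 → j % 2 = 1 ∨ ¬ Nat.Coprime (j / 2) M) : False := by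
  obtain ⟨e, rfl⟩ := hMc
  have hM0 : (M : ℤ) ≠ 0 := by exact_mod_cast hM.ne'
  have h1 : (s : ℤ) * d = j * e := by
    apply mul_left_cancel₀ hM0
    linear_combination h
  have he : 0 < e := by
    have : (0 : ℤ) < M := by exact_mod_cast hM
    exact pos_of_mul_pos_right hc this.le
  have hes : e ∣ s := hcd.of_mul_left_right.dvd_of_dvd_mul_right ⟨j, by linear_combination h1⟩
  have key : ∀ {j' : ℕ}, d = j' → ¬ Nat.Coprime j' (M * e.natAbs) → False := by
    intro j' hd hn
    apply hn
    rw [hd] at hcd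
    have h5 := Int.isCoprime_iff_gcd_eq_one.1 hcd
    rw [Int.gcd_eq_natAbs, Int.natAbs_mul, Int.natAbs_natCast, Int.natAbs_natCast,
      Nat.gcd_comm] at h5
    exact h5
  rcases hs with rfl | rfl
  · have he1 : e = 1 := by
      have := Int.le_of_dvd (by norm_num) hes
      push_cast at this
      omega
    subst he1
    exact key (j' := j) (by push_cast at h1; linarith) (by simpa using hj)
  · have he2 : e ≤ 2 := by
      have := Int.le_of_dvd (by norm_num) hes
      exact_mod_cast this
    push_cast at h1
    obtain rfl | rfl : e = 1 ∨ e = 2 := by omega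
    · rcases hj2 rfl with h6 | h6
      · omega
      · exact key (j' := j / 2) (by push_cast; omega) (by simpa using h6)
    · exact key (j' := j) (by linarith) hj

/-- Whether the covering of the unit interval by the intervals of radius `1 / (M s)` around
`p / (M s)`, with `s ≤ 2` and `p` satisfying `Q s p`, leaves out only cusps inequivalent to `∞`;
the condition is stated for the interval `[j / M, (j + 1) / M)`. -/
def Covers (M : ℕ) (Q : ℕ → ℕ → Prop) (j : ℕ) : Prop :=
  Q 1 j ∨ ¬ Nat.Coprime j M ∧ (Q 1 (j + 1) ∨ ∀ i < 2, Q 2 (2 * j + i) ∨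
    (Q 2 (2 * j + i + 1) ∧ ¬ Nat.Coprime (2 * j + i) (M * 2) ∧
      ((2 * j + i) % 2 = 1 ∨ ¬ Nat.Coprime ((2 * j + i) / 2) M)))

/-- A matrix with first column `(-p, M s)` decreases the lower left entry of a matrix with lower row
`(c, d)` if `d / c` is at distance less than `1 / (M s)` from `p / (M s)`. If such intervals cover
all `d / c` that can occur, then the descent is possible. -/
lemma descent_of_fixedColumn {L : List (ℕ × ℤ)} {M : ℕ} (hM : 0 < M)
    (hcol : ∀ j < M, Covers M (fun s p => FixedColumn L (-p) (M * s)) j)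
    {c d : ℤ} (hc : 0 < c) (hMc : (M : ℤ) ∣ c) (hd : 0 ≤ d) (hdc : d < c) (hcd : IsCoprime c d) :
    ∃ δ ∈ etaStabilizer L, (M : ℤ) ∣ δ 1 0 ∧ |c * δ 0 0 + d * δ 1 0| < c := by
  have hM' : (0 : ℤ) < M := by exact_mod_cast hM
  have use_col : ∀ {s p : ℕ}, FixedColumn L (-p) (M * s) → |M * s * d - p * c| < c →
      ∃ δ ∈ etaStabilizer L, (M : ℤ) ∣ δ 1 0 ∧ |c * δ 0 0 + d * δ 1 0| < c := by
    rintro s p ⟨δ, hδ, h0, h1⟩ h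
    refine ⟨δ, hδ, ⟨s, h1⟩, ?_⟩
    rw [h0, h1]
    rwa [show c * -(p : ℤ) + d * (M * s) = M * s * d - p * c by ring]
  have hfloor : ∀ {x : ℤ}, 0 ≤ x → ∃ j : ℕ, j * c ≤ x ∧ x < (j + 1) * c := by
    intro x hx
    refine ⟨(x / c).toNat, ?_⟩
    rw [Int.toNat_of_nonneg (Int.ediv_nonneg hx hc.le)]
    exact ⟨Int.ediv_mul_le x hc.ne', Int.lt_ediv_add_one_mul_self x hc⟩
  obtain ⟨j, hj1, hj2⟩ := hfloor (x := M * d) (by positivity)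
  have hjM : j < M := by
    have : (j : ℤ) < M := by
      by_contra! hh
      nlinarith
    exact_mod_cast this
  rcases hcol j hjM with h | ⟨hnc, h⟩
  · exact use_col h (abs_lt.2 ⟨by push_cast; linarith, by push_cast; linarith⟩)
  have hne : (M : ℤ) * d ≠ j * c := fun heq =>
    false_of_mul_eq_of_not_coprime (Or.inl rfl) hM hc hMc hcd (by push_cast; linarith)
      (by simpa using hnc) (by norm_num)
  rcases h with h | h
  · have : (j : ℤ) * c < M * d := lt_of_le_of_ne hj1 (Ne.symm hne)
    exact use_col h (abs_lt.2 ⟨by push_cast; linarith, by push_cast; linarith⟩)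
  obtain ⟨i, hi, hi1, hi2⟩ : ∃ i < 2, ((2 * j + i : ℕ) : ℤ) * c ≤ M * 2 * d ∧
      M * 2 * d < ((2 * j + i : ℕ) + 1 : ℤ) * c := by
    rcases lt_or_ge ((M : ℤ) * 2 * d) ((2 * j + 1) * c) with hlt | hge
    · exact ⟨0, by norm_num, by push_cast; linarith, by push_cast; linarith⟩
    · exact ⟨1, by norm_num, by push_cast; linarith, by push_cast; linarith⟩
  rcases h i hi with h | ⟨h, hn1, hn2⟩
  · exact use_col h (abs_lt.2 ⟨by push_cast at *; linarith, by push_cast at *; linarith⟩)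
  · have hne2 : (M : ℤ) * 2 * d ≠ (2 * j + i : ℕ) * c := fun heq =>
      false_of_mul_eq_of_not_coprime (Or.inr rfl) hM hc hMc hcd (by push_cast at *; linarith) hn1
        fun _ => hn2
    have : ((2 * j + i : ℕ) : ℤ) * c < M * 2 * d := lt_of_le_of_ne hi1 (Ne.symm hne2)
    exact use_col h (abs_lt.2 ⟨by push_cast at *; linarith, by push_cast at *; linarith⟩)

lemma pos_of_mem_genusZeroLevels {M : ℕ} (hM : M ∈ genusZeroLevels) : 0 < M := by
  revert M
  decide

lemma mk_mem_etaStabilizer {M : ℕ} (hM : M ∈ genusZeroLevels) {a b c d : ℤ}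
    (hdet : a * d - b * c = 1) (hc : (M : ℤ) ∣ c) (htr : |a + d| ≤ 2) :
    (⟨!![a, b; c, d], by rw [Matrix.det_fin_two_of]; exact hdet⟩ : SL(2, ℤ)) ∈
      etaStabilizer (etaExponents M) :=
  mem_etaStabilizer_of_trace (pos_of_mem_genusZeroLevels hM) (etaExponents_dvd M hM)
    (etaExponents_sum M hM) (fun g hg hgM => (etaExponents_cuspOrder M hM g hg hgM).1) hc htr

lemma fixedColumn_of_trace {M : ℕ} (hM : M ∈ genusZeroLevels) {a b c d : ℤ}
    (hdet : a * d - b * c = 1) (hc : (M : ℤ) ∣ c) (htr : |a + d| ≤ 2) :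
    FixedColumn (etaExponents M) a c :=
  ⟨_, mk_mem_etaStabilizer hM hdet hc htr, by simp, by simp⟩

/-- The first columns of the elements fixing the Hauptmodul are stable under multiplication by an
elliptic or parabolic matrix. -/
lemma fixedColumn_mul {M : ℕ} (hM : M ∈ genusZeroLevels) {a b c d a' c' : ℤ}
    (hdet : a * d - b * c = 1) (hc : (M : ℤ) ∣ c) (htr : |a + d| ≤ 2)
    (h : FixedColumn (etaExponents M) a' c') :
    FixedColumn (etaExponents M) (a * a' + b * c') (c * a' + d * c') := by
  obtain ⟨δ, hδ, h3, h4⟩ := h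
  let ε : SL(2, ℤ) := ⟨!![a, b; c, d], by rw [Matrix.det_fin_two_of]; exact hdet⟩
  refine ⟨ε * δ, mul_mem (mk_mem_etaStabilizer hM hdet hc htr) hδ, ?_, ?_⟩ <;>
  rw [Matrix.SpecialLinearGroup.coe_mul, Matrix.mul_apply, Fin.sum_univ_two, h3, h4] <;>
  simp [ε]

/-- The columns whose matrices are neither elliptic nor parabolic, but products of such. -/
def exceptionalColumns (M : ℕ) : List (ℕ × ℕ) :=
  match M with
  | 12 => [(2, 5), (2, 7), (2, 17), (2, 19)]
  | 13 => [(1, 2), (1, 6), (1, 7), (1, 11)]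
  | 25 => [(1, 2), (1, 3), (1, 8), (1, 12), (1, 13), (1, 17), (1, 22), (1, 23)]
  | _ => []

lemma fixedColumn_exceptional {M : ℕ} (hM : M ∈ genusZeroLevels) {x : ℕ × ℕ}
    (hx : x ∈ exceptionalColumns M) : FixedColumn (etaExponents M) (-x.2) (M * x.1) := by
  have h12 : M = 12 ∨ M = 13 ∨ M = 25 := by
    revert x
    revert M
    decide
  -- The exceptional columns are first columns of products of two or three elliptic or parabolic
  -- matrices, with the explicit factors below.
  have two : ∀ {a b c d a' b' c' d' : ℤ}, a * d - b * c = 1 ∧ (M : ℤ) ∣ c ∧ |a + d| ≤ 2 ∧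
      a' * d' - b' * c' = 1 ∧ (M : ℤ) ∣ c' ∧ |a' + d'| ≤ 2 ∧
      a * a' + b * c' = -x.2 ∧ c * a' + d * c' = M * x.1 →
      FixedColumn (etaExponents M) (-x.2) (M * x.1) := by
    rintro a b c d a' b' c' d' ⟨h1, h2, h3, h4, h5, h6, h7, h8⟩
    rw [← h7, ← h8]
    exact fixedColumn_mul hM h1 h2 h3 (fixedColumn_of_trace hM h4 h5 h6)
  have three : ∀ {a b c d a' b' c' d' a'' b'' c'' d'' : ℤ}, a * d - b * c = 1 ∧ (M : ℤ) ∣ c ∧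
      |a + d| ≤ 2 ∧ a' * d' - b' * c' = 1 ∧ (M : ℤ) ∣ c' ∧ |a' + d'| ≤ 2 ∧
      a'' * d'' - b'' * c'' = 1 ∧ (M : ℤ) ∣ c'' ∧ |a'' + d''| ≤ 2 ∧
      a * (a' * a'' + b' * c'') + b * (c' * a'' + d' * c'') = -x.2 ∧
      c * (a' * a'' + b' * c'') + d * (c' * a'' + d' * c'') = M * x.1 →
      FixedColumn (etaExponents M) (-x.2) (M * x.1) := by
    rintro a b c d a' b' c' d' a'' b'' c'' d'' ⟨h1, h2, h3, h4, h5, h6, h7, h8, h9, h10, h11⟩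
    rw [← h10, ← h11]
    exact fixedColumn_mul hM h1 h2 h3
      (fixedColumn_mul hM h4 h5 h6 (fixedColumn_of_trace hM h7 h8 h9))
  rcases h12 with rfl | rfl | rfl <;>
  simp only [exceptionalColumns, List.mem_cons, List.not_mem_nil, or_false] at hx
  · rcases hx with rfl | rfl | rfl | rfl
    · exact two (a := 7) (b := 1) (c := -36) (d := -5) (a' := 1) (b' := 0) (c' := -12) (d' := 1)
        (by decide)
    · exact two (a := 11) (b := 4) (c := -36) (d := -13) (a' := -5) (b' := -3) (c' := 12) (d' := 7)
        (by decide)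
    · exact two (a := 7) (b := 3) (c := -12) (d := -5) (a' := 13) (b' := 4) (c' := -36)
        (d' := -11) (by decide)
    · exact two (a := 29) (b := 25) (c := -36) (d := -31) (a' := -11) (b' := -12) (c' := 12)
        (d' := 13) (by decide)
  · rcases hx with rfl | rfl | rfl | rfl
    · exact two (a := 3) (b := 1) (c := -13) (d := -4) (a' := -5) (b' := -2) (c' := 13) (d' := 5)
        (by decide)
    · exact two (a := 5) (b := 2) (c := -13) (d := -5) (a' := 4) (b' := 1) (c' := -13) (d' := -3)
        (by decide)
    · exact two (a := 8) (b := 5) (c := -13) (d := -8) (a' := -9) (b' := -7) (c' := 13) (d' := 10)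
        (by decide)
    · exact two (a := 10) (b := 7) (c := -13) (d := -9) (a' := 8) (b' := 5) (c' := -13) (d' := -8)
        (by decide)
  · rcases hx with rfl | rfl | rfl | rfl | rfl | rfl | rfl | rfl
    · exact three (a := 4) (b := 1) (c := -25) (d := -6) (a' := 7) (b' := 2) (c' := -25) (d' := -7)
        (a'' := -9) (b'' := -4) (c'' := 25) (d'' := 11) (by decide)
    · exact two (a := 4) (b := 1) (c := -25) (d := -6) (a' := -7) (b' := -2) (c' := 25) (d' := 7)
        (by decide)
    · exact two (a := 7) (b := 2) (c := -25) (d := -7) (a' := 6) (b' := 1) (c' := -25) (d' := -4)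
        (by decide)
    · exact three (a := 11) (b := 4) (c := -25) (d := -9) (a' := 6) (b' := 1) (c' := -25)
        (d' := -4) (a'' := -7) (b'' := -1) (c'' := 50) (d'' := 7) (by decide)
    · exact three (a := 14) (b := 9) (c := -25) (d := -16) (a' := 18) (b' := 13) (c' := -25)
        (d' := -18) (a'' := -19) (b'' := -16) (c'' := 25) (d'' := 21) (by decide)
    · exact two (a := 18) (b := 13) (c := -25) (d := -18) (a' := -19) (b' := -16) (c' := 25)
        (d' := 21) (by decide)
    · exact two (a := 21) (b := 16) (c := -25) (d := -19) (a' := 18) (b' := 13) (c' := -25)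
        (d' := -18) (by decide)
    · exact three (a := 21) (b := 16) (c := -25) (d := -19) (a' := 18) (b' := 13) (c' := -25)
        (d' := -18) (a'' := -16) (b'' := -9) (c'' := 25) (d'' := 14) (by decide)

/-- Whether a matrix with first column `(-p, M s)` is known to fix the Hauptmodul: the column is
exceptional, or it can be completed to a matrix whose trace `e` satisfies `|e| ≤ 2`. -/
def IsKnownColumn (M s p : ℕ) : Prop :=
  (s, p) ∈ exceptionalColumns M ∨ ∃ e ∈ ([-2, -1, 0, 1, 2] : List ℤ), (M * s : ℤ) ∣ p * (p + e) + 1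

instance (M s p : ℕ) : Decidable (IsKnownColumn M s p) :=
  inferInstanceAs (Decidable (_ ∨ _))

instance (M j : ℕ) : Decidable (Covers M (IsKnownColumn M) j) :=
  inferInstanceAs (Decidable (_ ∨ _))

lemma IsKnownColumn.fixedColumn {M s p : ℕ} (hM : M ∈ genusZeroLevels) (h : IsKnownColumn M s p) :
    FixedColumn (etaExponents M) (-p) (M * s) := by
  rcases h with h | ⟨e, he, b, hb⟩
  · exact fixedColumn_exceptional hM h
  · have he2 : |e| ≤ 2 := by
      clear hb
      revert e
      decide
    exact fixedColumn_of_trace hM (a := -p) (b := -b) (c := M * s) (d := p + e)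
      (by linear_combination -hb) (dvd_mul_right _ _) (by simpa using he2)

/-- The finite computation behind the descent. -/
lemma covers_isKnownColumn : ∀ M ∈ genusZeroLevels, ∀ j < M, Covers M (IsKnownColumn M) j := by
  decide +kernel

lemma Covers.mono {M : ℕ} {Q Q' : ℕ → ℕ → Prop} (hQ : ∀ s p, Q s p → Q' s p) {j : ℕ}
    (h : Covers M Q j) : Covers M Q' j :=
  h.imp (hQ _ _) fun ⟨h0, h1⟩ => ⟨h0, h1.imp (hQ _ _) fun h2 i hi =>
    (h2 i hi).imp (hQ _ _) fun ⟨h3, h4⟩ => ⟨hQ _ _ h3, h4⟩⟩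

/-- The Hauptmodul of level `M` is invariant under `Γ₀(M)`. -/
lemma Gamma0_le_etaStabilizer {M : ℕ} (hM : M ∈ genusZeroLevels) {γ : SL(2, ℤ)}
    (hγ : (M : ℤ) ∣ γ 1 0) : γ ∈ etaStabilizer (etaExponents M) := by
  have hM0 := pos_of_mem_genusZeroLevels hM
  refine Gamma0_le_etaStabilizer_of_descent (M := M) (fun n => ?_) (fun c d hc hMc hd hdc hcd =>
    descent_of_fixedColumn hM0 (fun j hj => (covers_isKnownColumn M hM j hj).mono
      fun s p h => h.fixedColumn hM) hc hMc hd hdc hcd) hγ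
  refine mem_etaStabilizer_of_trace hM0 (etaExponents_dvd M hM) (etaExponents_sum M hM)
    (fun g hg hgM => (etaExponents_cuspOrder M hM g hg hgM).1) ?_ ?_
  · rw [ModularGroup.coe_T_zpow]; simp
  · rw [ModularGroup.coe_T_zpow]; simp

/-! ### The Hauptmodul at the cusps other than `∞` -/

/-- The Hauptmodul is bounded at the cusps that are inequivalent to `∞` under `Γ₀(M)`. -/
lemma isBoundedAtImInfty_etaQuotient_smul {M : ℕ} (hM : M ∈ genusZeroLevels) {σ : SL(2, ℤ)}
    (hσ : ¬ (M : ℤ) ∣ σ 1 0) :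
    IsBoundedAtImInfty fun z : ℍ => etaQuotient (etaExponents M) (σ • z : ℍ) := by
  have hM0 := pos_of_mem_genusZeroLevels hM
  have hL := etaExponents_dvd M hM
  obtain ⟨C, -, hlim⟩ := tendsto_etaQuotient_smul _ (fun p hp => (hL p hp).1)
    (etaExponents_sum M hM) σ
  rw [cuspExponent_eq_cuspOrder hM0 hL] at hlim
  obtain ⟨c, hc⟩ : ∃ c, c = (σ 1 0).natAbs := ⟨_, rfl⟩
  rw [← hc] at hlim
  have hg : Nat.gcd c M ≠ M := by
    intro h
    exact hσ (Int.natCast_dvd.2 (hc ▸ Nat.gcd_eq_right_iff_dvd.1 h))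
  have hord := (etaExponents_cuspOrder M hM (Nat.gcd c M) (Finset.mem_range.2
    (Nat.lt_succ_of_le (Nat.le_of_dvd hM0 (Nat.gcd_dvd_right _ _)))) (Nat.gcd_dvd_right _ _)).2 hg
  set κ : ℝ := cuspOrder (etaExponents M) M (Nat.gcd c M) / (24 * M) with hκ
  have hκ0 : 0 ≤ κ := by
    have : (0 : ℝ) ≤ cuspOrder (etaExponents M) M (Nat.gcd c M) := by exact_mod_cast hord
    positivity
  have hκC : (cuspOrder (etaExponents M) M (Nat.gcd c M) / (24 * M) : ℂ) = (κ : ℂ) := by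
    rw [hκ]; push_cast; rfl
  rw [hκC] at hlim
  have h1 : BoundedAtFilter atImInfty fun z : ℍ => Complex.exp (2 * π * Complex.I * κ * z) := by
    refine Asymptotics.IsBigO.of_bound 1 (Eventually.of_forall fun z => ?_)
    rw [Complex.norm_exp]
    simp only [Pi.one_apply, norm_one, mul_one]
    rw [Real.exp_le_one_iff, show 2 * π * Complex.I * κ * (z : ℂ) =
      ((2 * π * κ : ℝ) : ℂ) * (Complex.I * z) by push_cast; ring, Complex.re_ofReal_mul,
      Complex.I_mul_re]
    have := z.im_pos
    have : 0 ≤ 2 * π * κ * z.im := by positivity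
    rw [UpperHalfPlane.coe_im]
    linarith
  have h2 := (hlim.isBigO_one ℝ).mul h1
  refine Asymptotics.IsBigO.congr h2 (fun z => ?_) (fun z => by simp)
  rw [mul_assoc, ← Complex.exp_add]
  simp

/-! ### Integral power series on the unit disc -/

/-- The power series `p` converges on the open unit disc, with sum `g`. -/
def HasExpansion (p : PowerSeries ℂ) (g : ℂ → ℂ) : Prop :=
  ∀ q : ℂ, ‖q‖ < 1 → HasSum (fun n => PowerSeries.coeff n p * q ^ n) (g q)

namespace HasExpansion
open PowerSeries
variable {p r : PowerSeries ℂ} {g h : ℂ → ℂ}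

lemma congr (hp : HasExpansion p g) (hgh : ∀ q, ‖q‖ < 1 → g q = h q) : HasExpansion p h :=
  fun q hq => hgh q hq ▸ hp q hq

lemma const (c : ℂ) : HasExpansion (PowerSeries.C c) fun _ => c := by
  intro q _
  have := hasSum_ite_eq (0 : ℕ) c
  refine this.congr_fun fun n => ?_
  rw [PowerSeries.coeff_C]
  split_ifs with h <;> simp [h]

lemma id : HasExpansion PowerSeries.X fun q => q := by
  intro q _
  have := hasSum_ite_eq (1 : ℕ) q
  refine this.congr_fun fun n => ?_
  rw [PowerSeries.coeff_X]
  split_ifs with h <;> simp [h]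

lemma add (hp : HasExpansion p g) (hr : HasExpansion r h) :
    HasExpansion (p + r) fun q => g q + h q := by
  intro q hq
  refine ((hp q hq).add (hr q hq)).congr_fun fun n => ?_
  rw [map_add]
  ring

lemma neg (hp : HasExpansion p g) : HasExpansion (-p) fun q => -g q := by
  intro q hq
  refine (hp q hq).neg.congr_fun fun n => ?_
  rw [map_neg]
  ring

lemma mul (hp : HasExpansion p g) (hr : HasExpansion r h) :
    HasExpansion (p * r) fun q => g q * h q := by
  intro q hq
  have h1 := (hp q hq).summable.norm
  have h2 := (hr q hq).summable.norm
  have h3 := (summable_norm_sum_mul_antidiagonal_of_summable_norm h1 h2).of_norm.hasSum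
  rw [← tsum_mul_tsum_eq_tsum_sum_antidiagonal_of_summable_norm h1 h2, (hp q hq).tsum_eq,
    (hr q hq).tsum_eq] at h3
  refine h3.congr_fun fun n => ?_
  rw [PowerSeries.coeff_mul, Finset.sum_mul]
  refine Finset.sum_congr rfl fun x hx => ?_
  rw [← Finset.HasAntidiagonal.mem_antidiagonal.1 hx, pow_add]
  ring

lemma rescale (hp : HasExpansion p g) {w : ℂ} (hw : ‖w‖ = 1) :
    HasExpansion (PowerSeries.rescale w p) fun q => g (w * q) := by
  intro q hq
  refine (hp (w * q) (by rwa [norm_mul, hw, one_mul])).congr_fun fun n => ?_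
  rw [PowerSeries.coeff_rescale, mul_pow]
  ring

lemma comp_pow (hp : HasExpansion p g) {k : ℕ} (hk : k ≠ 0) :
    HasExpansion (PowerSeries.expand k hk p) fun q => g (q ^ k) := by
  intro q hq
  have h1 := hp (q ^ k) (by rw [norm_pow]; exact pow_lt_one₀ (norm_nonneg _) hq hk)
  have hinj : Function.Injective fun n : ℕ => k * n :=
    fun a b h => Nat.eq_of_mul_eq_mul_left (Nat.pos_of_ne_zero hk) h
  refine (hinj.hasSum_iff ?_).1 ?_
  · intro n hn
    rw [PowerSeries.coeff_expand_of_not_dvd, zero_mul]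
    rintro ⟨m, rfl⟩
    exact hn ⟨m, rfl⟩
  · refine h1.congr_fun fun n => ?_
    simp [pow_mul]

lemma hasFPowerSeriesAt (hp : HasExpansion p g) :
    HasFPowerSeriesAt g (FormalMultilinearSeries.ofScalars ℂ fun n => PowerSeries.coeff n p) 0 := by
  rw [hasFPowerSeriesAt_iff]
  filter_upwards [Metric.ball_mem_nhds (0 : ℂ) one_pos] with q hq
  rw [zero_add]
  refine (hp q (by simpa using hq)).congr_fun fun n => ?_
  simp [FormalMultilinearSeries.coeff_ofScalars, mul_comm]

lemma unique (hp : HasExpansion p g) (hr : HasExpansion r g) : p = r := by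
  have := hp.hasFPowerSeriesAt.eq_formalMultilinearSeries hr.hasFPowerSeriesAt
  ext n
  have h := congrArg (fun s => FormalMultilinearSeries.coeff s n) this
  simpa [FormalMultilinearSeries.coeff_ofScalars] using h

lemma apply_zero (hp : HasExpansion p g) : g 0 = PowerSeries.constantCoeff p := by
  have h := (hp 0 (by simp)).unique (hasSum_single 0 fun n hn => by simp [hn])
  simpa using h

lemma continuousAt_zero (hp : HasExpansion p g) : ContinuousAt g 0 :=
  hp.hasFPowerSeriesAt.continuousAt

lemma of_differentiableOn (hg : DifferentiableOn ℂ g (Metric.ball 0 1)) :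
    HasExpansion (PowerSeries.mk fun n => (n.factorial : ℂ)⁻¹ * iteratedDeriv n g 0) g := by
  intro q hq
  refine (Complex.hasSum_taylorSeries_on_ball hg (z := q) (by simpa using hq)).congr_fun fun n => ?_
  simp
  ring

end HasExpansion

/-- The function `g` is given on the open unit disc by a power series with integer
coefficients. -/
def IntSeries (g : ℂ → ℂ) : Prop :=
  ∃ p : PowerSeries ℤ, HasExpansion (p.map (Int.castRingHom ℂ)) g

namespace IntSeries
variable {g h : ℂ → ℂ}

lemma congr (hg : IntSeries g) (hgh : ∀ q, ‖q‖ < 1 → g q = h q) : IntSeries h :=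
  hg.imp fun _ hp => hp.congr hgh

lemma intCast (n : ℤ) : IntSeries fun _ => n :=
  ⟨PowerSeries.C n, by simpa using HasExpansion.const (n : ℂ)⟩

lemma id : IntSeries fun q => q :=
  ⟨PowerSeries.X, by simpa using HasExpansion.id⟩

lemma add (hg : IntSeries g) (hh : IntSeries h) : IntSeries fun q => g q + h q := by
  obtain ⟨p, hp⟩ := hg
  obtain ⟨r, hr⟩ := hh
  exact ⟨p + r, by simpa using hp.add hr⟩

lemma neg (hg : IntSeries g) : IntSeries fun q => -g q := by
  obtain ⟨p, hp⟩ := hg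
  exact ⟨-p, by simpa using hp.neg⟩

lemma mul (hg : IntSeries g) (hh : IntSeries h) : IntSeries fun q => g q * h q := by
  obtain ⟨p, hp⟩ := hg
  obtain ⟨r, hr⟩ := hh
  exact ⟨p * r, by simpa using hp.mul hr⟩

lemma comp_pow (hg : IntSeries g) {k : ℕ} (hk : k ≠ 0) : IntSeries fun q => g (q ^ k) := by
  obtain ⟨p, hp⟩ := hg
  refine ⟨PowerSeries.expand k hk p, ?_⟩
  convert hp.comp_pow hk using 1
  ext n
  rw [PowerSeries.coeff_map]
  by_cases hn : k ∣ n
  · obtain ⟨m, rfl⟩ := hn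
    simp
  · rw [PowerSeries.coeff_expand_of_not_dvd _ _ _ hn, PowerSeries.coeff_expand_of_not_dvd _ _ _ hn,
      map_zero]

lemma pow (hg : IntSeries g) (n : ℕ) : IntSeries fun q => g q ^ n := by
  induction n with
  | zero => simpa using intCast 1
  | succ n ih => simpa only [pow_succ] using ih.mul hg

lemma exists_apply_zero (hg : IntSeries g) : ∃ n : ℤ, g 0 = n := by
  obtain ⟨p, hp⟩ := hg
  exact ⟨PowerSeries.constantCoeff p, by
    rw [hp.apply_zero, ← PowerSeries.coeff_zero_eq_constantCoeff_apply, PowerSeries.coeff_map]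
    simp⟩

lemma continuousAt_zero (hg : IntSeries g) : ContinuousAt g 0 := hg.choose_spec.continuousAt_zero

/-- A function holomorphic on the disc is an integral power series as soon as its Taylor
coefficients are integers. -/
lemma of_differentiableOn (hg : DifferentiableOn ℂ g (Metric.ball 0 1))
    (hc : ∀ n, ∃ c : ℤ, (n.factorial : ℂ)⁻¹ * iteratedDeriv n g 0 = c) : IntSeries g := by
  choose c hc using hc
  refine ⟨PowerSeries.mk c, ?_⟩
  convert HasExpansion.of_differentiableOn hg using 1
  ext n
  simp [hc]

lemma exists_taylor (hg : IntSeries g) (hd : DifferentiableOn ℂ g (Metric.ball 0 1)) (n : ℕ) :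
    ∃ c : ℤ, (n.factorial : ℂ)⁻¹ * iteratedDeriv n g 0 = c := by
  obtain ⟨p, hp⟩ := hg
  have := (HasExpansion.of_differentiableOn hd).unique hp
  refine ⟨PowerSeries.coeff n p, ?_⟩
  have h := congrArg (PowerSeries.coeff n) this
  simpa using h

/-- Integral power series are stable under locally uniform limits. -/
lemma of_tendstoLocallyUniformlyOn {G : ℕ → ℂ → ℂ} (hG : ∀ n, IntSeries (G n))
    (hd : ∀ n, DifferentiableOn ℂ (G n) (Metric.ball 0 1))
    (hlim : TendstoLocallyUniformlyOn G g atTop (Metric.ball 0 1)) : IntSeries g := by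
  have hopen : IsOpen (Metric.ball (0 : ℂ) 1) := Metric.isOpen_ball
  refine of_differentiableOn (hlim.differentiableOn (.of_forall hd) hopen) fun m => ?_
  have key : ∀ m : ℕ, TendstoLocallyUniformlyOn (fun n => iteratedDeriv m (G n))
      (iteratedDeriv m g) atTop (Metric.ball 0 1) ∧
      ∀ n, DifferentiableOn ℂ (iteratedDeriv m (G n)) (Metric.ball 0 1) := by
    intro m
    induction m with
    | zero => simpa only [iteratedDeriv_zero] using ⟨hlim, hd⟩
    | succ m ih =>
      simp only [iteratedDeriv_succ]
      exact ⟨ih.1.deriv (.of_forall ih.2) hopen, fun n => (ih.2 n).deriv hopen⟩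
  have h0 := ((key m).1.tendsto_at (Metric.mem_ball_self one_pos)).const_mul
    ((m.factorial : ℂ)⁻¹)
  have hcl : IsClosed (Set.range ((↑) : ℤ → ℂ)) := by
    have := (Complex.isometry_ofReal.isClosedEmbedding.comp Int.isClosedEmbedding_coe_real)
    simpa [Function.comp_def] using this.isClosed_range
  obtain ⟨c, hc⟩ := hcl.mem_of_tendsto h0 (.of_forall fun n => by
    obtain ⟨c, hc⟩ := (hG n).exists_taylor (hd n) m
    exact ⟨c, hc.symm⟩)
  exact ⟨c, hc.symm⟩

/-- The inverse of an integral power series with constant term `1` is integral. -/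
lemma inv (hg : IntSeries g) (hd : DifferentiableOn ℂ g (Metric.ball 0 1)) (h0 : g 0 = 1)
    (hne : ∀ q, ‖q‖ < 1 → g q ≠ 0) : IntSeries fun q => (g q)⁻¹ := by
  obtain ⟨p, hp⟩ := hg
  have hp0 : PowerSeries.constantCoeff p = ((1 : ℤˣ) : ℤ) := by
    have := hp.apply_zero
    rw [h0, ← PowerSeries.coeff_zero_eq_constantCoeff_apply, PowerSeries.coeff_map] at this
    simpa using this.symm
  have hr := HasExpansion.of_differentiableOn (hd.fun_inv fun q hq => hne q (by simpa using hq))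
  have h1 := ((hp.mul hr).congr (h := fun _ => 1)
    fun q hq => mul_inv_cancel₀ (hne q hq)).unique (HasExpansion.const 1)
  have h2 : p.map (Int.castRingHom ℂ) * (p.invOfUnit 1).map (Int.castRingHom ℂ) = 1 := by
    rw [← map_mul, PowerSeries.mul_invOfUnit p 1 hp0, map_one]
  refine ⟨p.invOfUnit 1, ?_⟩
  convert hr using 1
  rw [map_one] at h1
  exact (left_inv_eq_right_inv (by rw [mul_comm, h1]) h2).symm

end IntSeries

/-- The functions given on the open unit disc by power series with integer coefficients form a
ring. -/
def intSeriesSubring : Subring (ℂ → ℂ) where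
  carrier := {g | IntSeries g}
  mul_mem' := fun h h' => IntSeries.mul h h'
  one_mem' := (IntSeries.intCast 1).congr fun _ _ => by simp
  add_mem' := fun h h' => IntSeries.add h h'
  zero_mem' := (IntSeries.intCast 0).congr fun _ _ => by simp
  neg_mem' := fun h => IntSeries.neg h

lemma mem_intSeriesSubring {g : ℂ → ℂ} : g ∈ intSeriesSubring ↔ IntSeries g := Iff.rfl

/-! ### The Laurent series of the Hauptmodul -/

lemma differentiableOn_eulerProduct :
    DifferentiableOn ℂ (fun q : ℂ => ∏' n : ℕ, (1 - q ^ (n + 1))) (Metric.ball 0 1) :=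
  ModularForm.differentiableOn_tprod_one_sub_pow

lemma eulerProduct_ne_zero {q : ℂ} (hq : ‖q‖ < 1) : ∏' n : ℕ, (1 - q ^ (n + 1)) ≠ 0 := by
  have := tprod_one_add_ne_zero_of_summable (f := fun n : ℕ => -q ^ (n + 1)) ?_ ?_
  · simpa [sub_eq_add_neg] using this
  · intro n h
    have h1 : q ^ (n + 1) = 1 := by linear_combination -h
    have h2 := congrArg norm h1
    rw [norm_pow, norm_one] at h2
    exact (pow_lt_one₀ (norm_nonneg q) hq n.succ_ne_zero).ne h2
  · simp only [norm_neg, norm_pow]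
    exact (summable_nat_add_iff 1).2 (summable_geometric_of_lt_one (norm_nonneg q) hq)

lemma intSeries_eulerProduct : IntSeries fun q => ∏' n : ℕ, (1 - q ^ (n + 1)) := by
  have h := ModularForm.multipliableLocallyUniformlyOn_one_sub_pow.hasProdLocallyUniformlyOn
  have h2 : TendstoLocallyUniformlyOn (fun (N : ℕ) q => ∏ n ∈ Finset.range N, (1 - q ^ (n + 1)))
      (fun q : ℂ => ∏' n : ℕ, (1 - q ^ (n + 1))) atTop (Metric.ball 0 1) := by
    intro u hu x hx
    obtain ⟨t, ht, H⟩ := h u hu x hx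
    exact ⟨t, ht, tendsto_finset_range.eventually H⟩
  refine IntSeries.of_tendstoLocallyUniformlyOn (fun N => ?_) (fun N => ?_) h2
  · have : (∏ n ∈ Finset.range N, fun q : ℂ => 1 - q ^ (n + 1)) ∈ intSeriesSubring :=
      Subring.prod_mem _ fun n _ => Subring.sub_mem _ (Subring.one_mem _)
        (IntSeries.id.comp_pow n.succ_ne_zero)
    rw [mem_intSeriesSubring] at this
    exact this.congr fun q _ => by simp
  · exact DifferentiableOn.fun_finsetProd fun n _ => by fun_prop

lemma intSeries_eulerProduct_zpow (r : ℤ) :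
    IntSeries fun q => (∏' n : ℕ, (1 - q ^ (n + 1))) ^ r := by
  cases r with
  | ofNat n => simpa using intSeries_eulerProduct.pow n
  | negSucc n =>
    simp only [zpow_negSucc, ← inv_pow]
    exact (intSeries_eulerProduct.inv differentiableOn_eulerProduct (by simp)
      fun q hq => eulerProduct_ne_zero hq).pow (n + 1)

/-- The Hauptmodul has a simple pole at `∞`, and its Laurent series in `q = exp (2πiz)` has integer
coefficients and leading coefficient `1`. -/
lemma exists_intSeries_etaQuotient {M : ℕ} (hM : M ∈ genusZeroLevels) :
    ∃ u : ℂ → ℂ, IntSeries u ∧ u 0 = 1 ∧ ∀ z : ℂ, 0 < z.im →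
      etaQuotient (etaExponents M) z * Complex.exp (2 * π * Complex.I * z) =
        u (Complex.exp (2 * π * Complex.I * z)) := by
  have hL := etaExponents_dvd M hM
  have key : ∀ L : List (ℕ × ℤ), (∀ p ∈ L, 0 < p.1) → ∃ u : ℂ → ℂ, IntSeries u ∧ u 0 = 1 ∧
      ∀ z : ℂ, 0 < z.im → etaQuotient L z =
        Complex.exp (2 * π * Complex.I * z / 24 * (L.map fun p => (p.1 : ℤ) * p.2).sum) *
        u (Complex.exp (2 * π * Complex.I * z)) := by
    intro L
    induction L with
    | nil =>
      exact fun _ => ⟨fun _ => 1, by simpa using IntSeries.intCast 1, rfl,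
        by simp [etaQuotient_nil]⟩
    | cons p L ih =>
      intro h
      obtain ⟨u, hu, hu0, hut⟩ := ih fun p hp => h p (List.mem_cons_of_mem _ hp)
      have hp : 0 < p.1 := h p List.mem_cons_self
      refine ⟨_, ((intSeries_eulerProduct_zpow p.2).comp_pow hp.ne').mul hu, ?_, fun z hz => ?_⟩
      · simp [hu0, hp.ne']
      · rw [etaQuotient_cons, hut z hz, ModularForm.eta, mul_zpow]
        have h1 : ∀ n, ModularForm.eta_q n (p.1 * z) =
            (Complex.exp (2 * π * Complex.I * z) ^ p.1) ^ (n + 1) := by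
          intro n
          rw [ModularForm.eta_q_eq_pow, ← Complex.exp_nat_mul _ p.1]
          congr 2; ring
        have h2 : Function.Periodic.qParam 24 (p.1 * z) ^ p.2 =
            Complex.exp (2 * π * Complex.I * z / 24 * ((p.1 : ℤ) * p.2 : ℤ)) := by
          rw [Function.Periodic.qParam, ← Complex.exp_int_mul]
          congr 1; push_cast; ring
        simp only [h1, h2, List.map_cons, List.sum_cons]
        rw [Int.cast_add, mul_add, Complex.exp_add]
        ring
  obtain ⟨u, hu, hu0, hut⟩ := key _ fun p hp => (hL p hp).1
  refine ⟨u, hu, hu0, fun z hz => ?_⟩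
  rw [hut z hz, etaExponents_weighted_sum M hM, mul_right_comm, ← Complex.exp_add]
  convert one_mul _ using 2
  rw [← Complex.exp_zero]
  congr 1
  push_cast
  ring

/-! ### Norms of integral power series -/

/-- Evaluation of integral power series at a point of the unit disc. -/
def evalSeries (q : ℂ) : intSeriesSubring →+* ℂ :=
  (Pi.evalRingHom (fun _ : ℂ => ℂ) q).comp intSeriesSubring.subtype

@[simp] lemma evalSeries_apply (q : ℂ) (g : intSeriesSubring) : evalSeries q g = g.1 q := rfl

/-- An integral power series splits into its parts with exponents in the residue classes
modulo `d`. -/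
lemma IntSeries.exists_residue_parts {u : ℂ → ℂ} (hu : IntSeries u) {d : ℕ} (hd : 0 < d) :
    ∃ a : ℕ → intSeriesSubring, ∀ w : ℂ, w ^ d = 1 → ∀ y : ℂ, ‖y‖ < 1 →
      u (w * y) = ∑ i ∈ Finset.range d, w ^ i * (a i).1 y := by
  obtain ⟨p, hp⟩ := hu
  have hs : ∀ i, ∃ g : ℂ → ℂ, HasExpansion ((PowerSeries.mk fun n =>
      if n % d = i then PowerSeries.coeff n p else 0).map (Int.castRingHom ℂ)) g := by
    intro i
    refine ⟨fun q => ∑' n, _, fun q hq => Summable.hasSum ?_⟩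
    refine Summable.of_norm_bounded (hp q hq).summable.norm fun n => ?_
    simp only [PowerSeries.coeff_map, PowerSeries.coeff_mk]
    split_ifs
    · rfl
    · simpa using by positivity
  choose a ha using hs
  refine ⟨fun i => ⟨a i, _, ha i⟩, fun w hw y hy => ?_⟩
  have hw1 : ‖w‖ = 1 := Complex.norm_eq_one_of_pow_eq_one hw hd.ne'
  have h1 := hp (w * y) (by rwa [norm_mul, hw1, one_mul])
  have h2 := hasSum_sum (s := Finset.range d) fun i _ => (ha i y hy).mul_left (w ^ i)
  refine h1.unique (h2.congr_fun fun n => ?_)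
  simp only [PowerSeries.coeff_map, PowerSeries.coeff_mk]
  rw [Finset.sum_eq_single (n % d)]
  · rw [if_pos rfl, mul_pow]
    have : w ^ n = w ^ (n % d) := by
      conv_lhs => rw [← Nat.div_add_mod n d, pow_add, pow_mul, hw, one_pow, one_mul]
    rw [this]
    ring
  · intro i _ hi
    rw [if_neg (Ne.symm hi)]
    simp
  · intro h
    exact absurd (Finset.mem_range.2 (Nat.mod_lt n hd)) h

/-- An integral power series that is invariant under `y ↦ ζy`, with `ζ` a primitive `d`-th root of
unity, is a power series in `y ^ d`. -/
lemma IntSeries.exists_comp_pow {g : ℂ → ℂ} (hg : IntSeries g) {d : ℕ} (hd : 0 < d) {ζ : ℂ}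
    (hζ : IsPrimitiveRoot ζ d) (hinv : ∀ y, ‖y‖ < 1 → g (ζ * y) = g y) :
    ∃ h : intSeriesSubring, ∀ y, ‖y‖ < 1 → g y = h.1 (y ^ d) := by
  obtain ⟨p, hp⟩ := hg
  have hζ1 : ‖ζ‖ = 1 := Complex.norm_eq_one_of_pow_eq_one hζ.pow_eq_one hd.ne'
  have h1 := ((hp.rescale hζ1).congr hinv).unique hp
  have h2 : ∀ n, ¬ d ∣ n → PowerSeries.coeff n p = 0 := by
    intro n hn
    have h := congrArg (PowerSeries.coeff n) h1
    rw [PowerSeries.coeff_rescale, PowerSeries.coeff_map] at h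
    have h3 : (ζ ^ n - 1) * ((PowerSeries.coeff n p : ℤ) : ℂ) = 0 := by
      rw [sub_mul, one_mul]
      simpa [sub_eq_zero] using h
    rcases mul_eq_zero.1 h3 with h | h
    · exact absurd ((hζ.pow_eq_one_iff_dvd n).1 (sub_eq_zero.1 h)) hn
    · exact_mod_cast h
  have key : ∀ y, ‖y‖ < 1 → HasSum (fun n => PowerSeries.coeff n ((PowerSeries.mk fun n =>
      PowerSeries.coeff (d * n) p).map (Int.castRingHom ℂ)) * (y ^ d) ^ n) (g y) := by
    intro y hy
    have hinj : Function.Injective fun n : ℕ => d * n :=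
      fun a b h => Nat.eq_of_mul_eq_mul_left hd h
    refine ((hinj.hasSum_iff ?_).2 (hp y hy)).congr_fun fun n => ?_
    · intro n hn
      rw [PowerSeries.coeff_map, h2, map_zero, zero_mul]
      rintro ⟨m, rfl⟩
      exact hn ⟨m, rfl⟩
    · simp [pow_mul]
  refine ⟨⟨fun q => ∑' n, PowerSeries.coeff n ((PowerSeries.mk fun n =>
      PowerSeries.coeff (d * n) p).map (Int.castRingHom ℂ)) * q ^ n, PowerSeries.mk fun n =>
      PowerSeries.coeff (d * n) p, fun q hq => ?_⟩, fun y hy => (key y hy).tsum_eq.symm⟩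
  obtain ⟨y, rfl⟩ := IsAlgClosed.exists_pow_nat_eq q hd
  have hy : ‖y‖ < 1 := by
    rw [norm_pow] at hq
    exact (pow_lt_one_iff_of_nonneg (norm_nonneg y) hd.ne').1 hq
  exact (key y hy).summable.hasSum

open Polynomial in
/-- The norm of `y X - u(y)` from power series in `y` to power series in `y ^ d` has integral
coefficients. To avoid coefficients in `ℤ[ζ]`, the norm is written as the resultant with respect to
`Z` of `Z ^ d - 1` and of a polynomial in `Z` that takes the value `ζ ^ b y X - u(ζ ^ b y)` at
`Z = ζ ^ b`. -/
lemma exists_norm_series {u : ℂ → ℂ} (hu : IntSeries u) {d : ℕ} (hd : 0 < d) {ζ : ℂ}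
    (hζ : IsPrimitiveRoot ζ d) :
    ∃ V : intSeriesSubring[X], ∀ y : ℂ, ‖y‖ < 1 →
      ∏ b ∈ Finset.range d, (C (ζ ^ b * y) * X - C (u (ζ ^ b * y))) =
        V.map (evalSeries (y ^ d)) := by
  obtain ⟨a, ha⟩ := hu.exists_residue_parts hd
  obtain ⟨Y, hY⟩ : ∃ Y : intSeriesSubring, ∀ y, Y.1 y = y := ⟨⟨_, IntSeries.id⟩, fun _ => rfl⟩
  obtain ⟨G, hGdef⟩ : ∃ G : intSeriesSubring[X][X], G =
    C (C Y * X) * X - ∑ i ∈ Finset.range d, C (C (a i)) * X ^ i := ⟨_, rfl⟩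
  have hGdeg : G.natDegree ≤ d := by
    rw [hGdef]
    refine (natDegree_sub_le _ _).trans (max_le ?_ ?_)
    · exact (natDegree_C_mul_le _ _).trans (natDegree_X_le.trans hd)
    · refine natDegree_sum_le_of_forall_le _ _ fun i hi => ?_
      exact (natDegree_C_mul_X_pow_le _ _).trans (Finset.mem_range.1 hi).le
  set R : intSeriesSubring[X] := resultant (X ^ d - C 1) G d d with hR
  have hRy : ∀ y : ℂ, ‖y‖ < 1 → R.map (evalSeries y) =
      ∏ b ∈ Finset.range d, (C (ζ ^ b * y) * X - C (u (ζ ^ b * y))) := by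
    intro y hy
    refine Polynomial.funext fun x => ?_
    obtain ⟨φ, hφ⟩ : ∃ φ : intSeriesSubring[X] →+* ℂ, φ = eval₂RingHom (evalSeries y) x := ⟨_, rfl⟩
    have h1 : (R.map (evalSeries y)).eval x = φ R := by rw [hφ, eval_map]; rfl
    rw [h1, hR, ← resultant_map_map]
    have h2 : (X ^ d - C 1 : intSeriesSubring[X][X]).map φ = X ^ d - C 1 := by simp
    have h3 : (X ^ d - C (1 : ℂ)).natDegree = d := natDegree_X_pow_sub_C
    have h4 := resultant_eq_prod_eval (X ^ d - C (1 : ℂ)) (G.map φ) d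
      (natDegree_map_le.trans hGdeg) (IsAlgClosed.splits _)
    rw [h3] at h4
    rw [h2, h4, (monic_X_pow_sub_C (1 : ℂ) hd.ne').leadingCoeff, one_pow, one_mul]
    change ((nthRoots d (1 : ℂ)).map _).prod = _
    rw [hζ.nthRoots_eq (one_pow d), Multiset.map_map, eval_prod]
    refine congrArg Multiset.prod (Multiset.map_congr rfl fun b _ => ?_)
    rw [ha (ζ ^ b) (by rw [← pow_mul, mul_comm, pow_mul, hζ.pow_eq_one, one_pow]) y hy]
    simp only [Function.comp_apply, mul_one, hGdef, hφ]
    simp [Polynomial.eval_finsetSum, Polynomial.map_sum, hY]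
    simp only [mul_comm, mul_assoc, mul_left_comm]
  have hinv : ∀ j, ∃ h : intSeriesSubring, ∀ y, ‖y‖ < 1 → (R.coeff j).1 y = h.1 (y ^ d) := by
    intro j
    refine IntSeries.exists_comp_pow (R.coeff j).2 hd hζ fun y hy => ?_
    have hζ1 : ‖ζ‖ = 1 := Complex.norm_eq_one_of_pow_eq_one hζ.pow_eq_one hd.ne'
    have h : R.map (evalSeries (ζ * y)) = R.map (evalSeries y) := by
      rw [hRy y hy, hRy (ζ * y) (by rwa [norm_mul, hζ1, one_mul])]
      obtain ⟨m, rfl⟩ : ∃ m, d = m + 1 := ⟨d - 1, by omega⟩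
      rw [Finset.prod_range_succ, Finset.prod_range_succ']
      have h5 : ζ ^ m * (ζ * y) = y := by
        rw [← mul_assoc, ← pow_succ, hζ.pow_eq_one, one_mul]
      congr 1
      · exact Finset.prod_congr rfl fun b _ => by rw [← mul_assoc, ← pow_succ]
      · rw [h5, pow_zero, one_mul]
    have := congrArg (fun P => P.coeff j) h
    simpa [coeff_map] using this
  choose h hh using hinv
  refine ⟨∑ j ∈ Finset.range (R.natDegree + 1), C (h j) * X ^ j, fun y hy => ?_⟩
  rw [← hRy y hy]
  conv_lhs => rw [R.as_sum_range_C_mul_X_pow]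
  simp only [Polynomial.map_sum, Polynomial.map_mul, Polynomial.map_pow, map_C, map_X,
    evalSeries_apply]
  exact Finset.sum_congr rfl fun j _ => by rw [hh j y hy]

/-! ### Modular functions as polynomials in the Hauptmodul -/

lemma tendsto_exp_atImInfty :
    Tendsto (fun z : ℍ => Complex.exp (2 * π * Complex.I * z)) atImInfty (𝓝 0) := by
  have h := (Function.Periodic.qParam_tendsto one_pos).mono_right nhdsWithin_le_nhds
  have h2 := h.comp tendsto_coe_atImInfty
  refine h2.congr fun z => ?_
  simp [Function.Periodic.qParam]

lemma norm_exp_lt_one {z : ℂ} (hz : 0 < z.im) : ‖Complex.exp (2 * π * Complex.I * z)‖ < 1 := by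
  rw [Complex.norm_exp, Real.exp_lt_one_iff, show 2 * π * Complex.I * z =
    ((2 * π : ℝ) : ℂ) * (Complex.I * z) by push_cast; ring, Complex.re_ofReal_mul,
    Complex.I_mul_re]
  have : 0 < 2 * π * z.im := by positivity
  linarith

/-- A holomorphic function on `ℍ` that is invariant under `Γ₀(M)` and bounded at all cusps is
constant. -/
lemma exists_eq_const {M : ℕ} (hM : 0 < M) {f : ℂ → ℂ} (hf : DifferentiableOn ℂ f {z | 0 < z.im})
    (hinv : ∀ γ : SL(2, ℤ), (M : ℤ) ∣ γ 1 0 → ∀ z : ℍ, f (γ • z : ℍ) = f z)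
    (hbd : ∀ σ : SL(2, ℤ), IsBoundedAtImInfty fun z : ℍ => f (σ • z : ℍ)) :
    ∃ c, ∀ z : ℍ, f z = c := by
  have : NeZero M := ⟨hM.ne'⟩
  have hsl : ∀ σ : SL(2, ℤ), ((fun z : ℍ => f z) ∣[(0 : ℤ)] σ) = fun z : ℍ => f (σ • z : ℍ) := by
    intro σ
    ext z
    rw [ModularForm.SL_slash_apply]
    simp
  let F : ModularForm ((CongruenceSubgroup.Gamma0 M).map (Matrix.SpecialLinearGroup.mapGL ℝ)) 0 :=
    { toFun := fun z => f z
      slash_action_eq' := by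
        rintro _ ⟨γ, hγ, rfl⟩
        refine (hsl γ).trans ?_
        ext z
        refine hinv γ ?_ z
        rw [SetLike.mem_coe, CongruenceSubgroup.Gamma0_mem] at hγ
        exact (ZMod.intCast_zmod_eq_zero_iff_dvd _ _).1 hγ
      holo' := by
        rw [UpperHalfPlane.mdifferentiable_iff]
        refine hf.congr fun z hz => ?_
        simp [UpperHalfPlane.ofComplex_apply_of_im_pos hz]
      bdd_at_cusps' := by
        intro c hc
        rw [Subgroup.IsArithmetic.isCusp_iff_isCusp_SL2Z] at hc
        rw [OnePoint.isBoundedAt_iff_forall_SL2Z hc]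
        intro γ _
        rw [hsl]
        exact hbd γ }
  obtain ⟨c, hc⟩ := ModularForm.eq_const_of_weight_zero F
  exact ⟨c, fun z => congrFun hc z⟩

/-- An integral power series without constant term is divisible by `q`. -/
lemma IntSeries.exists_eq_mul {g : ℂ → ℂ} (hg : IntSeries g) (h0 : g 0 = 0) :
    ∃ h, IntSeries h ∧ ∀ q, ‖q‖ < 1 → g q = q * h q := by
  obtain ⟨p, hp⟩ := hg
  have hp0 : ((PowerSeries.coeff 0 p : ℤ) : ℂ) = 0 := by
    have := hp.apply_zero
    rw [h0, ← PowerSeries.coeff_zero_eq_constantCoeff_apply, PowerSeries.coeff_map] at this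
    simpa using this.symm
  have key : ∀ q, ‖q‖ < 1 → Summable fun n => PowerSeries.coeff n ((PowerSeries.mk fun n =>
      PowerSeries.coeff (n + 1) p).map (Int.castRingHom ℂ)) * q ^ n := by
    intro q hq
    by_cases h : q = 0
    · refine summable_of_ne_finset_zero (s := {0}) fun n hn => ?_
      rw [h, zero_pow (by simpa using hn), mul_zero]
    · have h1 := ((summable_nat_add_iff 1).2 (hp q hq).summable).mul_right q⁻¹
      refine h1.congr fun n => ?_
      simp only [PowerSeries.coeff_map, PowerSeries.coeff_mk, pow_succ]
      field_simp
  refine ⟨_, ⟨_, fun q hq => (key q hq).hasSum⟩, fun q hq => ?_⟩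
  have h1 := (hasSum_nat_add_iff' 1).2 (hp q hq)
  have h2 := (key q hq).hasSum.mul_left q
  have h3 := h1.unique (h2.congr_fun fun n => by
    simp only [PowerSeries.coeff_map, PowerSeries.coeff_mk, pow_succ]
    ring)
  rw [← h3]
  rw [Finset.sum_range_one, PowerSeries.coeff_map, eq_intCast, hp0, zero_mul, sub_zero]

/-- A function that is holomorphic on `ℍ`, invariant under `Γ₀(M)`, bounded at the cusps other than
`∞`, and has a pole of order at most `k` at `∞` with integral Laurent coefficients is a polynomial
of degree at most `k` in the Hauptmodul, with integral coefficients. Subtracting multiples of powers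
of the Hauptmodul removes the pole. -/
lemma exists_polynomial_of_intSeries {M : ℕ} (hM : M ∈ genusZeroLevels) (k : ℕ) {f g : ℂ → ℂ}
    (hf : DifferentiableOn ℂ f {z | 0 < z.im})
    (hinv : ∀ γ : SL(2, ℤ), (M : ℤ) ∣ γ 1 0 → ∀ z : ℍ, f (γ • z : ℍ) = f z)
    (hbd : ∀ σ : SL(2, ℤ), ¬ (M : ℤ) ∣ σ 1 0 → IsBoundedAtImInfty fun z : ℍ => f (σ • z : ℍ))
    (hg : IntSeries g) (hfg : ∀ z : ℂ, 0 < z.im →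
      f z * Complex.exp (2 * π * Complex.I * z) ^ k = g (Complex.exp (2 * π * Complex.I * z))) :
    ∃ P : Polynomial ℤ, P.natDegree ≤ k ∧ (P.coeff k : ℂ) = g 0 ∧
      ∀ z : ℂ, 0 < z.im → f z = Polynomial.aeval (etaQuotient (etaExponents M) z) P := by
  have hM0 := pos_of_mem_genusZeroLevels hM
  induction k generalizing f g with
  | zero =>
    have hlim : Tendsto (fun z : ℍ => f z) atImInfty (𝓝 (g 0)) := by
      refine (hg.continuousAt_zero.tendsto.comp tendsto_exp_atImInfty).congr fun z => ?_
      simpa using (hfg z z.im_pos).symm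
    obtain ⟨c, hc⟩ := exists_eq_const hM0 hf hinv fun σ => by
      by_cases hσ : (M : ℤ) ∣ σ 1 0
      · simp only [hinv σ hσ]
        exact hlim.isBigO_one ℝ
      · exact hbd σ hσ
    obtain ⟨n, hn⟩ := hg.exists_apply_zero
    have hcg : c = g 0 := tendsto_nhds_unique (by simpa only [hc] using tendsto_const_nhds) hlim
    refine ⟨Polynomial.C n, by simp, by simp [hn], fun z hz => ?_⟩
    rw [hc ⟨z, hz⟩, hcg, hn]
    simp
  | succ k ih =>
    obtain ⟨u, hu, hu0, hut⟩ := exists_intSeries_etaQuotient hM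
    obtain ⟨n, hn⟩ := hg.exists_apply_zero
    obtain ⟨h, hh, hgh⟩ := IntSeries.exists_eq_mul
      (hg.add ((IntSeries.intCast (-n)).mul (hu.pow (k + 1)))) (by simp [hn, hu0])
    have hinvt : ∀ γ : SL(2, ℤ), (M : ℤ) ∣ γ 1 0 → ∀ z : ℍ,
        etaQuotient (etaExponents M) (γ • z : ℍ) = etaQuotient (etaExponents M) z := by
      intro γ hγ
      exact mem_etaStabilizer.1 (Gamma0_le_etaStabilizer hM hγ)
    obtain ⟨P, hP1, -, hP3⟩ := ih (f := fun z => f z - n * etaQuotient (etaExponents M) z ^ (k + 1))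
      (g := h) (hf.sub (((differentiableOn_etaQuotient _
        fun p hp => (etaExponents_dvd M hM p hp).1).pow _).const_mul _))
      (fun γ hγ z => by rw [hinv γ hγ, hinvt γ hγ])
      (fun σ hσ => by
        have h1 := hbd σ hσ
        have h2 := isBoundedAtImInfty_etaQuotient_smul hM hσ
        have h3 : (fun z : ℍ => etaQuotient (etaExponents M) (σ • z : ℍ) ^ (k + 1)) =O[atImInfty]
            (1 : ℍ → ℝ) :=
          (h2.pow (k + 1)).congr (fun _ => rfl) fun _ => one_pow _
        exact h1.sub (h3.const_mul_left (n : ℂ))) hh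
      (fun z hz => by
        have h1 := hfg z hz
        have h2 := hut z hz
        have h3 := hgh _ (norm_exp_lt_one hz)
        have h4 := Complex.exp_ne_zero (2 * π * Complex.I * z)
        refine mul_left_cancel₀ h4 (Eq.trans ?_ h3)
        rw [← h2, ← h1]
        push_cast
        ring)
    refine ⟨P + Polynomial.C n * Polynomial.X ^ (k + 1), ?_, ?_, fun z hz => ?_⟩
    · exact (Polynomial.natDegree_add_le _ _).trans (max_le (hP1.trans k.le_succ)
        (Polynomial.natDegree_C_mul_X_pow_le _ _))
    · rw [Polynomial.coeff_add, Polynomial.coeff_eq_zero_of_natDegree_lt (by omega), hn]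
      simp
    · rw [map_add, ← hP3 z hz]
      simp

/-! ### Hermite bases of sublattices of `ℤ²` -/

/-- In the residue class of `m` modulo `M` there are integers prime to `n`, unless `m`, `n` and `M`
have a common prime factor. -/
lemma exists_isCoprime_add_mul {m n M : ℤ} (hn : n ≠ 0)
    (h : ∀ p : ℤ, Prime p → p ∣ m → p ∣ n → ¬ p ∣ M) : ∃ k : ℤ, IsCoprime (m + k * M) n := by
  classical
  -- The product of the primes that divide `n` but not `m`.
  refine ⟨∏ p ∈ n.natAbs.primeFactors.filter fun p : ℕ => ¬ (p : ℤ) ∣ m, ((p : ℕ) : ℤ), ?_⟩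
  refine isCoprime_of_prime_dvd (fun h0 => hn h0.2) fun p hp hp1 hpn => ?_
  have hp' : p.natAbs.Prime := Int.prime_iff_natAbs_prime.1 hp
  have hdvd : ∀ x : ℤ, p ∣ x ↔ ((p.natAbs : ℕ) : ℤ) ∣ x := fun x => (Int.natAbs_dvd).symm
  by_cases hpm : p ∣ m
  · have h1 := (dvd_add_right hpm).1 hp1
    rcases hp.dvd_or_dvd h1 with h2 | h2
    · obtain ⟨q, hq, hpq⟩ := (hp.dvd_finsetProd_iff _).1 h2
      rw [Finset.mem_filter, Nat.mem_primeFactors] at hq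
      rw [hdvd, Int.natCast_dvd_natCast, Nat.prime_dvd_prime_iff_eq hp' hq.1.1] at hpq
      exact hq.2 (hpq ▸ (hdvd m).1 hpm)
    · exact h p hp hpm hpn h2
  · refine hpm ((dvd_add_left (Dvd.dvd.mul_right ?_ M)).1 hp1)
    rw [hdvd]
    refine Finset.dvd_prod_of_mem (fun q : ℕ => (q : ℤ)) (Finset.mem_filter.2 ⟨?_, ?_⟩)
    · exact Nat.mem_primeFactors.2 ⟨hp', Int.natAbs_dvd_natAbs.2 hpn, Int.natAbs_ne_zero.2 hn⟩
    · rwa [← hdvd]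

/-- The sublattice of `ℤ²` with Hermite basis `(d, 0)`, `(b, a)`. -/
def hermiteLattice (a b d : ℕ) : AddSubgroup (ℤ × ℤ) :=
  AddSubgroup.closure {((d : ℤ), 0), ((b : ℤ), (a : ℤ))}

lemma mem_hermiteLattice {a b d : ℕ} {v : ℤ × ℤ} :
    v ∈ hermiteLattice a b d ↔ ∃ i j : ℤ, v.1 = i * d + j * b ∧ v.2 = j * a := by
  rw [hermiteLattice, AddSubgroup.mem_closure_pair]
  refine exists_congr fun i => exists_congr fun j => ?_
  rw [Prod.ext_iff]
  simp [eq_comm]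

/-- The index of a subgroup of `ℤ²` is the product of the indices of its intersection with the first
factor and of its projection to the second one. -/
lemma index_eq_mul_of_projections {H : AddSubgroup (ℤ × ℤ)} {a d : ℕ}
    (hd : H.comap (AddMonoidHom.inl ℤ ℤ) = AddSubgroup.zmultiples (d : ℤ))
    (ha : H.map (AddMonoidHom.snd ℤ ℤ) = AddSubgroup.zmultiples (a : ℤ)) : H.index = a * d := by
  have h1 := AddSubgroup.relIndex_mul_index
    (le_sup_left : H ≤ H ⊔ (AddMonoidHom.snd ℤ ℤ).ker)
  have h2 := AddSubgroup.index_map H (AddMonoidHom.snd ℤ ℤ)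
  have h3 := AddSubgroup.index_comap H (AddMonoidHom.inl ℤ ℤ)
  have h4 : (AddMonoidHom.inl ℤ ℤ).range = (AddMonoidHom.snd ℤ ℤ).ker := by
    ext v
    rw [AddMonoidHom.mem_range, AddMonoidHom.mem_ker]
    exact ⟨fun ⟨x, hx⟩ => hx ▸ rfl, fun h => ⟨v.1, Prod.ext rfl h.symm⟩⟩
  have h5 : (AddMonoidHom.snd ℤ ℤ).range = ⊤ :=
    AddMonoidHom.range_eq_top.2 fun y => ⟨(0, y), rfl⟩
  rw [ha, h5, AddSubgroup.index_top, mul_one, Int.index_zmultiples, Int.natAbs_natCast] at h2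
  rw [hd, h4, Int.index_zmultiples, Int.natAbs_natCast] at h3
  rw [AddSubgroup.relIndex_sup_left, ← h3, ← h2] at h1
  rw [← h1, mul_comm]

lemma comap_inl_hermiteLattice {a b d : ℕ} (ha : 0 < a) :
    (hermiteLattice a b d).comap (AddMonoidHom.inl ℤ ℤ) = AddSubgroup.zmultiples (d : ℤ) := by
  ext x
  rw [AddSubgroup.mem_comap, mem_hermiteLattice, AddSubgroup.mem_zmultiples_iff]
  constructor
  · rintro ⟨i, j, h1, h2⟩
    have : j = 0 := by
      rcases mul_eq_zero.1 (show j * (a : ℤ) = 0 from h2.symm) with h | h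
      · exact h
      · omega
    exact ⟨i, by simpa [this] using h1.symm⟩
  · rintro ⟨i, rfl⟩
    exact ⟨i, 0, by simp, by simp⟩

lemma map_snd_hermiteLattice {a b d : ℕ} :
    (hermiteLattice a b d).map (AddMonoidHom.snd ℤ ℤ) = AddSubgroup.zmultiples (a : ℤ) := by
  ext y
  rw [AddSubgroup.mem_map, AddSubgroup.mem_zmultiples_iff]
  constructor
  · rintro ⟨v, hv, rfl⟩
    obtain ⟨i, j, -, h2⟩ := mem_hermiteLattice.1 hv
    exact ⟨j, by simpa using h2.symm⟩
  · rintro ⟨j, rfl⟩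
    exact ⟨(j * b, j * a), mem_hermiteLattice.2 ⟨0, j, by simp, rfl⟩, by simp⟩

lemma index_hermiteLattice {a b d : ℕ} (ha : 0 < a) : (hermiteLattice a b d).index = a * d :=
  index_eq_mul_of_projections (comap_inl_hermiteLattice ha) map_snd_hermiteLattice

lemma hermiteLattice_injective {a b d a' b' d' : ℕ} (ha : 0 < a) (ha' : 0 < a') (hb : b < d)
    (hb' : b' < d') (h : hermiteLattice a b d = hermiteLattice a' b' d') :
    a = a' ∧ b = b' ∧ d = d' := by
  have hd : d = d' := by
    have h1 := comap_inl_hermiteLattice (b := b) (d := d) ha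
    rw [h, comap_inl_hermiteLattice ha'] at h1
    have h2 := congrArg AddSubgroup.index h1
    simpa [Int.index_zmultiples] using h2.symm
  have haa : a = a' := by
    have h1 := map_snd_hermiteLattice (a := a) (b := b) (d := d)
    rw [h, map_snd_hermiteLattice] at h1
    have h2 := congrArg AddSubgroup.index h1
    simpa [Int.index_zmultiples] using h2.symm
  subst hd haa
  have h1 : ((b : ℤ), (a : ℤ)) ∈ hermiteLattice a b' d :=
    h ▸ mem_hermiteLattice.2 ⟨0, 1, by simp, by simp⟩
  obtain ⟨i, j, h2, h3⟩ := mem_hermiteLattice.1 h1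
  have hj : j = 1 := by
    have : (j - 1) * (a : ℤ) = 0 := by linear_combination -h3
    rcases mul_eq_zero.1 this with h | h <;> omega
  have h4 : (b : ℤ) ≡ b' [ZMOD d] := (Int.modEq_iff_dvd.2 ⟨-i, by simp [hj] at h2; rw [h2]; ring⟩)
  have h5 : b % d = b' % d := (Int.natCast_modEq_iff.1 h4)
  exact ⟨rfl, by rwa [Nat.mod_eq_of_lt hb, Nat.mod_eq_of_lt hb'] at h5, rfl⟩

/-- Every subgroup of `ℤ²` of finite index has a Hermite basis. -/
lemma exists_hermiteLattice {H : AddSubgroup (ℤ × ℤ)} {N : ℕ} (hN : 0 < N) (hH : H.index = N) :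
    ∃ a b d : ℕ, 0 < a ∧ b < d ∧ a * d = N ∧ H = hermiteLattice a b d := by
  obtain ⟨d, hd⟩ := Int.subgroup_cyclic (H.comap (AddMonoidHom.inl ℤ ℤ))
  obtain ⟨a, ha⟩ := Int.subgroup_cyclic (H.map (AddMonoidHom.snd ℤ ℤ))
  have hd' : H.comap (AddMonoidHom.inl ℤ ℤ) = AddSubgroup.zmultiples (d.natAbs : ℤ) := by
    rw [hd, Int.zmultiples_natAbs, AddSubgroup.zmultiples_eq_closure]
  have ha' : H.map (AddMonoidHom.snd ℤ ℤ) = AddSubgroup.zmultiples (a.natAbs : ℤ) := by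
    rw [ha, Int.zmultiples_natAbs, AddSubgroup.zmultiples_eq_closure]
  have had := index_eq_mul_of_projections hd' ha'
  rw [hH] at had
  generalize d.natAbs = d at hd' had
  generalize a.natAbs = a at ha' had
  have hapos : 0 < a := Nat.pos_of_ne_zero fun h => by simp [h] at had; omega
  have hdpos : 0 < d := Nat.pos_of_ne_zero fun h => by simp [h] at had; omega
  obtain ⟨⟨x, y⟩, hxH, hy⟩ : (a : ℤ) ∈ H.map (AddMonoidHom.snd ℤ ℤ) :=
    ha' ▸ AddSubgroup.mem_zmultiples _
  have hy' : y = a := hy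
  subst hy'
  have hdH : ∀ z : ℤ, (z, (0 : ℤ)) ∈ H ↔ (d : ℤ) ∣ z := by
    intro z
    rw [← Int.mem_zmultiples_iff, ← hd']
    rfl
  have hb0 : 0 ≤ x % d := Int.emod_nonneg _ (by omega)
  have hbH : (((x % d).toNat : ℤ), (a : ℤ)) ∈ H := by
    have h1 := H.sub_mem hxH ((hdH (d * (x / d))).2 (dvd_mul_right _ _))
    rw [Int.toNat_of_nonneg hb0, Int.emod_def]
    simpa using h1
  refine ⟨a, (x % d).toNat, d, hapos, ?_, had.symm, ?_⟩
  · have := Int.emod_lt_of_pos x (show (0 : ℤ) < d by omega)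
    omega
  · ext ⟨m, n⟩
    rw [mem_hermiteLattice]
    constructor
    · intro h
      obtain ⟨j, hj⟩ : (a : ℤ) ∣ n := by
        rw [← Int.mem_zmultiples_iff, ← ha']
        exact ⟨_, h, rfl⟩
      have h1 := H.sub_mem h (H.zsmul_mem hbH j)
      have h2 : (m, n) - j • (((x % d).toNat : ℤ), (a : ℤ)) =
          (m - j * ((x % d).toNat : ℤ), 0) := by
        ext
        · simp
        · simp [hj]
          ring
      rw [h2, hdH] at h1
      obtain ⟨i, hi⟩ := h1
      exact ⟨i, j, by linear_combination hi, by rw [hj]; ring⟩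
    · rintro ⟨i, j, h1, h2⟩
      have h3 := H.add_mem (H.zsmul_mem ((hdH d).2 dvd_rfl) i) (H.zsmul_mem hbH j)
      convert h3 using 1
      ext
      · simpa using h1
      · simpa using h2

/-! ### Primitive sublattices and cosets of `Γ₀(N)` -/

/-- The linear form `det (w, ·)` modulo `N`, with `w` the first column of `σ`. -/
def columnForm (N : ℕ) (σ : SL(2, ℤ)) : ℤ × ℤ →+ ZMod N :=
  (Int.castAddHom (ZMod N)).comp
    ((AddMonoidHom.mulLeft (σ 0 0)).comp (AddMonoidHom.snd ℤ ℤ) -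
      (AddMonoidHom.mulLeft (σ 1 0)).comp (AddMonoidHom.fst ℤ ℤ))

lemma columnForm_apply (N : ℕ) (σ : SL(2, ℤ)) (v : ℤ × ℤ) :
    columnForm N σ v = ((σ 0 0 * v.2 - σ 1 0 * v.1 : ℤ) : ZMod N) := rfl

/-- The subgroup of those `v` in `ℤ²` for which `N` divides `det (w, v)`, with `w` the first column
of `σ`. It depends only on the class of `w` in `ℙ¹(ℤ / N)`. -/
def columnLattice (N : ℕ) (σ : SL(2, ℤ)) : AddSubgroup (ℤ × ℤ) := (columnForm N σ).ker

lemma mem_columnLattice {N : ℕ} {σ : SL(2, ℤ)} {v : ℤ × ℤ} :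
    v ∈ columnLattice N σ ↔ (N : ℤ) ∣ σ 0 0 * v.2 - σ 1 0 * v.1 := by
  rw [columnLattice, AddMonoidHom.mem_ker, columnForm_apply, ZMod.intCast_zmod_eq_zero_iff_dvd]

lemma index_columnLattice (N : ℕ) (σ : SL(2, ℤ)) : (columnLattice N σ).index = N := by
  have hsurj : Function.Surjective (columnForm N σ) := by
    intro y
    obtain ⟨k, rfl⟩ := ZMod.intCast_surjective y
    refine ⟨(k * σ 0 1, k * σ 1 1), ?_⟩
    rw [columnForm_apply]
    congr 1
    linear_combination k * det_eq σ
  rw [columnLattice, AddSubgroup.index_ker, AddMonoidHom.range_eq_top.2 hsurj]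
  simp

lemma inv_mul_apply_one_zero (σ σ' : SL(2, ℤ)) :
    (σ⁻¹ * σ') 1 0 = σ 0 0 * σ' 1 0 - σ 1 0 * σ' 0 0 := by
  rw [Matrix.SpecialLinearGroup.coe_mul, Matrix.SpecialLinearGroup.coe_inv,
    Matrix.adjugate_fin_two, Matrix.mul_apply, Fin.sum_univ_two]
  simp
  ring

/-- The first columns of `σ` and `σ'` have the same class in `ℙ¹(ℤ / N)` if and only if `σ` and `σ'`
lie in the same left coset of `Γ₀(N)`. -/
lemma columnLattice_eq_iff (N : ℕ) (σ σ' : SL(2, ℤ)) :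
    columnLattice N σ = columnLattice N σ' ↔ σ⁻¹ * σ' ∈ CongruenceSubgroup.Gamma0 N := by
  rw [CongruenceSubgroup.Gamma0_mem, inv_mul_apply_one_zero, ZMod.intCast_zmod_eq_zero_iff_dvd]
  constructor
  · intro h
    have h1 : ((σ' 0 0, σ' 1 0) : ℤ × ℤ) ∈ columnLattice N σ := by
      rw [h, mem_columnLattice]
      simp [mul_comm]
    exact mem_columnLattice.1 h1
  · have key : ∀ σ σ' : SL(2, ℤ), (N : ℤ) ∣ σ 0 0 * σ' 1 0 - σ 1 0 * σ' 0 0 →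
        columnLattice N σ' ≤ columnLattice N σ := by
      intro σ σ' h v hv
      rw [mem_columnLattice] at hv ⊢
      -- Expand `v` in the basis of `ℤ²` formed by the columns of `σ'`.
      have h1 : σ 0 0 * v.2 - σ 1 0 * v.1 =
          (σ' 1 1 * v.1 - σ' 0 1 * v.2) * (σ 0 0 * σ' 1 0 - σ 1 0 * σ' 0 0) +
          (σ 0 0 * σ' 1 1 - σ 1 0 * σ' 0 1) * (σ' 0 0 * v.2 - σ' 1 0 * v.1) := by
        linear_combination (-(σ 0 0 * v.2 - σ 1 0 * v.1)) * det_eq σ'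
      rw [h1]
      exact dvd_add (h.mul_left _) (hv.mul_left _)
    intro h
    refine le_antisymm (key σ' σ ?_) (key σ σ' h)
    rwa [show σ' 0 0 * σ 1 0 - σ' 1 0 * σ 0 0 = -(σ 0 0 * σ' 1 0 - σ 1 0 * σ' 0 0) by ring,
      dvd_neg]

/-- A sublattice with primitive Hermite basis arises from a matrix in `SL₂(ℤ)`: the vector
`(b + k d, a)` of the lattice can be made primitive, and it may serve as the first column. -/
lemma exists_columnLattice_eq {a b d : ℕ} (ha : 0 < a) (hd : 0 < d)
    (hprim : Nat.gcd a (Nat.gcd b d) = 1) :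
    ∃ σ, hermiteLattice a b d = columnLattice (a * d) σ := by
  obtain ⟨k, hk⟩ := exists_isCoprime_add_mul (m := b) (n := a) (M := d) (by omega)
    fun p hp h1 h2 h3 => by
      have h4 : p.natAbs ∣ Nat.gcd a (Nat.gcd b d) := Nat.dvd_gcd (Int.natAbs_dvd_natAbs.2 h2)
        (Nat.dvd_gcd (Int.natAbs_dvd_natAbs.2 h1) (Int.natAbs_dvd_natAbs.2 h3))
      rw [hprim, Nat.dvd_one] at h4
      exact (Int.prime_iff_natAbs_prime.1 hp).ne_one h4
  obtain ⟨σ, h0, h1⟩ := hk.exists_SL2_col 0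
  refine ⟨σ, ?_⟩
  have hle : hermiteLattice a b d ≤ columnLattice (a * d) σ := by
    intro v hv
    obtain ⟨i, j, h2, h3⟩ := mem_hermiteLattice.1 hv
    rw [mem_columnLattice, h0, h1, h2, h3]
    push_cast
    exact ⟨j * k - i, by ring⟩
  have h2 := AddSubgroup.relIndex_mul_index hle
  rw [index_columnLattice, index_hermiteLattice ha] at h2
  refine le_antisymm hle (AddSubgroup.relIndex_eq_one.1 ?_)
  exact Nat.eq_of_mul_eq_mul_right (Nat.mul_pos ha hd) (by rw [h2, one_mul])

/-- The lattice contains the first column of `σ`, which is a primitive vector. -/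
lemma gcd_eq_one_of_columnLattice {a b d N : ℕ} {σ : SL(2, ℤ)}
    (h : hermiteLattice a b d = columnLattice N σ) : Nat.gcd a (Nat.gcd b d) = 1 := by
  have h1 : ((σ 0 0, σ 1 0) : ℤ × ℤ) ∈ hermiteLattice a b d := by
    rw [h, mem_columnLattice]
    simp [mul_comm]
  obtain ⟨i, j, h2, h3⟩ := mem_hermiteLattice.1 h1
  have h4 : ((Nat.gcd a (Nat.gcd b d) : ℕ) : ℤ) ∣ 1 := by
    have ha : ((Nat.gcd a (Nat.gcd b d) : ℕ) : ℤ) ∣ a :=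
      Int.natCast_dvd_natCast.2 (Nat.gcd_dvd_left _ _)
    have hb : ((Nat.gcd a (Nat.gcd b d) : ℕ) : ℤ) ∣ b :=
      Int.natCast_dvd_natCast.2 ((Nat.gcd_dvd_right _ _).trans (Nat.gcd_dvd_left _ _))
    have hd : ((Nat.gcd a (Nat.gcd b d) : ℕ) : ℤ) ∣ d :=
      Int.natCast_dvd_natCast.2 ((Nat.gcd_dvd_right _ _).trans (Nat.gcd_dvd_right _ _))
    rw [← det_eq σ, show σ 0 0 = i * d + j * b from h2, show σ 1 0 = j * a from h3]
    exact dvd_sub (((hd.mul_left i).add (hb.mul_left j)).mul_right _) ((ha.mul_left j).mul_left _)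
  exact_mod_cast Int.natCast_dvd_natCast.1 h4 |> Nat.dvd_one.1

/-- The Hermite triples `(a, b, d)` of determinant `N`, i.e. those with `a * d = N` and `0 ≤ b < d`,
encoded as pairs `⟨d, b⟩`. -/
def hermiteIndex (N : ℕ) : Finset (Σ _ : ℕ, ℕ) := N.divisors.sigma fun d => Finset.range d

/-- The Hermite triples `(a, b, d)` of determinant `N` with `gcd(a, b, d) = 1`. -/
def primitiveIndex (N : ℕ) : Finset (Σ _ : ℕ, ℕ) :=
  (hermiteIndex N).filter fun x => Nat.gcd (N / x.1) (Nat.gcd x.2 x.1) = 1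

lemma mem_hermiteIndex {N : ℕ} (hN : 0 < N) {x : Σ _ : ℕ, ℕ} :
    x ∈ hermiteIndex N ↔ 0 < N / x.1 ∧ x.2 < x.1 ∧ N / x.1 * x.1 = N := by
  rw [hermiteIndex, Finset.mem_sigma, Nat.mem_divisors, Finset.mem_range]
  constructor
  · rintro ⟨⟨h1, -⟩, h2⟩
    exact ⟨Nat.div_pos (Nat.le_of_dvd hN h1) (by omega), h2, Nat.div_mul_cancel h1⟩
  · rintro ⟨-, h2, h3⟩
    exact ⟨⟨⟨N / x.1, by rw [mul_comm, h3]⟩, hN.ne'⟩, h2⟩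

lemma hermiteLattice_injOn {N : ℕ} (hN : 0 < N) :
    Set.InjOn (fun x : Σ _ : ℕ, ℕ => hermiteLattice (N / x.1) x.2 x.1) (hermiteIndex N) := by
  rintro ⟨d, b⟩ hx ⟨d', b'⟩ hy h
  rw [Finset.mem_coe, mem_hermiteIndex hN] at hx hy
  obtain ⟨-, h1, h2⟩ := hermiteLattice_injective hx.1 hy.1 hx.2.1 hy.2.1 h
  simp_all

/-- The primitive Hermite triples of determinant `N` correspond to the cosets of `Γ₀(N)`. -/
lemma card_primitiveIndex {N : ℕ} (hN : 0 < N) :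
    (primitiveIndex N).card = (CongruenceSubgroup.Gamma0 N).index := by
  let f : SL(2, ℤ) ⧸ CongruenceSubgroup.Gamma0 N → AddSubgroup (ℤ × ℤ) :=
    Quotient.lift (columnLattice N) fun σ σ' h =>
      (columnLattice_eq_iff N σ σ').2 (QuotientGroup.leftRel_apply.1 h)
  have hf : Function.Injective f := by
    intro p q
    refine Quotient.inductionOn₂ p q fun σ σ' h => ?_
    exact Quotient.sound (QuotientGroup.leftRel_apply.2 ((columnLattice_eq_iff N σ σ').1 h))
  have hr : Set.range f = (fun x : Σ _ : ℕ, ℕ => hermiteLattice (N / x.1) x.2 x.1) ''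
      (primitiveIndex N) := by
    ext H
    constructor
    · rintro ⟨q, rfl⟩
      refine Quotient.inductionOn q fun σ => ?_
      obtain ⟨a, b, d, ha, hb, had, h⟩ := exists_hermiteLattice hN (index_columnLattice N σ)
      have hNd : N / d = a := by
        rw [← had, Nat.mul_div_cancel _ (by omega)]
      refine ⟨⟨d, b⟩, ?_, ?_⟩
      · rw [Finset.mem_coe, primitiveIndex, Finset.mem_filter, mem_hermiteIndex hN, hNd]
        exact ⟨⟨ha, hb, had⟩, gcd_eq_one_of_columnLattice h.symm⟩
      · simp only [hNd]
        exact h.symm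
    · rintro ⟨x, hx, rfl⟩
      rw [Finset.mem_coe, primitiveIndex, Finset.mem_filter, mem_hermiteIndex hN] at hx
      obtain ⟨⟨h1, h2, h3⟩, h4⟩ := hx
      obtain ⟨σ, hσ⟩ := exists_columnLattice_eq h1 (by omega) h4
      rw [h3] at hσ
      exact ⟨Quotient.mk _ σ, hσ.symm⟩
  have hsub : primitiveIndex N ⊆ hermiteIndex N := Finset.filter_subset _ _
  have h1 := ((hermiteLattice_injOn hN).mono (Finset.coe_subset.2 hsub)).ncard_image
  rw [Set.ncard_coe_finset] at h1
  rw [← h1, ← hr, ← Nat.card_coe_set_eq, Nat.card_range_of_injective hf]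
  rfl

/-! ### Isogenies and their kernels -/

namespace ComplexEllipticCurve

variable {E E₁ E₂ : ComplexEllipticCurve}

lemma mk_eq_zero_iff {z : ℂ} : (QuotientAddGroup.mk z : E.Point) = 0 ↔ z ∈ E.lattice :=
  QuotientAddGroup.eq_zero_iff z

lemma countable_lattice (E : ComplexEllipticCurve) : (E.lattice : Set ℂ).Countable := by
  obtain ⟨ω₁, ω₂, -, h⟩ := E.exists_periods
  refine (Set.countable_range fun p : ℤ × ℤ => p.1 • ω₁ + p.2 • ω₂).mono fun x hx => ?_
  rw [h, SetLike.mem_coe, AddSubgroup.mem_closure_pair] at hx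
  obtain ⟨m, n, rfl⟩ := hx
  exact ⟨(m, n), rfl⟩

lemma eq_zero_of_forall_mul_mem {c : ℂ} (h : ∀ z, c * z ∈ E.lattice) : c = 0 := by
  by_contra hc
  refine not_countable_complex ((E.countable_lattice).mono fun z _ => ?_)
  have := h (c⁻¹ * z)
  rwa [mul_inv_cancel_left₀ hc] at this

/-- The multiplier of an isogeny is determined by the isogeny. -/
lemma multiplier_unique {α β : ℂ}
    (h : ∀ z : ℂ, (QuotientAddGroup.mk (α * z) : E.Point) = QuotientAddGroup.mk (β * z)) :
    α = β := by
  refine sub_eq_zero.1 (eq_zero_of_forall_mul_mem (E := E) fun z => ?_)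
  rw [← mk_eq_zero_iff, sub_mul, QuotientAddGroup.mk_sub, h, sub_self]

lemma Isogeny.multiplier_ne_zero (f : Isogeny E₁ E₂) {α : ℂ}
    (hα : ∀ z : ℂ, f.hom (QuotientAddGroup.mk z) = QuotientAddGroup.mk (α * z)) : α ≠ 0 := by
  rintro rfl
  refine one_ne_zero (eq_zero_of_forall_mul_mem (E := E₂) (c := 1) fun z => ?_)
  obtain ⟨x, hx⟩ := f.surjective (QuotientAddGroup.mk (1 * z))
  obtain ⟨w, rfl⟩ := QuotientAddGroup.mk_surjective x
  rw [← mk_eq_zero_iff, ← hx, hα, zero_mul, QuotientAddGroup.mk_zero]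

/-- The homomorphism `ℂ / Λ₁ → ℂ / Λ₂` induced by multiplication by `α`. -/
noncomputable def mulHom {α : ℂ} (h : ∀ w ∈ E₁.lattice, α * w ∈ E₂.lattice) :
    E₁.Point →+ E₂.Point :=
  QuotientAddGroup.map _ _ (AddMonoidHom.mulLeft α) fun w hw => h w hw

lemma mulHom_mk {α : ℂ} (h : ∀ w ∈ E₁.lattice, α * w ∈ E₂.lattice) (z : ℂ) :
    mulHom h (QuotientAddGroup.mk z) = QuotientAddGroup.mk (α * z) := rfl

/-- The isogeny induced by multiplication by `α`. -/
noncomputable def mulIsogeny {α : ℂ} (hα : α ≠ 0) (h : ∀ w ∈ E₁.lattice, α * w ∈ E₂.lattice)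
    (hfin : Finite (mulHom h).ker) : Isogeny E₁ E₂ where
  hom := mulHom h
  surjective := by
    intro y
    obtain ⟨z, rfl⟩ := QuotientAddGroup.mk_surjective y
    exact ⟨QuotientAddGroup.mk (α⁻¹ * z), by rw [mulHom_mk, mul_inv_cancel_left₀ hα]⟩
  finite_ker := hfin
  holomorphic := ⟨fun z => α * z, by fun_prop, fun _ => rfl⟩

lemma mulHom_injective {α : ℂ} (h : ∀ w ∈ E₁.lattice, α * w ∈ E₂.lattice)
    (h' : ∀ z, α * z ∈ E₂.lattice → z ∈ E₁.lattice) : Function.Injective (mulHom h) := by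
  refine (injective_iff_map_eq_zero _).2 fun x hx => ?_
  obtain ⟨z, rfl⟩ := QuotientAddGroup.mk_surjective x
  rw [mulHom_mk, mk_eq_zero_iff] at hx
  exact mk_eq_zero_iff.2 (h' z hx)

lemma finite_ker_mulHom {α : ℂ} (h : ∀ w ∈ E₁.lattice, α * w ∈ E₂.lattice)
    (h' : ∀ z, α * z ∈ E₂.lattice → z ∈ E₁.lattice) : Finite (mulHom h).ker := by
  rw [(AddMonoidHom.ker_eq_bot_iff _).2 (mulHom_injective h h')]
  infer_instance

/-- The parametrization of the lattice `Λ_τ` by the coordinates with respect to `1, τ`. -/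
noncomputable def periodHom (τ : ℍ) : ℤ × ℤ →+ ℂ where
  toFun v := v.1 + v.2 * τ
  map_zero' := by simp
  map_add' v w := by
    simp only [Prod.fst_add, Prod.snd_add, Int.cast_add]
    ring

lemma periodHom_apply (τ : ℍ) (v : ℤ × ℤ) : periodHom τ v = v.1 + v.2 * τ := rfl

lemma mem_lattice_ofUpperHalfPlane {τ : ℍ} {z : ℂ} :
    z ∈ (ofUpperHalfPlane τ).lattice ↔ ∃ v, periodHom τ v = z := by
  change z ∈ AddSubgroup.closure {1, (τ : ℂ)} ↔ _
  rw [AddSubgroup.mem_closure_pair]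
  constructor
  · rintro ⟨m, n, rfl⟩
    exact ⟨(m, n), by simp [periodHom_apply]⟩
  · rintro ⟨v, rfl⟩
    exact ⟨v.1, v.2, by simp [periodHom_apply]⟩

lemma periodHom_injective (τ : ℍ) : Function.Injective (periodHom τ) := by
  refine (injective_iff_map_eq_zero _).2 fun v hv => ?_
  have h2 : v.2 = 0 := by
    have := congrArg Complex.im hv
    simpa [periodHom_apply, τ.im_pos.ne'] using this
  have h1 : v.1 = 0 := by
    rw [periodHom_apply, h2] at hv
    simpa using hv
  exact Prod.ext h1 h2

/-- For a homomorphism `ℂ / Λ → E_τ` given by multiplication by `α`, the homomorphism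
`v ↦ v / α`, whose image is the kernel. -/
noncomputable def kernelParam (E : ComplexEllipticCurve) (τ : ℍ) (α : ℂ) : ℤ × ℤ →+ E.Point :=
  (QuotientAddGroup.mk' E.lattice).comp ((AddMonoidHom.mulLeft α⁻¹).comp (periodHom τ))

lemma kernelParam_apply (τ : ℍ) (α : ℂ) (v : ℤ × ℤ) :
    kernelParam E τ α v = QuotientAddGroup.mk (α⁻¹ * periodHom τ v) := rfl

lemma mem_ker_kernelParam {τ : ℍ} {α : ℂ} {v : ℤ × ℤ} :
    v ∈ (kernelParam E τ α).ker ↔ α⁻¹ * periodHom τ v ∈ E.lattice := by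
  rw [AddMonoidHom.mem_ker, kernelParam_apply, mk_eq_zero_iff]

lemma range_kernelParam {τ : ℍ} {α : ℂ} (hα : α ≠ 0) {f : E.Point →+ (ofUpperHalfPlane τ).Point}
    (hf : ∀ z : ℂ, f (QuotientAddGroup.mk z) = QuotientAddGroup.mk (α * z)) :
    (kernelParam E τ α).range = f.ker := by
  ext x
  obtain ⟨z, rfl⟩ := QuotientAddGroup.mk_surjective x
  rw [AddMonoidHom.mem_ker, hf, mk_eq_zero_iff, mem_lattice_ofUpperHalfPlane]
  constructor
  · rintro ⟨v, hv⟩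
    have h1 := congrArg f hv
    rw [kernelParam_apply, hf, hf, mul_inv_cancel_left₀ hα] at h1
    rw [← mem_lattice_ofUpperHalfPlane, ← mk_eq_zero_iff, ← h1, mk_eq_zero_iff,
      mem_lattice_ofUpperHalfPlane]
    exact ⟨v, rfl⟩
  · rintro ⟨v, hv⟩
    exact ⟨v, by rw [kernelParam_apply, hv, inv_mul_cancel_left₀ hα]⟩

lemma card_ker_eq_index {τ : ℍ} {α : ℂ} (hα : α ≠ 0) {f : E.Point →+ (ofUpperHalfPlane τ).Point}
    (hf : ∀ z : ℂ, f (QuotientAddGroup.mk z) = QuotientAddGroup.mk (α * z)) :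
    Nat.card f.ker = (kernelParam E τ α).ker.index := by
  rw [AddSubgroup.index_ker, range_kernelParam hα hf]

/-- The kernel is cyclic if and only if the Hermite triple is primitive. If a prime `p` divides `a`,
`b` and `d`, then the kernel, of order `a d`, is killed by `a d / p`. If the triple is primitive,
then the kernel embeds into `ℤ / a d`, by the linear form of which the lattice is the kernel. -/
lemma isAddCyclic_ker_iff {τ : ℍ} {α : ℂ} (hα : α ≠ 0)
    {f : E.Point →+ (ofUpperHalfPlane τ).Point}
    (hf : ∀ z : ℂ, f (QuotientAddGroup.mk z) = QuotientAddGroup.mk (α * z))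
    {a b d : ℕ} (ha : 0 < a) (hd : 0 < d)
    (hH : (kernelParam E τ α).ker = hermiteLattice a b d) :
    IsAddCyclic f.ker ↔ Nat.gcd a (Nat.gcd b d) = 1 := by
  have hcard := card_ker_eq_index hα hf
  rw [hH, index_hermiteLattice ha] at hcard
  constructor
  · intro hc
    by_contra hg
    obtain ⟨p, hp, hpg⟩ := Nat.exists_prime_and_dvd hg
    obtain ⟨a', rfl⟩ := hpg.trans (Nat.gcd_dvd_left _ _)
    obtain ⟨b', rfl⟩ := (hpg.trans (Nat.gcd_dvd_right _ _)).trans (Nat.gcd_dvd_left _ _)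
    obtain ⟨d', rfl⟩ := (hpg.trans (Nat.gcd_dvd_right _ _)).trans (Nat.gcd_dvd_right _ _)
    obtain ⟨x, hx⟩ := IsAddCyclic.exists_generator (α := f.ker)
    have h1 : addOrderOf x = Nat.card f.ker := addOrderOf_eq_card_of_forall_mem_zmultiples hx
    have h2 : (p * a' * d') • x = 0 := by
      obtain ⟨v, hv⟩ : (x : E.Point) ∈ (kernelParam E τ α).range := by
        rw [range_kernelParam hα hf]; exact x.2
      refine Subtype.ext ?_
      rw [AddSubgroup.coe_nsmul, ← hv, ← map_nsmul]
      change _ ∈ (kernelParam E τ α).ker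
      rw [hH, mem_hermiteLattice]
      refine ⟨a' * v.1 - b' * v.2, d' * v.2, ?_, ?_⟩
      · simp; ring
      · simp; ring
    have h3 := addOrderOf_dvd_of_nsmul_eq_zero h2
    rw [h1, hcard] at h3
    have h4 : 0 < p * a' * d' := by
      have : 0 < d' := Nat.pos_of_mul_pos_left hd
      positivity
    have h5 := Nat.le_of_dvd h4 h3
    have h6 := hp.two_le
    nlinarith
  · intro hg
    obtain ⟨σ, hσ⟩ := exists_columnLattice_eq ha hd hg
    have h1 : (kernelParam E τ α).ker = (columnForm (a * d) σ).ker := hH.trans hσ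
    rw [← range_kernelParam hα hf]
    have e1 := QuotientAddGroup.quotientKerEquivRange (kernelParam E τ α)
    have e2 := QuotientAddGroup.quotientAddEquivOfEq h1
    refine isAddCyclic_of_injective ((QuotientAddGroup.kerLift (columnForm (a * d) σ)).comp
      (e1.symm.trans e2).toAddMonoidHom) ?_
    exact (QuotientAddGroup.kerLift_injective _).comp (e1.symm.trans e2).injective

end ComplexEllipticCurve

/-! ### Level structures and points of the upper half plane -/

/-- A subgroup of order prime to the order of the kernel of `f` is determined by its image
under `f`, among the subgroups of the same order. -/
lemma AddSubgroup.eq_of_map_eq_of_coprime {A B : Type*} [AddCommGroup A] [AddCommGroup B]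
    (f : A →+ B) {M : ℕ} {C D : AddSubgroup A} (hC : Nat.card C = M) (hD : Nat.card D = M)
    (hcop : Nat.Coprime M (Nat.card f.ker)) (h : C.map f = D.map f) : C = D := by
  have key : ∀ C D : AddSubgroup A, Nat.card C = M → Nat.card D = M → C.map f = D.map f →
      C ≤ D := by
    intro C D hC hD h x hx
    obtain ⟨y, hy, hxy⟩ : f x ∈ D.map f := h ▸ AddSubgroup.mem_map_of_mem f hx
    have h1 : x - y ∈ f.ker := by rw [AddMonoidHom.mem_ker, map_sub, hxy, sub_self]
    have hx' : M • x = 0 := by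
      have := card_nsmul_eq_zero' (x := (⟨x, hx⟩ : C))
      rw [hC] at this
      exact congrArg Subtype.val this
    have hy' : M • y = 0 := by
      have := card_nsmul_eq_zero' (x := (⟨y, hy⟩ : D))
      rw [hD] at this
      exact congrArg Subtype.val this
    have h2 : Nat.card f.ker • (x - y) = 0 :=
      congrArg Subtype.val (card_nsmul_eq_zero' (x := (⟨x - y, h1⟩ : f.ker)))
    have h3 : M • (x - y) = 0 := by rw [nsmul_sub, hx', hy', sub_self]
    have h4 : addOrderOf (x - y) ∣ 1 := by
      rw [← hcop.gcd_eq_one]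
      exact Nat.dvd_gcd (addOrderOf_dvd_of_nsmul_eq_zero h3) (addOrderOf_dvd_of_nsmul_eq_zero h2)
    rw [Nat.dvd_one, AddMonoid.addOrderOf_eq_one_iff, sub_eq_zero] at h4
    exact h4 ▸ hy
  exact le_antisymm (key C D hC hD h) (key D C hD hC h.symm)

/-- A generator of a cyclic group may be multiplied by an integer prime to its order. -/
lemma AddSubgroup.zmultiples_zsmul_of_isCoprime {A : Type*} [AddGroup A] {g : A} {M : ℕ} {k : ℤ}
    (hg : M • g = 0) (hcop : IsCoprime (M : ℤ) k) :
    AddSubgroup.zmultiples (k • g) = AddSubgroup.zmultiples g := by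
  refine le_antisymm ?_ ?_
  · rw [AddSubgroup.zmultiples_le]
    exact ⟨k, rfl⟩
  · rw [AddSubgroup.zmultiples_le, AddSubgroup.mem_zmultiples_iff]
    obtain ⟨u, v, h⟩ := hcop
    refine ⟨v, ?_⟩
    have h2 : (1 : ℤ) • g = v • (k • g) := by
      rw [← h, add_zsmul, mul_comm u, mul_comm v, mul_zsmul', mul_zsmul', natCast_zsmul, hg,
        zsmul_zero, zero_add]
    rw [← h2, one_zsmul]

namespace Gamma0Curve

variable {M N : ℕ} {X : Gamma0Curve M} {τ : ℍ}

/-- The standard level structure `⟨1 / M⟩` on `E_τ`. -/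
noncomputable def standard (M : ℕ) (hM : 0 < M) (τ : ℍ) : Gamma0Curve M where
  curve := ofUpperHalfPlane τ
  C := AddSubgroup.zmultiples (QuotientAddGroup.mk (1 / (M : ℂ)))
  isAddCyclic := inferInstance
  card_eq := by
    rw [Nat.card_zmultiples]
    refine Nat.dvd_antisymm ?_ ?_
    · rw [addOrderOf_dvd_iff_nsmul_eq_zero, ← QuotientAddGroup.mk_nsmul, mk_eq_zero_iff,
        mem_lattice_ofUpperHalfPlane]
      refine ⟨(1, 0), ?_⟩
      have : (M : ℂ) ≠ 0 := by exact_mod_cast hM.ne'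
      simp [periodHom_apply, this]
    · have h := addOrderOf_nsmul_eq_zero
        (QuotientAddGroup.mk (1 / (M : ℂ)) : (ofUpperHalfPlane τ).Point)
      generalize
        addOrderOf (QuotientAddGroup.mk (1 / (M : ℂ)) : (ofUpperHalfPlane τ).Point) = n at h
      rw [← QuotientAddGroup.mk_nsmul, mk_eq_zero_iff, mem_lattice_ofUpperHalfPlane] at h
      obtain ⟨v, hv⟩ := h
      have hM' : (M : ℂ) ≠ 0 := by exact_mod_cast hM.ne'
      have h1 : periodHom τ (v.1 * M - n, v.2 * M) = 0 := by
        rw [periodHom_apply] at hv ⊢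
        rw [nsmul_eq_mul] at hv
        field_simp at hv
        push_cast
        linear_combination hv
      have h2 := periodHom_injective τ (h1.trans (map_zero _).symm)
      have h3 : v.1 * M - n = 0 := congrArg Prod.fst h2
      exact Int.natCast_dvd_natCast.1 ⟨v.1, by linear_combination -h3⟩

lemma standard_isRepresentedBy (hM : 0 < M) (τ : ℍ) : (standard M hM τ).IsRepresentedBy τ :=
  ⟨Isogeny.refl _, fun _ _ h => h, AddSubgroup.map_id _⟩

/-- Two points of `ℍ` representing the same pair `(E, C)` are equivalent under `Γ₀(M)`. -/
lemma exists_smul_eq_of_isRepresentedBy (hM : 0 < M) {τ' : ℍ} (h : X.IsRepresentedBy τ)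
    (h' : X.IsRepresentedBy τ') : ∃ γ : SL(2, ℤ), (M : ℤ) ∣ γ 1 0 ∧ τ = γ • τ' := by
  obtain ⟨g, hg, hgC⟩ := h
  obtain ⟨g', hg', hgC'⟩ := h'
  set f := g'.comp (g.inverse hg) with hf
  have hfinj : Function.Injective f.hom := hg'.comp (g.inverse_injective hg)
  have hfC : (AddSubgroup.zmultiples (QuotientAddGroup.mk (1 / (M : ℂ)))).map f.hom =
      AddSubgroup.zmultiples (QuotientAddGroup.mk (1 / (M : ℂ))) := by
    rw [← hgC, ← hgC', AddSubgroup.map_map]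
    congr 1
    ext x
    simp [hf, Isogeny.comp]
  obtain ⟨α, hα⟩ := f.exists_mul
  have hα0 := f.multiplier_ne_zero hα
  have hmem : ∀ w, w ∈ (ofUpperHalfPlane τ).lattice ↔ α * w ∈ (ofUpperHalfPlane τ').lattice := by
    intro w
    rw [← mk_eq_zero_iff, ← mk_eq_zero_iff, ← hα, map_eq_zero_iff _ hfinj]
  obtain ⟨⟨δ, c⟩, h1⟩ := mem_lattice_ofUpperHalfPlane.1
    ((hmem 1).1 (mem_lattice_ofUpperHalfPlane.2 ⟨(1, 0), by simp [periodHom_apply]⟩))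
  obtain ⟨⟨b, a⟩, h2⟩ := mem_lattice_ofUpperHalfPlane.1
    ((hmem τ).1 (mem_lattice_ofUpperHalfPlane.2 ⟨(0, 1), by simp [periodHom_apply]⟩))
  have hdiv : ∀ z, z ∈ (ofUpperHalfPlane τ').lattice → ∃ v, α * periodHom τ v = z := by
    intro z hz
    obtain ⟨v, hv⟩ := mem_lattice_ofUpperHalfPlane.1 ((hmem (α⁻¹ * z)).2
      (by rwa [mul_inv_cancel_left₀ hα0]))
    exact ⟨v, by rw [hv, mul_inv_cancel_left₀ hα0]⟩
  obtain ⟨⟨s, r⟩, h3⟩ := hdiv 1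
    (mem_lattice_ofUpperHalfPlane.2 ⟨(1, 0), by simp [periodHom_apply]⟩)
  obtain ⟨⟨q, p⟩, h4⟩ := hdiv τ'
    (mem_lattice_ofUpperHalfPlane.2 ⟨(0, 1), by simp [periodHom_apply]⟩)
  simp only [periodHom_apply, mul_one] at h1 h2 h3 h4
  have h5 : periodHom τ' (s * δ + r * b, s * c + r * a) = periodHom τ' (1, 0) := by
    simp only [periodHom_apply]
    push_cast
    linear_combination h3 + s * h1 + r * h2
  have h6 : periodHom τ' (q * δ + p * b, q * c + p * a) = periodHom τ' (0, 1) := by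
    simp only [periodHom_apply]
    push_cast
    linear_combination h4 + q * h1 + p * h2
  obtain ⟨h51, h52⟩ := Prod.ext_iff.1 (periodHom_injective τ' h5)
  obtain ⟨h61, h62⟩ := Prod.ext_iff.1 (periodHom_injective τ' h6)
  simp only at h51 h52 h61 h62
  -- The two changes of basis are inverse to each other.
  have hdetu : (s * p - r * q) * (a * δ - b * c) = 1 := by
    linear_combination (q * c + p * a) * h51 - (q * δ + p * b) * h52 + h62
  have hdenom : ((c : ℂ) * τ' + δ) = α := by linear_combination h1
  have hτ : (τ : ℂ) = (a * τ' + b) / (c * τ' + δ) := by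
    rw [hdenom, eq_div_iff hα0]
    linear_combination -h2
  have him : τ.im = (a * δ - b * c : ℤ) * τ'.im / Complex.normSq α := by
    rw [eq_div_iff (Complex.normSq_pos.2 hα0).ne', ← h1, Complex.normSq_apply]
    rw [← h1] at h2
    have hre := congrArg Complex.re h2
    have him := congrArg Complex.im h2
    simp at hre him ⊢
    linear_combination (c * τ'.im) * hre - (c * τ'.re + δ) * him
  -- The determinant is `1` and not `-1` since `τ` and `τ'` both lie in the upper half plane.
  have hdet : a * δ - b * c = 1 := by
    rcases Int.eq_one_or_neg_one_of_mul_eq_one' hdetu with h | h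
    · exact h.2
    · exfalso
      rw [h.2] at him
      have h7 := τ.im_pos
      have h8 := τ'.im_pos
      have h9 := Complex.normSq_pos.2 hα0
      have h10 : (((-1 : ℤ) : ℝ) * τ'.im / Complex.normSq α) ≤ 0 :=
        div_nonpos_of_nonpos_of_nonneg (by push_cast; linarith) h9.le
      linarith
  obtain ⟨γ, hγa, hγb, hγc, hγd⟩ : ∃ γ : SL(2, ℤ), γ 0 0 = a ∧ γ 0 1 = b ∧ γ 1 0 = c ∧ γ 1 1 = δ :=
    ⟨⟨!![a, b; c, δ], by rw [Matrix.det_fin_two_of, hdet]⟩, rfl, rfl, rfl, rfl⟩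
  refine ⟨γ, ?_, ?_⟩
  · rw [hγc]
    have hM' : (M : ℂ) ≠ 0 := by exact_mod_cast hM.ne'
    have h7 : f.hom (QuotientAddGroup.mk (1 / (M : ℂ))) ∈
        AddSubgroup.zmultiples (QuotientAddGroup.mk (1 / (M : ℂ)) : (ofUpperHalfPlane τ').Point) :=
      hfC ▸ AddSubgroup.mem_map_of_mem _ (AddSubgroup.mem_zmultiples _)
    obtain ⟨k, hk⟩ := AddSubgroup.mem_zmultiples_iff.1 h7
    rw [hα, ← QuotientAddGroup.mk_zsmul, ← sub_eq_zero, ← QuotientAddGroup.mk_sub, mk_eq_zero_iff,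
      mem_lattice_ofUpperHalfPlane] at hk
    obtain ⟨v, hv⟩ := hk
    have h8 : periodHom τ' (k - δ, -c) = periodHom τ' (M * v.1, M * v.2) := by
      simp only [periodHom_apply, zsmul_eq_mul] at hv ⊢
      field_simp at hv
      push_cast
      linear_combination hv.symm - h1
    obtain ⟨-, h82⟩ := Prod.ext_iff.1 (periodHom_injective τ' h8)
    exact (dvd_neg.1 ⟨v.2, h82⟩)
  · refine UpperHalfPlane.ext ?_
    rw [coe_smul_eq, hτ, hγa, hγb, hγc, hγd]

/-- The value `t(E, C)` may be computed at any point of `ℍ` representing `(E, C)`. -/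
lemma t_eq_of_isRepresentedBy (hM : M ∈ genusZeroLevels) (h : X.IsRepresentedBy τ) :
    X.t = etaQuotient (etaExponents M) τ := by
  have h1 : X.IsRepresentedBy (Classical.epsilon X.IsRepresentedBy) :=
    Classical.epsilon_spec (p := X.IsRepresentedBy) ⟨τ, h⟩
  obtain ⟨γ, hγ, h2⟩ := exists_smul_eq_of_isRepresentedBy (pos_of_mem_genusZeroLevels hM) h1 h
  rw [t, etaHauptmodul_eq_etaQuotient hM, h2]
  exact mem_etaStabilizer.1 (Gamma0_le_etaStabilizer hM hγ) τ

end Gamma0Curve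

/-! ### Isogeny classes and Hermite triples -/

/-- The point `(a τ + b) / d` of the upper half plane, where the Hermite triple `(a, b, d)` of
determinant `N` is encoded as `⟨d, b⟩`. -/
noncomputable def heckePoint (N : ℕ) (x : Σ _ : ℕ, ℕ) (z : ℂ) : ℂ :=
  (((N / x.1 : ℕ) : ℂ) * z + ((x.2 : ℤ) : ℂ)) / (x.1 : ℂ)

lemma heckePoint_im_pos {N : ℕ} (hN : 0 < N) {x : Σ _ : ℕ, ℕ} (hx : x ∈ hermiteIndex N) {z : ℂ}
    (hz : 0 < z.im) : 0 < (heckePoint N x z).im := by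
  rw [mem_hermiteIndex hN] at hx
  exact im_affine_pos hx.1 (by omega) _ hz

namespace Gamma0Curve

variable {M N : ℕ} {X : Gamma0Curve M} {τ : ℍ}

/-- The subgroup `H` of `ℤ²` describes the isogeny `A` to `(E, C) ≅ (E_τ, C_τ)`: if the composite of
`A` with the isomorphism `g` is multiplication by `α`, then `H` consists of the coordinates with
respect to the basis `1, τ` of the elements of the sublattice `α Λ` of `Λ_τ`. -/
def IsogenyTo.HasLattice (g : Isogeny X.curve (ofUpperHalfPlane τ)) (A : X.IsogenyTo N)
    (H : AddSubgroup (ℤ × ℤ)) : Prop :=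
  ∃ α : ℂ, α ≠ 0 ∧
    (∀ z : ℂ, g.hom (A.isog.hom (QuotientAddGroup.mk z)) = QuotientAddGroup.mk (α * z)) ∧
    (kernelParam A.source.curve τ α).ker = H

lemma IsogenyTo.ker_comp {g : Isogeny X.curve (ofUpperHalfPlane τ)}
    (hg : Function.Injective g.hom) (A : X.IsogenyTo N) :
    (g.hom.comp A.isog.hom).ker = A.isog.hom.ker := by
  ext x
  rw [AddMonoidHom.mem_ker, AddMonoidHom.mem_ker, AddMonoidHom.comp_apply,
    map_eq_zero_iff _ hg]

lemma IsogenyTo.exists_hasLattice {g : Isogeny X.curve (ofUpperHalfPlane τ)}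
    (hg : Function.Injective g.hom) (A : X.IsogenyTo N) :
    ∃ H, A.HasLattice g H ∧ H.index = N := by
  obtain ⟨α, hα⟩ := (g.comp A.isog).exists_mul
  have hα0 := (g.comp A.isog).multiplier_ne_zero hα
  refine ⟨_, ⟨α, hα0, hα, rfl⟩, ?_⟩
  rw [← card_ker_eq_index hα0 hα]
  change Nat.card (g.hom.comp A.isog.hom).ker = N
  rw [A.ker_comp hg]
  exact A.degree_eq

lemma IsogenyTo.HasLattice.isCyclic_iff {g : Isogeny X.curve (ofUpperHalfPlane τ)}
    (hg : Function.Injective g.hom) {A : X.IsogenyTo N} {a b d : ℕ} (ha : 0 < a) (hd : 0 < d)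
    (h : A.HasLattice g (hermiteLattice a b d)) :
    A.isog.IsCyclic ↔ Nat.gcd a (Nat.gcd b d) = 1 := by
  obtain ⟨α, hα0, hα, hH⟩ := h
  have := isAddCyclic_ker_iff (f := g.hom.comp A.isog.hom) hα0 hα ha hd hH
  rwa [A.ker_comp hg] at this

/-- With the multiplier `α`, the lattice of the source of `A` is `α⁻¹` times the sublattice of `Λ_τ`
described by `H`. -/
lemma IsogenyTo.HasLattice.exists_multiplier {g : Isogeny X.curve (ofUpperHalfPlane τ)}
    {A : X.IsogenyTo N} {H : AddSubgroup (ℤ × ℤ)} (h : A.HasLattice g H) :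
    ∃ α : ℂ, α ≠ 0 ∧
    (∀ z : ℂ, g.hom (A.isog.hom (QuotientAddGroup.mk z)) = QuotientAddGroup.mk (α * z)) ∧
    (∀ w : ℂ, w ∈ A.source.curve.lattice ↔ ∃ v ∈ H, α * w = periodHom τ v) := by
  obtain ⟨α, hα0, hα, rfl⟩ := h
  refine ⟨α, hα0, hα, fun w => ⟨fun hw => ?_, ?_⟩⟩
  · have h1 := hα w
    rw [mk_eq_zero_iff.2 hw, map_zero, map_zero] at h1
    obtain ⟨v, hv⟩ := mem_lattice_ofUpperHalfPlane.1 (mk_eq_zero_iff.1 h1.symm)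
    exact ⟨v, mem_ker_kernelParam.2 (by rwa [hv, inv_mul_cancel_left₀ hα0]), hv.symm⟩
  · rintro ⟨v, hv, hvw⟩
    have := mem_ker_kernelParam.1 hv
    rwa [← hvw, inv_mul_cancel_left₀ hα0] at this

/-- Equivalent isogenies are described by the same subgroup of `ℤ²`. -/
lemma IsogenyTo.HasLattice.eq_of_equivalent {g : Isogeny X.curve (ofUpperHalfPlane τ)}
    {A B : X.IsogenyTo N} {H K : AddSubgroup (ℤ × ℤ)} (hA : A.HasLattice g H)
    (hB : B.HasLattice g K) (hAB : A.Equivalent B) : H = K := by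
  obtain ⟨α, hα0, hα, rfl⟩ := hA
  obtain ⟨β, hβ0, hβ, rfl⟩ := hB
  obtain ⟨h, hh, -⟩ := hAB
  have hinj := IsogenyTo.injective hh
  obtain ⟨γ, hγ⟩ := h.exists_mul
  have hαβ : α = β * γ := multiplier_unique (E := ofUpperHalfPlane τ) fun z => by
    rw [← hα, hh, AddMonoidHom.comp_apply, hγ, hβ, mul_assoc]
  ext v
  rw [mem_ker_kernelParam, mem_ker_kernelParam, ← mk_eq_zero_iff, ← map_eq_zero_iff _ hinj, hγ,
    mk_eq_zero_iff]
  have hγ0 : γ ≠ 0 := fun h0 => hα0 (by rw [hαβ, h0, mul_zero])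
  rw [show γ * (α⁻¹ * periodHom τ v) = β⁻¹ * periodHom τ v by rw [hαβ]; field_simp]

/-- Isogenies described by the same subgroup of `ℤ²` are equivalent; as `gcd(M, N) = 1`, the level
structure on the source is determined by that on the target. -/
lemma IsogenyTo.HasLattice.equivalent (hMN : Nat.Coprime M N)
    {g : Isogeny X.curve (ofUpperHalfPlane τ)} (hg : Function.Injective g.hom)
    {A B : X.IsogenyTo N} {H : AddSubgroup (ℤ × ℤ)} (hA : A.HasLattice g H)
    (hB : B.HasLattice g H) : A.Equivalent B := by
  obtain ⟨α, hα0, hα, hαm⟩ := hA.exists_multiplier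
  obtain ⟨β, hβ0, hβ, hβm⟩ := hB.exists_multiplier
  have hmem : ∀ w, w ∈ A.source.curve.lattice ↔ β⁻¹ * α * w ∈ B.source.curve.lattice := by
    intro w
    rw [hαm, hβm]
    simp only [mul_assoc, mul_inv_cancel_left₀ hβ0]
  have h1 : ∀ w ∈ A.source.curve.lattice, β⁻¹ * α * w ∈ B.source.curve.lattice :=
    fun w => (hmem w).1
  have h2 : ∀ w, β⁻¹ * α * w ∈ B.source.curve.lattice → w ∈ A.source.curve.lattice :=
    fun w => (hmem w).2
  have hinj := mulHom_injective h1 h2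
  let h : Isogeny A.source.curve B.source.curve :=
    mulIsogeny (mul_ne_zero (inv_ne_zero hβ0) hα0) h1 (finite_ker_mulHom h1 h2)
  have hcomp : A.isog.hom = B.isog.hom.comp h.hom := by
    refine AddMonoidHom.ext fun x => hg ?_
    obtain ⟨z, rfl⟩ := QuotientAddGroup.mk_surjective x
    change g.hom (A.isog.hom (QuotientAddGroup.mk z)) =
      g.hom (B.isog.hom (QuotientAddGroup.mk (β⁻¹ * α * z)))
    rw [hα, hβ, mul_assoc, mul_inv_cancel_left₀ hβ0]
  refine ⟨h, hcomp, ?_⟩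
  refine AddSubgroup.eq_of_map_eq_of_coprime B.isog.hom (M := M) ?_ B.source.card_eq ?_ ?_
  · rw [Nat.card_congr (AddSubgroup.equivMapOfInjective A.source.C h.hom hinj).toEquiv.symm]
    exact A.source.card_eq
  · rwa [show Nat.card B.isog.hom.ker = N from B.degree_eq]
  · rw [AddSubgroup.map_map, ← hcomp, A.map_C, B.map_C]

/-- For every Hermite triple `(a, b, d)` there is an isogeny described by it; its source is
`E_{τ'}` with `τ' = (a τ + b) / d`. -/
lemma exists_isogenyTo_hasLattice (hM : 0 < M) (hN : 0 < N) (hMN : Nat.Coprime M N)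
    {g : Isogeny X.curve (ofUpperHalfPlane τ)} (hg : Function.Injective g.hom)
    (hgC : X.C.map g.hom = AddSubgroup.zmultiples (QuotientAddGroup.mk (1 / (M : ℂ))))
    {x : Σ _ : ℕ, ℕ} (hx : x ∈ hermiteIndex N) :
    ∃ A : X.IsogenyTo N, A.HasLattice g (hermiteLattice (N / x.1) x.2 x.1) ∧
      A.source = standard M hM ⟨heckePoint N x τ, heckePoint_im_pos hN hx τ.im_pos⟩ := by
  obtain ⟨d, b⟩ := x
  have hx' := (mem_hermiteIndex hN).1 hx
  obtain ⟨τ', hτ'⟩ : ∃ τ' : ℍ, τ' = ⟨heckePoint N ⟨d, b⟩ τ, heckePoint_im_pos hN hx τ.im_pos⟩ :=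
    ⟨_, rfl⟩
  rw [← hτ']
  obtain ⟨ha, hb, had⟩ := hx'
  simp only at ha hb had ⊢
  have hd : (d : ℂ) ≠ 0 := by exact_mod_cast (show d ≠ 0 by omega)
  have hτd : (d : ℂ) * τ' = (N / d : ℕ) * τ + b := by
    rw [hτ']
    change (d : ℂ) * heckePoint N ⟨d, b⟩ τ = _
    rw [heckePoint]
    simp only
    rw [mul_div_cancel₀ _ hd]
    push_cast
    rfl
  generalize N / d = a at ha had hτd ⊢
  have hper : ∀ v, (d : ℂ) * periodHom τ' v =
      periodHom τ (v.1 * d + v.2 * b, v.2 * (a : ℤ)) := by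
    intro v
    simp only [periodHom_apply]
    push_cast
    rw [mul_add, mul_left_comm, hτd]
    ring
  have h1 : ∀ w ∈ (ofUpperHalfPlane τ').lattice, (d : ℂ) * w ∈ (ofUpperHalfPlane τ).lattice := by
    intro w hw
    obtain ⟨v, rfl⟩ := mem_lattice_ofUpperHalfPlane.1 hw
    exact mem_lattice_ofUpperHalfPlane.2 ⟨_, (hper v).symm⟩
  have hker : (kernelParam (ofUpperHalfPlane τ') τ d).ker = hermiteLattice a b d := by
    ext v
    rw [mem_ker_kernelParam, mem_lattice_ofUpperHalfPlane, mem_hermiteLattice]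
    constructor
    · rintro ⟨w, hw⟩
      have h2 := hper w
      rw [hw, mul_inv_cancel_left₀ hd] at h2
      have h3 := periodHom_injective τ h2
      exact ⟨w.1, w.2, congrArg Prod.fst h3, congrArg Prod.snd h3⟩
    · rintro ⟨i, j, h2, h3⟩
      refine ⟨(i, j), ?_⟩
      rw [eq_inv_mul_iff_mul_eq₀ hd, hper, show v = (i * d + j * b, j * (a : ℤ)) from
        Prod.ext h2 h3]
  have hcard : Nat.card (mulHom h1).ker = N := by
    rw [card_ker_eq_index hd (mulHom_mk h1), hker, index_hermiteLattice ha, had]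
  have hfin : Finite (mulHom h1).ker := Nat.finite_of_card_ne_zero (by omega)
  let m := mulIsogeny hd h1 hfin
  have hgm : ∀ z : ℂ, g.hom ((g.inverse hg).hom (m.hom (QuotientAddGroup.mk z))) =
      QuotientAddGroup.mk (d * z) := by
    intro z
    rw [Isogeny.hom_inverse_apply]
    rfl
  refine ⟨⟨standard M hM τ', (g.inverse hg).comp m, ?_, ?_⟩, ⟨d, hd, hgm, hker⟩, rfl⟩
  · rw [← hcard]
    change Nat.card ((g.inverse hg).hom.comp (mulHom h1)).ker = _
    congr 2
    ext y
    rw [AddMonoidHom.mem_ker, AddMonoidHom.mem_ker, AddMonoidHom.comp_apply,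
      map_eq_zero_iff _ (g.inverse_injective hg)]
  · change (AddSubgroup.zmultiples (QuotientAddGroup.mk (1 / (M : ℂ)))).map
      ((g.inverse hg).hom.comp (mulHom h1)) = X.C
    have h4 : X.C = (X.C.map g.hom).map (g.inverse hg).hom := by
      rw [AddSubgroup.map_map]
      convert (AddSubgroup.map_id _).symm
      ext y
      simp
    rw [h4, hgC, ← AddSubgroup.map_map]
    congr 1
    rw [AddMonoidHom.map_zmultiples, mulHom_mk]
    have hdN : d ∣ N := ⟨a, by rw [mul_comm, had]⟩
    have hMg : M • (QuotientAddGroup.mk (1 / (M : ℂ)) : (ofUpperHalfPlane τ).Point) = 0 := by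
      have hM' : (M : ℂ) ≠ 0 := by exact_mod_cast hM.ne'
      rw [← QuotientAddGroup.mk_nsmul, mk_eq_zero_iff, mem_lattice_ofUpperHalfPlane]
      exact ⟨(1, 0), by simp [periodHom_apply, hM']⟩
    rw [← AddSubgroup.zmultiples_zsmul_of_isCoprime hMg
      (Nat.isCoprime_iff_coprime.2 (hMN.coprime_dvd_right hdN)), ← QuotientAddGroup.mk_zsmul,
      zsmul_eq_mul, Int.cast_natCast]

/-- The classes in `I_N(E, C)` correspond to the Hermite triples of determinant `N`, those in
`P_N(E, C)` to the primitive ones. -/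
lemma exists_bijective_isogenyClasses (hM : M ∈ genusZeroLevels) (hN : 0 < N)
    (hMN : Nat.Coprime M N) (hX : X.IsRepresentedBy τ) :
    ∃ Θ : {x // x ∈ hermiteIndex N} → X.IsogenyClasses N, Function.Bijective Θ ∧
      (∀ x, (Θ x).t = etaQuotient (etaExponents M) (heckePoint N x τ)) ∧
      ∀ x, Θ x ∈ X.cyclicIsogenyClasses N ↔ (x : Σ _ : ℕ, ℕ) ∈ primitiveIndex N := by
  have hM0 := pos_of_mem_genusZeroLevels hM
  obtain ⟨g, hg, hgC⟩ := hX
  choose A hA hAs using fun x : {x // x ∈ hermiteIndex N} =>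
    exists_isogenyTo_hasLattice hM0 hN hMN hg hgC x.2
  refine ⟨fun x => Quotient.mk _ (A x), ⟨fun x y hxy => ?_, fun c => ?_⟩, fun x => ?_, fun x => ?_⟩
  · have h1 : (A x).Equivalent (A y) := Quotient.exact hxy
    exact Subtype.ext (hermiteLattice_injOn hN x.2 y.2 ((hA x).eq_of_equivalent (hA y) h1))
  · obtain ⟨B, rfl⟩ := Quotient.exists_rep c
    obtain ⟨H, hH, hHN⟩ := B.exists_hasLattice hg
    obtain ⟨a, b, d, ha, hb, had, rfl⟩ := exists_hermiteLattice hN hHN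
    have hNd : N / d = a := by rw [← had, Nat.mul_div_cancel _ (by omega)]
    refine ⟨⟨⟨d, b⟩, (mem_hermiteIndex hN).2 (by simp only [hNd]; exact ⟨ha, hb, had⟩)⟩, ?_⟩
    refine Quotient.sound ((hA _).equivalent hMN hg ?_)
    simp only [hNd]
    exact hH
  · change (A x).source.t = _
    rw [hAs x, t_eq_of_isRepresentedBy hM (standard_isRepresentedBy hM0 _)]
  · have hx := (mem_hermiteIndex hN).1 x.2
    rw [primitiveIndex, Finset.mem_filter, and_iff_right x.2,
      ← (hA x).isCyclic_iff hg hx.1 (by omega)]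
    constructor
    · rintro ⟨B, hB, hBA⟩
      have h1 : B.Equivalent (A x) := Quotient.exact hBA
      obtain ⟨H, hH, -⟩ := B.exists_hasLattice hg
      rw [hH.eq_of_equivalent (hA x) h1] at hH
      rw [hH.isCyclic_iff hg hx.1 (by omega)] at hB
      rwa [(hA x).isCyclic_iff hg hx.1 (by omega)]
    · intro h
      exact ⟨A x, h, rfl⟩

variable {X' : Gamma0Curve M}

/-- Every pair `(E, C)` is represented by a point of the upper half plane: a generator of `C` can be
lifted to `ω / M` with `ω` a primitive vector of the lattice. -/
lemma exists_isRepresentedBy (hM : 0 < M) (X : Gamma0Curve M) : ∃ τ, X.IsRepresentedBy τ := by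
  obtain ⟨ω₁, ω₂, hli, hΛ⟩ := X.curve.exists_periods
  have hmem : ∀ w, w ∈ X.curve.lattice ↔ ∃ p q : ℤ, p * ω₁ + q * ω₂ = w := by
    intro w
    rw [hΛ, AddSubgroup.mem_closure_pair]
    simp
  have hM' : (M : ℂ) ≠ 0 := by exact_mod_cast hM.ne'
  have := X.isAddCyclic
  obtain ⟨x, hx⟩ := IsAddCyclic.exists_generator (α := X.C)
  have hord : addOrderOf (x : X.curve.Point) = M := by
    rw [AddSubgroup.addOrderOf_coe, addOrderOf_eq_card_of_forall_mem_zmultiples hx, X.card_eq]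
  have hC : X.C = AddSubgroup.zmultiples (x : X.curve.Point) := by
    refine le_antisymm (fun y hy => ?_) (AddSubgroup.zmultiples_le.2 x.2)
    obtain ⟨k, hk⟩ := hx ⟨y, hy⟩
    exact ⟨k, congrArg Subtype.val hk⟩
  obtain ⟨c, hc⟩ := QuotientAddGroup.mk_surjective (x : X.curve.Point)
  rw [← hc] at hord hC
  obtain ⟨m, n, hmn⟩ : ∃ p q : ℤ, p * ω₁ + q * ω₂ = M * c := by
    have h := addOrderOf_nsmul_eq_zero (QuotientAddGroup.mk c : X.curve.Point)
    rw [hord, ← QuotientAddGroup.mk_nsmul, mk_eq_zero_iff, hmem, nsmul_eq_mul] at h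
    exact h
  have hprim : ∀ p : ℤ, Prime p → p ∣ m → p ∣ n → ¬ p ∣ M := by
    rintro p hp ⟨m', rfl⟩ ⟨n', rfl⟩ hpM
    have hp' : p.natAbs.Prime := Int.prime_iff_natAbs_prime.1 hp
    obtain ⟨M', hMM⟩ := Int.natAbs_dvd_natAbs.2 hpM
    rw [Int.natAbs_natCast] at hMM
    obtain ⟨s, hs, hps⟩ : ∃ s : ℤ, s * s = 1 ∧ p = s * (p.natAbs : ℤ) := by
      rcases Int.natAbs_eq p with h | h
      · exact ⟨1, by norm_num, by rw [one_mul]; exact h⟩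
      · exact ⟨-1, by norm_num, by rw [neg_one_mul]; exact h⟩
    generalize p.natAbs = r at hp' hMM hps
    subst hps
    have hr0 : (r : ℂ) ≠ 0 := by exact_mod_cast hp'.ne_zero
    have h1 : M' • (QuotientAddGroup.mk c : X.curve.Point) = 0 := by
      rw [← QuotientAddGroup.mk_nsmul, mk_eq_zero_iff, hmem, nsmul_eq_mul]
      refine ⟨s * m', s * n', mul_left_cancel₀ hr0 ?_⟩
      rw [hMM] at hmn
      push_cast at hmn ⊢
      linear_combination hmn
    have h2 := addOrderOf_dvd_of_nsmul_eq_zero h1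
    rw [hord, hMM] at h2
    have h3 : 0 < M' := Nat.pos_of_ne_zero fun h => by rw [h] at hMM; omega
    have h4 := Nat.le_of_dvd h3 h2
    have h5 := hp'.two_le
    nlinarith
  -- The coordinates `(m, n)` of `M c` may be changed by multiples of `M`, so as to become coprime.
  -- If `n = 0`, the lift `c` is first changed by `ω₂`.
  obtain ⟨ε, hε⟩ : ∃ ε : ℤ, n + ε * M ≠ 0 ∧ (ε ≠ 0 → n = 0) := by
    by_cases h : n = 0
    · exact ⟨1, by rw [h]; omega, fun _ => h⟩
    · exact ⟨0, by simpa using h, fun h0 => absurd rfl h0⟩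
  obtain ⟨k, hk⟩ := exists_isCoprime_add_mul (m := m) (n := n + ε * M) (M := M) hε.1
    fun p hp h1 h2 h3 => hprim p hp h1 ((dvd_add_left (h3.mul_left ε)).1 h2) h3
  obtain ⟨u, v, huv⟩ := hk
  obtain ⟨m', hm'⟩ : ∃ m', m' = m + k * M := ⟨_, rfl⟩
  obtain ⟨n', hn'⟩ : ∃ n', n' = n + ε * M := ⟨_, rfl⟩
  rw [← hm', ← hn'] at huv
  obtain ⟨c', hc'⟩ : ∃ c' : ℂ, c' = c + k * ω₁ + ε * ω₂ := ⟨_, rfl⟩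
  have hmn' : (m' : ℂ) * ω₁ + n' * ω₂ = M * c' := by
    rw [hm', hn', hc']
    push_cast
    linear_combination hmn
  have hC' : X.C = AddSubgroup.zmultiples (QuotientAddGroup.mk c' : X.curve.Point) := by
    rw [hC]
    congr 1
    rw [← sub_eq_zero, ← QuotientAddGroup.mk_sub, mk_eq_zero_iff, hmem]
    exact ⟨-k, -ε, by rw [hc']; push_cast; ring⟩
  have hind : ∀ s t : ℝ, s * ω₁ + t * ω₂ = 0 → s = 0 ∧ t = 0 := by
    intro s t h
    exact LinearIndependent.pair_iff.1 hli s t (by simpa using h)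
  have huv' : (u : ℂ) * m' + v * n' = 1 := by exact_mod_cast congrArg (Int.cast : ℤ → ℂ) huv
  have hω0 : (M : ℂ) * c' ≠ 0 := by
    intro h
    obtain ⟨h1, h2⟩ := hind m' n' (by push_cast; rw [hmn', h])
    have h3 : m' = 0 := by exact_mod_cast h1
    have h4 : n' = 0 := by exact_mod_cast h2
    rw [h3, h4] at huv
    simp at huv
  obtain ⟨ω, hω⟩ : ∃ ω : ℂ, ω = -v * ω₁ + u * ω₂ := ⟨_, rfl⟩
  have him : (ω / (M * c')).im ≠ 0 := by
    intro h
    have h1 : ω = ((ω / (M * c')).re : ℂ) * (M * c') := by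
      rw [← div_eq_iff hω0]
      exact Complex.ext (by simp) (by simpa using h)
    generalize (ω / (M * c')).re = r at h1
    obtain ⟨h2, h3⟩ := hind (-v - r * m') (u - r * n') (by
      push_cast
      rw [hω, ← hmn'] at h1
      linear_combination h1)
    have h4 : (u : ℝ) * m' + v * n' = 1 := by exact_mod_cast congrArg (Int.cast : ℤ → ℝ) huv
    have h5 : (0 : ℝ) = 1 := by linear_combination h4 + n' * h2 - m' * h3
    exact zero_ne_one h5
  -- The sign `s` makes the basis `M c', s ω` of the lattice positively oriented.
  obtain ⟨s, hs, hspos⟩ : ∃ s : ℤ, s * s = 1 ∧ 0 < ((s : ℂ) * (ω / (M * c'))).im := by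
    rcases lt_or_gt_of_ne him with h | h
    · exact ⟨-1, by norm_num, by simpa using h⟩
    · exact ⟨1, by norm_num, by simpa using h⟩
  have hsC : (s : ℂ) * s = 1 := by exact_mod_cast congrArg (Int.cast : ℤ → ℂ) hs
  obtain ⟨τ, hτ⟩ : ∃ τ : ℍ, (τ : ℂ) = s * (ω / (M * c')) := ⟨⟨_, hspos⟩, rfl⟩
  have hτω : (M * c') * (τ : ℂ) = s * ω := by
    rw [hτ, mul_left_comm, mul_div_cancel₀ _ hω0]
  have hlat : ∀ w, w ∈ X.curve.lattice ↔ (M * c')⁻¹ * w ∈ (ofUpperHalfPlane τ).lattice := by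
    intro w
    rw [hmem, mem_lattice_ofUpperHalfPlane]
    constructor
    · rintro ⟨p, q, rfl⟩
      refine ⟨(p * u + q * v, s * (q * m' - p * n')), ?_⟩
      rw [eq_inv_mul_iff_mul_eq₀ hω0, periodHom_apply]
      push_cast
      linear_combination (s * (q * m' - p * n')) * hτω + (q * m' - p * n') * ω * hsC -
        (p * u + q * v) * hmn' + (q * m' - p * n') * hω + (p * ω₁ + q * ω₂) * huv'
    · rintro ⟨z, hz⟩
      rw [eq_inv_mul_iff_mul_eq₀ hω0, periodHom_apply] at hz
      refine ⟨z.1 * m' - s * z.2 * v, z.1 * n' + s * z.2 * u, ?_⟩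
      rw [← hz]
      push_cast
      linear_combination z.1 * hmn' - z.2 * hτω - s * z.2 * hω
  have h1 : ∀ w ∈ X.curve.lattice, (M * c')⁻¹ * w ∈ (ofUpperHalfPlane τ).lattice :=
    fun w => (hlat w).1
  have h2 : ∀ w, (M * c')⁻¹ * w ∈ (ofUpperHalfPlane τ).lattice → w ∈ X.curve.lattice :=
    fun w => (hlat w).2
  refine ⟨τ, mulIsogeny (inv_ne_zero hω0) h1 (finite_ker_mulHom h1 h2), mulHom_injective h1 h2, ?_⟩
  rw [hC', AddMonoidHom.map_zmultiples]
  change AddSubgroup.zmultiples (QuotientAddGroup.mk ((M * c')⁻¹ * c')) = _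
  have hc0 : c' ≠ 0 := right_ne_zero_of_mul hω0
  congr 2
  field_simp

lemma phiValue_eq_prod (hM : M ∈ genusZeroLevels) (hN : 0 < N) (hMN : Nat.Coprime M N)
    (hX : X'.IsRepresentedBy τ) : phiValue N X X' =
      ∏ x ∈ hermiteIndex N, (X.t - etaQuotient (etaExponents M) (heckePoint N x τ)) := by
  obtain ⟨Θ, hΘ, ht, -⟩ := exists_bijective_isogenyClasses hM hN hMN hX
  rw [phiValue, ← finprod_eq_of_bijective Θ hΘ
    (f := fun x : {x // x ∈ hermiteIndex N} =>
      X.t - etaQuotient (etaExponents M) (heckePoint N x τ)) fun x => by rw [ht],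
    finprod_eq_prod_of_fintype]
  exact Finset.prod_coe_sort (hermiteIndex N)
    fun x => X.t - etaQuotient (etaExponents M) (heckePoint N x τ)

lemma psiValue_eq_prod (hM : M ∈ genusZeroLevels) (hN : 0 < N) (hMN : Nat.Coprime M N)
    (hX : X'.IsRepresentedBy τ) : psiValue N X X' =
      ∏ x ∈ primitiveIndex N, (X.t - etaQuotient (etaExponents M) (heckePoint N x τ)) := by
  classical
  obtain ⟨Θ, hΘ, ht, hcyc⟩ := exists_bijective_isogenyClasses hM hN hMN hX
  have hsub : primitiveIndex N ⊆ hermiteIndex N := Finset.filter_subset _ _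
  rw [psiValue, finprod_mem_def, ← finprod_eq_of_bijective Θ hΘ
    (f := fun x : {x // x ∈ hermiteIndex N} => if (x : Σ _ : ℕ, ℕ) ∈ primitiveIndex N then
      X.t - etaQuotient (etaExponents M) (heckePoint N x τ) else 1)
    fun x => by simp only [Set.mulIndicator_apply, hcyc, ht], finprod_eq_prod_of_fintype]
  refine (Finset.prod_coe_sort (hermiteIndex N) fun x => if x ∈ primitiveIndex N then
    X.t - etaQuotient (etaExponents M) (heckePoint N x τ) else 1).trans ?_
  rw [← Finset.prod_filter, Finset.filter_mem_eq_inter, Finset.inter_eq_right.2 hsub]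

end Gamma0Curve

/-! ### The polynomial with the values at the isogenous curves as roots -/

/-- The substitution `q ↦ q ^ k` in integral power series. -/
def compPow (k : ℕ) (hk : k ≠ 0) : intSeriesSubring →+* intSeriesSubring where
  toFun g := ⟨fun q => g.1 (q ^ k), g.2.comp_pow hk⟩
  map_one' := rfl
  map_mul' _ _ := rfl
  map_zero' := rfl
  map_add' _ _ := rfl

lemma evalSeries_comp_compPow (k : ℕ) (hk : k ≠ 0) (q : ℂ) :
    (evalSeries q).comp (compPow k hk) = evalSeries (q ^ k) := rfl

lemma prod_pow_eq_one_or_neg_one {ζ : ℂ} {d : ℕ} (h : ζ ^ d = 1) :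
    ∃ δ : ℤ, (δ = 1 ∨ δ = -1) ∧ ∏ b ∈ Finset.range d, ζ ^ b = δ := by
  have h1 : (∏ b ∈ Finset.range d, ζ ^ b) ^ 2 = 1 := by
    rw [Finset.prod_pow_eq_pow_sum, ← pow_mul, Finset.sum_range_id_mul_two, pow_mul, h, one_pow]
  rcases sq_eq_one_iff.1 h1 with h2 | h2
  · exact ⟨1, Or.inl rfl, by simpa using h2⟩
  · exact ⟨-1, Or.inr rfl, by simpa using h2⟩

open Polynomial in
/-- For fixed `a` and `d`, the product of the `X - t((a τ + b) / d)` becomes an integral power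
series in `q` after multiplication by `q ^ a`, with constant term `±1`: it is the norm of `X - t`
with respect to `y = q ^ (a / d)`. -/
lemma exists_series_prod_translates {M : ℕ} (hM : M ∈ genusZeroLevels) {a d : ℕ} (ha : 0 < a)
    (hd : 0 < d) : ∃ W : intSeriesSubring[X],
      (∃ ε : ℤ, (ε = 1 ∨ ε = -1) ∧ W.map (evalSeries 0) = C (ε : ℂ)) ∧
      ∀ z : ℂ, 0 < z.im → C (Complex.exp (2 * π * Complex.I * z) ^ a) *
        ∏ b ∈ Finset.range d, (X - C (etaQuotient (etaExponents M) ((a * z + (b : ℤ)) / d))) =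
          W.map (evalSeries (Complex.exp (2 * π * Complex.I * z))) := by
  obtain ⟨u, hu, hu0, hut⟩ := exists_intSeries_etaQuotient hM
  have hζ := Complex.isPrimitiveRoot_exp d hd.ne'
  set ζ := Complex.exp (2 * π * Complex.I / d) with hζdef
  obtain ⟨V, hV⟩ := exists_norm_series hu hd hζ
  obtain ⟨δ, hδ, hδζ⟩ := prod_pow_eq_one_or_neg_one hζ.pow_eq_one
  have hd' : (d : ℂ) ≠ 0 := by exact_mod_cast hd.ne'
  have hδ2 : (δ : ℂ) * δ = 1 := by rcases hδ with rfl | rfl <;> norm_num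
  refine ⟨(δ : intSeriesSubring[X]) * V.map (compPow a ha.ne'), ⟨δ * (-1) ^ d, ?_, ?_⟩,
    fun z hz => ?_⟩
  · rcases hδ with rfl | rfl <;> rcases neg_one_pow_eq_or ℤ d with h | h <;> simp [h]
  · have h0 := hV 0 (by simp)
    rw [Polynomial.map_mul, Polynomial.map_map, evalSeries_comp_compPow, zero_pow ha.ne']
    rw [zero_pow hd.ne'] at h0
    rw [← h0]
    simp [hu0]
  · obtain ⟨y, hy⟩ : ∃ y, y = Complex.exp (2 * π * Complex.I * ((a * z + (0 : ℤ)) / d)) := ⟨_, rfl⟩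
    have hy1 : ‖y‖ < 1 := hy ▸ norm_exp_lt_one (im_affine_pos ha hd 0 hz)
    have hyd : y ^ d = Complex.exp (2 * π * Complex.I * z) ^ a := by
      rw [hy, ← Complex.exp_nat_mul, ← Complex.exp_nat_mul]
      congr 1
      field_simp
      push_cast
      ring
    have hyb : ∀ b : ℕ, Complex.exp (2 * π * Complex.I * ((a * z + (b : ℤ)) / d)) = ζ ^ b * y := by
      intro b
      rw [hζdef, hy, ← Complex.exp_nat_mul, ← Complex.exp_add]
      congr 1
      field_simp
      push_cast
      ring
    have h1 : ∀ b ∈ Finset.range d, C (ζ ^ b * y) * X - C (u (ζ ^ b * y)) = C (ζ ^ b * y) *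
        (X - C (etaQuotient (etaExponents M) ((a * z + (b : ℤ)) / d))) := by
      intro b _
      have h2 := hut _ (im_affine_pos ha hd b hz)
      rw [hyb] at h2
      rw [← h2, mul_sub, ← C_mul, mul_comm (etaQuotient _ _)]
    have h3 := hV y hy1
    rw [Finset.prod_congr rfl h1, Finset.prod_mul_distrib, ← map_prod, Finset.prod_mul_distrib,
      hδζ, Finset.prod_const, Finset.card_range, hyd] at h3
    rw [Polynomial.map_mul, Polynomial.map_map, evalSeries_comp_compPow, ← h3,
      Polynomial.map_intCast,
      ← mul_assoc]
    congr 1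
    rw [← C_eq_intCast, ← C_mul, ← mul_assoc, hδ2, one_mul]

open Polynomial in
/-- The polynomial whose roots are the values of the Hauptmodul at the points `(a τ + b) / d` for
the Hermite triples `(a, b, d)` in `S`. -/
noncomputable def heckePolynomial (M N : ℕ) (S : Finset (Σ _ : ℕ, ℕ)) (z : ℂ) : ℂ[X] :=
  ∏ x ∈ S, (X - C (etaQuotient (etaExponents M) (heckePoint N x z)))

lemma heckePolynomial_monic (M N : ℕ) (S : Finset (Σ _ : ℕ, ℕ)) (z : ℂ) :
    (heckePolynomial M N S z).Monic :=
  Polynomial.monic_prod_of_monic _ _ fun _ _ => Polynomial.monic_X_sub_C _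

lemma natDegree_heckePolynomial (M N : ℕ) (S : Finset (Σ _ : ℕ, ℕ)) (z : ℂ) :
    (heckePolynomial M N S z).natDegree = S.card := by
  rw [heckePolynomial, Polynomial.natDegree_prod_of_monic _ _ fun _ _ => Polynomial.monic_X_sub_C _]
  simp

lemma card_hermiteIndex (N : ℕ) : (hermiteIndex N).card = ∑ d ∈ N.divisors, d := by
  simp [hermiteIndex, Finset.card_sigma]

open Polynomial in
/-- The product of the `X - t((a τ + b) / d)` over all triples becomes an integral power series in
`q` after multiplication by `q ^ σ(N)`, with constant term `±1`. The number of triples is `σ(N)` as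
well. -/
lemma exists_series_heckePolynomial {M N : ℕ} (hM : M ∈ genusZeroLevels) (hN : 0 < N) :
    ∃ G : intSeriesSubring[X],
      (∃ ε : ℤ, (ε = 1 ∨ ε = -1) ∧ G.map (evalSeries 0) = C (ε : ℂ)) ∧
      ∀ z : ℂ, 0 < z.im → C (Complex.exp (2 * π * Complex.I * z) ^ (hermiteIndex N).card) *
        heckePolynomial M N (hermiteIndex N) z =
          G.map (evalSeries (Complex.exp (2 * π * Complex.I * z))) := by
  have hW : ∀ d : ℕ, ∃ W : intSeriesSubring[X], d ∈ N.divisors →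
      (∃ ε : ℤ, (ε = 1 ∨ ε = -1) ∧ W.map (evalSeries 0) = C (ε : ℂ)) ∧
      ∀ z : ℂ, 0 < z.im → C (Complex.exp (2 * π * Complex.I * z) ^ (N / d)) *
        ∏ b ∈ Finset.range d, (X - C (etaQuotient (etaExponents M)
          (((N / d : ℕ) * z + (b : ℤ)) / d))) =
          W.map (evalSeries (Complex.exp (2 * π * Complex.I * z))) := by
    intro d
    by_cases h : d ∈ N.divisors
    · have hdN := Nat.dvd_of_mem_divisors h
      have hd : 0 < d := Nat.pos_of_mem_divisors h
      obtain ⟨W, hW⟩ := exists_series_prod_translates hM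
        (Nat.div_pos (Nat.le_of_dvd hN hdN) hd) hd
      exact ⟨W, fun _ => hW⟩
    · exact ⟨0, fun h' => absurd h' h⟩
  choose W hW using hW
  refine ⟨∏ d ∈ N.divisors, W d, ?_, fun z hz => ?_⟩
  · rw [Polynomial.map_prod]
    refine Finset.prod_induction (fun d => (W d).map (evalSeries 0))
      (fun P => ∃ ε : ℤ, (ε = 1 ∨ ε = -1) ∧ P = C (ε : ℂ)) ?_ ⟨1, by simp⟩ fun d hd => (hW d hd).1
    rintro _ _ ⟨ε, hε, rfl⟩ ⟨ε', hε', rfl⟩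
    refine ⟨ε * ε', ?_, by simp⟩
    rcases hε with rfl | rfl <;> rcases hε' with rfl | rfl <;> simp
  · rw [Polynomial.map_prod, ← Finset.prod_congr rfl fun d hd => (hW d hd).2 z hz,
      Finset.prod_mul_distrib, ← map_prod, Finset.prod_pow_eq_pow_sum,
      Nat.sum_div_divisors N fun d => d,
      card_hermiteIndex, heckePolynomial, hermiteIndex, Finset.prod_sigma]
    rfl

/-! ### Invariance of the coefficients -/

namespace Gamma0Curve
variable {M N : ℕ}

/-- Points that are equivalent under `Γ₀(M)` represent the same pair `(E, C)`: the matrix `γ`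
changes the basis of the lattice, and multiplies `1 / M` by an integer prime to `M`. -/
lemma standard_isRepresentedBy_smul (hM : 0 < M) (τ : ℍ) {γ : SL(2, ℤ)} (hγ : (M : ℤ) ∣ γ 1 0) :
    (standard M hM τ).IsRepresentedBy (γ • τ) := by
  have hM' : (M : ℂ) ≠ 0 := by exact_mod_cast hM.ne'
  have hdet := det_eq γ
  have hdetC : (γ 0 0 : ℂ) * γ 1 1 - γ 0 1 * γ 1 0 = 1 := by
    exact_mod_cast congrArg (Int.cast : ℤ → ℂ) hdet
  have hj0 := smul_denom_ne_zero γ τ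
  have hτ' : ((γ • τ : ℍ) : ℂ) = _ := coe_smul_eq γ τ
  obtain ⟨j, hj⟩ : ∃ j : ℂ, j = γ 1 0 * τ + γ 1 1 := ⟨_, rfl⟩
  rw [← hj] at hj0 hτ'
  obtain ⟨τ', hτ'def⟩ : ∃ τ' : ℍ, τ' = γ • τ := ⟨_, rfl⟩
  rw [← hτ'def] at hτ' ⊢
  have hjτ : j * τ' = γ 0 0 * τ + γ 0 1 := by
    rw [hτ', mul_div_cancel₀ _ hj0]
  have hlat : ∀ w, w ∈ (ofUpperHalfPlane τ).lattice ↔ j⁻¹ * w ∈ (ofUpperHalfPlane τ').lattice := by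
    intro w
    rw [mem_lattice_ofUpperHalfPlane, mem_lattice_ofUpperHalfPlane]
    constructor
    · rintro ⟨v, rfl⟩
      refine ⟨(γ 0 0 * v.1 - γ 0 1 * v.2, γ 1 1 * v.2 - γ 1 0 * v.1), ?_⟩
      rw [eq_inv_mul_iff_mul_eq₀ hj0, periodHom_apply, periodHom_apply]
      push_cast
      linear_combination (γ 1 1 * v.2 - γ 1 0 * v.1) * hjτ +
        (γ 0 0 * v.1 - γ 0 1 * v.2) * hj + (v.1 + v.2 * τ) * hdetC
    · rintro ⟨v, hv⟩
      rw [eq_inv_mul_iff_mul_eq₀ hj0, periodHom_apply] at hv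
      refine ⟨(v.1 * γ 1 1 + v.2 * γ 0 1, v.1 * γ 1 0 + v.2 * γ 0 0), ?_⟩
      rw [periodHom_apply, ← hv]
      push_cast
      linear_combination -v.2 * hjτ - v.1 * hj
  have h1 : ∀ w ∈ (ofUpperHalfPlane τ).lattice, j⁻¹ * w ∈ (ofUpperHalfPlane τ').lattice :=
    fun w => (hlat w).1
  have h2 : ∀ w, j⁻¹ * w ∈ (ofUpperHalfPlane τ').lattice → w ∈ (ofUpperHalfPlane τ).lattice :=
    fun w => (hlat w).2
  refine ⟨mulIsogeny (inv_ne_zero hj0) h1 (finite_ker_mulHom h1 h2), mulHom_injective h1 h2, ?_⟩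
  change (AddSubgroup.zmultiples (QuotientAddGroup.mk (1 / (M : ℂ)) :
    (ofUpperHalfPlane τ).Point)).map (mulHom h1) = _
  rw [AddMonoidHom.map_zmultiples]
  change AddSubgroup.zmultiples (QuotientAddGroup.mk (j⁻¹ * (1 / (M : ℂ)))) = _
  have hMg : M • (QuotientAddGroup.mk (1 / (M : ℂ)) : (ofUpperHalfPlane τ').Point) = 0 := by
    rw [← QuotientAddGroup.mk_nsmul, mk_eq_zero_iff, mem_lattice_ofUpperHalfPlane]
    exact ⟨(1, 0), by simp [periodHom_apply, hM']⟩
  obtain ⟨c, hc⟩ := hγ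
  have hcop : IsCoprime (M : ℤ) (γ 0 0) := by
    refine ⟨-γ 0 1 * c, γ 1 1, ?_⟩
    linear_combination hdet + γ 0 1 * hc
  rw [← AddSubgroup.zmultiples_zsmul_of_isCoprime hMg hcop]
  congr 1
  rw [← QuotientAddGroup.mk_zsmul, ← sub_eq_zero, ← QuotientAddGroup.mk_sub, mk_eq_zero_iff,
    mem_lattice_ofUpperHalfPlane]
  refine ⟨(0, -c), ?_⟩
  have hcC : (γ 1 0 : ℂ) = M * c := by exact_mod_cast congrArg (Int.cast : ℤ → ℂ) hc
  rw [periodHom_apply, zsmul_eq_mul]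
  refine mul_left_cancel₀ (mul_ne_zero hj0 hM') ?_
  have h3 : j * M * (j⁻¹ * (1 / (M : ℂ)) - γ 0 0 * (1 / (M : ℂ))) = 1 - j * γ 0 0 := by
    field_simp
  rw [h3]
  push_cast
  linear_combination -(M * c : ℂ) * hjτ + (γ 0 0 : ℂ) * hj + hdetC + (γ 0 0 * τ + γ 0 1 : ℂ) * hcC

/-- The polynomial attached to all Hermite triples depends only on the pair `(E, C)`. -/
lemma heckePolynomial_eq_finprod {X : Gamma0Curve M} {τ : ℍ} (hM : M ∈ genusZeroLevels)
    (hN : 0 < N) (hMN : Nat.Coprime M N) (hX : X.IsRepresentedBy τ) :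
    heckePolynomial M N (hermiteIndex N) τ =
      ∏ᶠ c : X.IsogenyClasses N, (Polynomial.X - Polynomial.C c.t) := by
  obtain ⟨Θ, hΘ, ht, -⟩ := exists_bijective_isogenyClasses hM hN hMN hX
  rw [← finprod_eq_of_bijective Θ hΘ
    (f := fun x : {x // x ∈ hermiteIndex N} =>
      (Polynomial.X - Polynomial.C (etaQuotient (etaExponents M) (heckePoint N x τ))))
    fun x => by rw [ht],
    finprod_eq_prod_of_fintype]
  exact (Finset.prod_coe_sort (hermiteIndex N)
    fun x => Polynomial.X - Polynomial.C (etaQuotient (etaExponents M) (heckePoint N x τ))).symm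

end Gamma0Curve

/-- The invariance under `Γ₀(M)` is a consequence of the description in terms of `(E, C)`. -/
lemma heckePolynomial_smul {M N : ℕ} (hM : M ∈ genusZeroLevels) (hN : 0 < N)
    (hMN : Nat.Coprime M N) {γ : SL(2, ℤ)} (hγ : (M : ℤ) ∣ γ 1 0) (τ : ℍ) :
    heckePolynomial M N (hermiteIndex N) (γ • τ : ℍ) = heckePolynomial M N (hermiteIndex N) τ := by
  have hM0 := pos_of_mem_genusZeroLevels hM
  rw [Gamma0Curve.heckePolynomial_eq_finprod hM hN hMN
    (Gamma0Curve.standard_isRepresentedBy_smul hM0 τ hγ),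
    Gamma0Curve.heckePolynomial_eq_finprod hM hN hMN (Gamma0Curve.standard_isRepresentedBy hM0 τ)]

/-! ### Growth of the coefficients at the cusps -/

/-- The matrix `(a b; 0 d) σ` is the product of some `σ'` in `SL₂(ℤ)` and an upper triangular matrix
`(A B; 0 D)`. If `M` is prime to `d` and `σ ∞` is a cusp inequivalent to `∞` under `Γ₀(M)`, then so
is `σ' ∞`. -/
lemma exists_moebius_decomposition {M a d : ℕ} (ha : 0 < a) (hd : 0 < d) (hMd : Nat.Coprime M d)
    (b : ℤ) (σ : SL(2, ℤ)) :
    ∃ (σ' : SL(2, ℤ)) (A D : ℕ) (hA : 0 < A) (hD : 0 < D) (B : ℤ),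
      ((M : ℤ) ∣ σ' 1 0 → (M : ℤ) ∣ σ 1 0) ∧ ∀ z : ℍ,
        (a * ((σ • z : ℍ) : ℂ) + b) / d =
          ((σ' • (⟨(A * z + B) / D, im_affine_pos hA hD B z.im_pos⟩ : ℍ) : ℍ) : ℂ) := by
  obtain ⟨p, hp⟩ : ∃ p : ℤ, p = a * σ 0 0 + b * σ 1 0 := ⟨_, rfl⟩
  obtain ⟨q, hq⟩ : ∃ q : ℤ, q = a * σ 0 1 + b * σ 1 1 := ⟨_, rfl⟩
  obtain ⟨r, hr⟩ : ∃ r : ℤ, r = d * σ 1 0 := ⟨_, rfl⟩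
  obtain ⟨s, hs⟩ : ∃ s : ℤ, s = d * σ 1 1 := ⟨_, rfl⟩
  have hdet : p * s - q * r = a * d := by
    rw [hp, hq, hr, hs]
    linear_combination (a * d : ℤ) * det_eq σ
  have had : (0 : ℤ) < a * d := by positivity
  have hg : 0 < Int.gcd p r := by
    refine Int.gcd_pos_iff.2 ?_
    by_contra h
    push Not at h
    rw [h.1, h.2] at hdet
    simp at hdet
    omega
  obtain ⟨g, hgdef⟩ : ∃ g, g = Int.gcd p r := ⟨_, rfl⟩
  rw [← hgdef] at hg
  obtain ⟨p', r', hpr, hp', hr'⟩ : ∃ p' r' : ℤ, IsCoprime p' r' ∧ p = p' * g ∧ r = r' * g := by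
    have hg' : 0 < Int.gcd p r := hgdef ▸ hg
    exact ⟨p / Int.gcd p r, r / Int.gcd p r, Int.isCoprime_iff_gcd_eq_one.2
      (Int.gcd_ediv_gcd_ediv_gcd hg'), by rw [hgdef, Int.ediv_mul_cancel (Int.gcd_dvd_left ..)],
      by rw [hgdef, Int.ediv_mul_cancel (Int.gcd_dvd_right ..)]⟩
  obtain ⟨σ', h0, h1⟩ := hpr.exists_SL2_col 0
  have hdet' := det_eq σ'
  rw [h0, h1] at hdet'
  have hD : 0 < p' * s - r' * q := by
    refine pos_of_mul_pos_right (a := (g : ℤ)) ?_ (by omega)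
    rw [show (g : ℤ) * (p' * s - r' * q) = a * d by rw [← hdet, hp', hr']; ring]
    exact had
  obtain ⟨D, hDdef⟩ : ∃ D : ℕ, (D : ℤ) = p' * s - r' * q := ⟨_, Int.toNat_of_nonneg hD.le⟩
  have hD0 : 0 < D := by omega
  refine ⟨σ', g, D, hg, hD0, σ' 1 1 * q - σ' 0 1 * s, ?_, fun z => ?_⟩
  · rw [h1]
    intro h
    have h2 : (M : ℤ) ∣ d * σ 1 0 := by
      rw [← hr, hr']
      exact h.mul_right _
    exact (Nat.isCoprime_iff_coprime.2 hMd).dvd_of_dvd_mul_left h2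
  · rw [coe_smul_eq, coe_smul_eq, h0, h1]
    have hz := smul_denom_ne_zero σ z
    have hdC : (d : ℂ) ≠ 0 := by exact_mod_cast hd.ne'
    have hDC : (D : ℂ) ≠ 0 := by exact_mod_cast hD0.ne'
    have e1 : (a * (((σ 0 0 : ℂ) * z + σ 0 1) / (σ 1 0 * z + σ 1 1)) + b) / d =
        (p * z + q) / (r * z + s) := by
      have h2 : (r * z + s : ℂ) = d * (σ 1 0 * z + σ 1 1) := by rw [hr, hs]; push_cast; ring
      have h3 : (p * z + q : ℂ) = a * (σ 0 0 * z + σ 0 1) + b * (σ 1 0 * z + σ 1 1) := by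
        rw [hp, hq]; push_cast; ring
      rw [h2, h3]
      generalize (σ 1 0 * z + σ 1 1 : ℂ) = w at hz
      field_simp
    have hcast : (D : ℂ) = p' * s - r' * q := by exact_mod_cast congrArg (Int.cast : ℤ → ℂ) hDdef
    have hdetC : (p' : ℂ) * σ' 1 1 - σ' 0 1 * r' = 1 := by
      exact_mod_cast congrArg (Int.cast : ℤ → ℂ) hdet'
    rw [e1]
    change _ = (p' * ((g * (z : ℂ) + ((σ' 1 1 * q - σ' 0 1 * s : ℤ) : ℂ)) / D) + σ' 0 1) /
      (r' * ((g * (z : ℂ) + ((σ' 1 1 * q - σ' 0 1 * s : ℤ) : ℂ)) / D) + σ' 1 1)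
    have e2 : p' * ((g * (z : ℂ) + ((σ' 1 1 * q - σ' 0 1 * s : ℤ) : ℂ)) / D) + σ' 0 1 =
        (p * z + q) / D := by
      rw [eq_div_iff hDC, add_mul, mul_assoc, div_mul_cancel₀ _ hDC, hcast, hp']
      push_cast
      linear_combination (q : ℂ) * hdetC
    have e3 : r' * ((g * (z : ℂ) + ((σ' 1 1 * q - σ' 0 1 * s : ℤ) : ℂ)) / D) + σ' 1 1 =
        (r * z + s) / D := by
      rw [eq_div_iff hDC, add_mul, mul_assoc, div_mul_cancel₀ _ hDC, hcast, hr']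
      push_cast
      linear_combination (s : ℂ) * hdetC
    rw [e2, e3, div_div_div_cancel_right₀ hDC]

lemma tendsto_affine_atImInfty {A D : ℕ} (hA : 0 < A) (hD : 0 < D) (B : ℤ) :
    Tendsto (fun z : ℍ => (⟨(A * z + B) / D, im_affine_pos hA hD B z.im_pos⟩ : ℍ))
      atImInfty atImInfty := by
  rw [atImInfty, tendsto_comap_iff]
  have h : ∀ z : ℍ, (UpperHalfPlane.im ∘ fun z : ℍ =>
      (⟨(A * z + B) / D, im_affine_pos hA hD B z.im_pos⟩ : ℍ)) z = (A / D : ℝ) * z.im := by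
    intro z
    change ((A * (z : ℂ) + B) / D).im = _
    rw [Complex.div_natCast_im, Complex.add_im, Complex.intCast_im, add_zero,
      ← Complex.ofReal_natCast,
      Complex.im_ofReal_mul, UpperHalfPlane.coe_im]
    ring
  refine Tendsto.congr (fun z => (h z).symm) ?_
  exact (tendsto_comap (f := UpperHalfPlane.im)).const_mul_atTop (by positivity)

lemma isBoundedAtImInfty_heckePoint_smul {M N : ℕ} (hM : M ∈ genusZeroLevels) (hN : 0 < N)
    (hMN : Nat.Coprime M N) {σ : SL(2, ℤ)} (hσ : ¬ (M : ℤ) ∣ σ 1 0) {x : Σ _ : ℕ, ℕ}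
    (hx : x ∈ hermiteIndex N) : IsBoundedAtImInfty fun z : ℍ =>
      etaQuotient (etaExponents M) (heckePoint N x ((σ • z : ℍ) : ℂ)) := by
  obtain ⟨h1, h2, h3⟩ := (mem_hermiteIndex hN).1 hx
  obtain ⟨σ', A, D, hA, hD, B, hσ', h⟩ := exists_moebius_decomposition h1
    (show 0 < x.1 by omega) (hMN.coprime_dvd_right ⟨N / x.1, by rw [mul_comm, h3]⟩) x.2 σ
  have hb := isBoundedAtImInfty_etaQuotient_smul hM fun h' => hσ (hσ' h')
  have hb2 := hb.comp_tendsto (tendsto_affine_atImInfty hA hD B)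
  refine Asymptotics.IsBigO.congr hb2 (fun z => ?_) fun z => rfl
  simp only [Function.comp_apply]
  rw [← h z]
  rfl

/-- The coefficients of `∏ (X - fᵢ)` belong to every ring of functions containing all `fᵢ`. -/
lemma coeff_prod_X_sub_C_mem {Z ι : Type*} (A : Subring (Z → ℂ)) (S : Finset ι) (f : ι → Z → ℂ)
    (hf : ∀ i ∈ S, f i ∈ A) (j : ℕ) :
    (fun z => (∏ i ∈ S, (Polynomial.X - Polynomial.C (f i z))).coeff j) ∈ A := by
  classical
  induction S using Finset.induction_on generalizing j with
  | empty =>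
    by_cases hj : j = 0
    · simp only [Finset.prod_empty, Polynomial.coeff_one, hj, if_true]
      exact A.one_mem
    · simp only [Finset.prod_empty, Polynomial.coeff_one, hj, if_false]
      exact A.zero_mem
  | insert i S hi ih =>
    have ih' := ih fun i hi => hf i (Finset.mem_insert_of_mem hi)
    have hfi := hf i (Finset.mem_insert_self _ _)
    simp only [Finset.prod_insert hi, sub_mul, Polynomial.coeff_sub, Polynomial.coeff_C_mul]
    refine A.sub_mem ?_ (A.mul_mem hfi (ih' j))
    cases j with
    | zero =>
      simp only [Polynomial.mul_coeff_zero, Polynomial.coeff_X_zero, zero_mul]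
      exact A.zero_mem
    | succ j => simpa only [Polynomial.coeff_X_mul] using ih' j

/-! ### Integrality of the coefficients -/

/-- The ring of functions that are holomorphic on the upper half plane. -/
def holomorphicSubring : Subring (ℂ → ℂ) where
  carrier := {f | DifferentiableOn ℂ f {z | 0 < z.im}}
  mul_mem' := DifferentiableOn.mul
  one_mem' := differentiableOn_const 1
  add_mem' := DifferentiableOn.add
  zero_mem' := differentiableOn_const 0
  neg_mem' := DifferentiableOn.neg

lemma differentiableOn_coeff_heckePolynomial {M N : ℕ} (hM : M ∈ genusZeroLevels) (hN : 0 < N)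
    (j : ℕ) : DifferentiableOn ℂ (fun z => (heckePolynomial M N (hermiteIndex N) z).coeff j)
      {z | 0 < z.im} := by
  refine coeff_prod_X_sub_C_mem holomorphicSubring (hermiteIndex N)
    (fun x z => etaQuotient (etaExponents M) (heckePoint N x z)) (fun x hx => ?_) j
  have h := differentiableOn_etaQuotient (etaExponents M) fun p hp => (etaExponents_dvd M hM p hp).1
  refine h.comp (Differentiable.differentiableOn ?_) fun z hz => heckePoint_im_pos hN hx hz
  unfold heckePoint
  fun_prop

lemma isBoundedAtImInfty_coeff_heckePolynomial {M N : ℕ} (hM : M ∈ genusZeroLevels) (hN : 0 < N)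
    (hMN : Nat.Coprime M N) {σ : SL(2, ℤ)} (hσ : ¬ (M : ℤ) ∣ σ 1 0) (j : ℕ) :
    IsBoundedAtImInfty fun z : ℍ =>
      (heckePolynomial M N (hermiteIndex N) ((σ • z : ℍ) : ℂ)).coeff j :=
  coeff_prod_X_sub_C_mem (boundedFilterSubalgebra ℂ atImInfty).toSubring (hermiteIndex N)
    (fun x (z : ℍ) => etaQuotient (etaExponents M) (heckePoint N x ((σ • z : ℍ) : ℂ)))
    (fun _ hx => isBoundedAtImInfty_heckePoint_smul hM hN hMN hσ hx) j

lemma card_hermiteIndex_pos {N : ℕ} (hN : 0 < N) : 0 < (hermiteIndex N).card := by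
  rw [card_hermiteIndex]
  exact Finset.sum_pos (fun d hd => Nat.pos_of_mem_divisors hd) ⟨N, Nat.mem_divisors_self N hN.ne'⟩

open Polynomial in
/-- The coefficients of `∏ (X - t((a τ + b) / d))` are integral polynomials in `t(τ)`. Here the
polynomials in `ℤ[Y][X]` are monic in `X`, and their degree in `Y` is attained by the constant
coefficient. -/
lemma exists_modularPolynomial {M N : ℕ} (hM : M ∈ genusZeroLevels) (hN : 0 < N)
    (hMN : Nat.Coprime M N) : ∃ Φ : ℤ[X][X], Φ.Monic ∧ Φ.natDegree = (hermiteIndex N).card ∧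
      (∀ j, (Φ.coeff j).natDegree ≤ (hermiteIndex N).card) ∧
      (Φ.coeff 0).natDegree = (hermiteIndex N).card ∧
      ∀ z : ℂ, 0 < z.im →
        Φ.map ((aeval (etaQuotient (etaExponents M) z) : ℤ[X] →ₐ[ℤ] ℂ) : ℤ[X] →+* ℂ) =
          heckePolynomial M N (hermiteIndex N) z := by
  obtain ⟨G, ⟨ε, hε, hG0⟩, hG⟩ := exists_series_heckePolynomial (N := N) hM hN
  have hP : ∀ j, ∃ P : ℤ[X], P.natDegree ≤ (hermiteIndex N).card ∧
      (P.coeff (hermiteIndex N).card : ℂ) = (G.coeff j).1 0 ∧ ∀ z : ℂ, 0 < z.im →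
      (heckePolynomial M N (hermiteIndex N) z).coeff j =
        aeval (etaQuotient (etaExponents M) z) P := fun j =>
    exists_polynomial_of_intSeries hM _ (differentiableOn_coeff_heckePolynomial hM hN j)
      (fun γ hγ z => by rw [heckePolynomial_smul hM hN hMN hγ])
      (fun σ hσ => isBoundedAtImInfty_coeff_heckePolynomial hM hN hMN hσ j) (G.coeff j).2
      fun z hz => by
        have := congrArg (fun P => P.coeff j) (hG z hz)
        rw [coeff_C_mul, coeff_map] at this
        rw [mul_comm, this]
        rfl
  choose P hP1 hP2 hP3 using hP
  have hs := card_hermiteIndex_pos hN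
  have hmonic := fun z => heckePolynomial_monic M N (hermiteIndex N) z
  have hnat := fun z => natDegree_heckePolynomial M N (hermiteIndex N) z
  generalize (hermiteIndex N).card = s at *
  have hcoeff : ∀ j, (∑ i ∈ Finset.range s, C (P i) * X ^ i : ℤ[X][X]).coeff j =
      if j < s then P j else 0 := by
    intro j
    simp [coeff_C_mul, coeff_X_pow]
  have hdeg : (∑ i ∈ Finset.range s, C (P i) * X ^ i : ℤ[X][X]).degree < s := by
    rw [degree_lt_iff_coeff_zero]
    intro j hj
    rw [hcoeff, if_neg (by omega)]
  have hcoeff' : ∀ j, (X ^ s + ∑ i ∈ Finset.range s, C (P i) * X ^ i : ℤ[X][X]).coeff j =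
      if j < s then P j else if j = s then 1 else 0 := by
    intro j
    rw [coeff_add, hcoeff, coeff_X_pow]
    split_ifs with h1 h2 <;> first | omega | simp
  refine ⟨X ^ s + ∑ i ∈ Finset.range s, C (P i) * X ^ i, monic_X_pow_add hdeg,
    (natDegree_add_eq_left_of_degree_lt (by rwa [degree_X_pow])).trans (natDegree_X_pow s),
    fun j => ?_, ?_, fun z hz => ?_⟩
  · rw [hcoeff']
    split_ifs
    · exact hP1 j
    · simp
    · simp
  · rw [hcoeff', if_pos hs]
    refine le_antisymm (hP1 0) (le_natDegree_of_ne_zero fun h0 => ?_)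
    have h1 := hP2 0
    have h2 := congrArg (fun Q => Q.coeff 0) hG0
    rw [coeff_map, coeff_C_zero] at h2
    rw [h0, show (G.coeff 0).1 0 = ε from h2] at h1
    -- The leading coefficient of the constant coefficient is `±1`.
    rcases hε with rfl | rfl <;> norm_num at h1
  · ext j
    rw [coeff_map, hcoeff']
    split_ifs with h1 h2
    · exact (hP3 j z hz).symm
    · rw [map_one, h2, ← hnat z]
      exact (hmonic z).coeff_natDegree.symm
    · rw [map_zero, coeff_eq_zero_of_natDegree_lt (by rw [hnat z]; omega)]

/-! ### Sorting Hermite triples by their greatest common divisor -/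

/-- A Hermite triple is `e` times a primitive one, with `e` the greatest common divisor of its
entries. -/
lemma prod_hermiteIndex {α : Type*} [CommMonoid α] {N : ℕ} (hN : 0 < N) (f : (Σ _ : ℕ, ℕ) → α) :
    ∏ x ∈ hermiteIndex N, f x = ∏ e ∈ N.divisors.filter fun e => e ^ 2 ∣ N,
      ∏ y ∈ primitiveIndex (N / e ^ 2), f ⟨e * y.1, e * y.2⟩ := by
  classical
  rw [← Finset.prod_fiberwise_of_maps_to (t := N.divisors.filter fun e => e ^ 2 ∣ N)
    (g := fun x : Σ _ : ℕ, ℕ => Nat.gcd (N / x.1) (Nat.gcd x.2 x.1))]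
  · refine Finset.prod_congr rfl fun e he => ?_
    rw [Finset.mem_filter, Nat.mem_divisors] at he
    obtain ⟨⟨heN, -⟩, N', rfl⟩ := he
    have he0 : 0 < e := Nat.pos_of_ne_zero fun h => by simp [h] at hN
    have hN' : 0 < N' := Nat.pos_of_mul_pos_left hN
    rw [Nat.mul_div_cancel_left _ (by positivity)]
    symm
    refine Finset.prod_nbij (fun y => ⟨e * y.1, e * y.2⟩) ?_ ?_ ?_ fun _ _ => rfl
    · rintro ⟨d, b⟩ hy
      rw [primitiveIndex, Finset.mem_filter, mem_hermiteIndex hN'] at hy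
      obtain ⟨⟨h1, h2, h3⟩, h4⟩ := hy
      simp only at h1 h2 h3 h4
      have h5 : e ^ 2 * N' / (e * d) = e * (N' / d) := by
        conv_lhs => rw [← h3]
        rw [show e ^ 2 * (N' / d * d) = e * (N' / d) * (e * d) by ring,
          Nat.mul_div_cancel _ (Nat.mul_pos he0 (by omega))]
      rw [Finset.mem_filter, mem_hermiteIndex hN]
      simp only [h5, Nat.gcd_mul_left]
      refine ⟨⟨by positivity, by gcongr, ?_⟩, by rw [h4, mul_one]⟩
      conv_rhs => rw [← h3]
      ring
    · rintro ⟨d, b⟩ - ⟨d', b'⟩ - h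
      simp only [Sigma.mk.injEq, heq_eq_eq] at h
      rw [Nat.eq_of_mul_eq_mul_left he0 h.1, Nat.eq_of_mul_eq_mul_left he0 h.2]
    · rintro ⟨d, b⟩ hx
      rw [Finset.mem_coe, Finset.mem_filter, mem_hermiteIndex hN] at hx
      obtain ⟨⟨h1, h2, h3⟩, h4⟩ := hx
      simp only at h1 h2 h3 h4
      obtain ⟨a', ha'⟩ : e ∣ e ^ 2 * N' / d := h4 ▸ Nat.gcd_dvd_left _ _
      obtain ⟨b', rfl⟩ : e ∣ b := h4 ▸ (Nat.gcd_dvd_right _ _).trans (Nat.gcd_dvd_left _ _)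
      obtain ⟨d', rfl⟩ : e ∣ d := h4 ▸ (Nat.gcd_dvd_right _ _).trans (Nat.gcd_dvd_right _ _)
      rw [ha'] at h1 h3 h4
      have hN'' : a' * d' = N' := Nat.eq_of_mul_eq_mul_left (show 0 < e ^ 2 by positivity)
        (by rw [← h3]; ring)
      have ha0 : 0 < a' := Nat.pos_of_mul_pos_left h1
      have hb : b' < d' := Nat.lt_of_mul_lt_mul_left h2
      have h6 : N' / d' = a' := by rw [← hN'', Nat.mul_div_cancel _ (by omega)]
      refine ⟨⟨d', b'⟩, ?_, rfl⟩
      rw [Finset.mem_coe, primitiveIndex, Finset.mem_filter, mem_hermiteIndex hN', h6]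
      refine ⟨⟨ha0, hb, hN''⟩, ?_⟩
      rw [Nat.gcd_mul_left, Nat.gcd_mul_left] at h4
      exact Nat.eq_of_mul_eq_mul_left he0 (by rw [h4, mul_one])
  · intro x hx
    obtain ⟨h1, h2, h3⟩ := (mem_hermiteIndex hN).1 hx
    rw [Finset.mem_filter, Nat.mem_divisors]
    have h4 : Nat.gcd (N / x.1) (Nat.gcd x.2 x.1) ∣ x.1 :=
      (Nat.gcd_dvd_right _ _).trans (Nat.gcd_dvd_right _ _)
    refine ⟨⟨h4.trans ⟨N / x.1, by rw [mul_comm, h3]⟩, hN.ne'⟩, ?_⟩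
    rw [sq]
    conv_rhs => rw [← h3]
    exact mul_dvd_mul (Nat.gcd_dvd_left _ _) h4

lemma heckePoint_mul {N e : ℕ} (he : 0 < e) (heN : e ^ 2 ∣ N) {y : Σ _ : ℕ, ℕ}
    (hy : y ∈ hermiteIndex (N / e ^ 2)) (hN : 0 < N) (z : ℂ) :
    heckePoint N ⟨e * y.1, e * y.2⟩ z = heckePoint (N / e ^ 2) y z := by
  obtain ⟨N', rfl⟩ := heN
  rw [Nat.mul_div_cancel_left _ (by positivity)] at hy ⊢
  obtain ⟨h1, h2, h3⟩ := (mem_hermiteIndex (Nat.pos_of_mul_pos_left hN)).1 hy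
  have h5 : e ^ 2 * N' / (e * y.1) = e * (N' / y.1) := by
    conv_lhs => rw [← h3]
    rw [show e ^ 2 * (N' / y.1 * y.1) = e * (N' / y.1) * (e * y.1) by ring,
      Nat.mul_div_cancel _ (Nat.mul_pos he (by omega))]
  have he' : (e : ℂ) ≠ 0 := by exact_mod_cast he.ne'
  rw [heckePoint, heckePoint]
  simp only [h5]
  generalize N' / y.1 = a
  push_cast
  rw [show (e * a * z + e * y.2 : ℂ) = e * (a * z + y.2) by ring, mul_div_mul_left _ _ he']

lemma heckePolynomial_hermiteIndex {N : ℕ} (M : ℕ) (hN : 0 < N) (z : ℂ) :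
    heckePolynomial M N (hermiteIndex N) z = ∏ e ∈ N.divisors.filter fun e => e ^ 2 ∣ N,
      heckePolynomial M (N / e ^ 2) (primitiveIndex (N / e ^ 2)) z := by
  rw [heckePolynomial, prod_hermiteIndex hN]
  refine Finset.prod_congr rfl fun e he => Finset.prod_congr rfl fun y hy => ?_
  rw [Finset.mem_filter] at he
  rw [heckePoint_mul (Nat.pos_of_mem_divisors he.1) he.2 (Finset.mem_filter.1 hy).1 hN]

/-- The Hauptmodul takes infinitely many values, as it has a pole at `∞`. -/
lemma infinite_range_etaQuotient {M : ℕ} (hM : M ∈ genusZeroLevels) :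
    (Set.range fun z : ℍ => etaQuotient (etaExponents M) z).Infinite := by
  intro hfin
  obtain ⟨u, hu, hu0, hut⟩ := exists_intSeries_etaQuotient hM
  obtain ⟨K, hK⟩ := hfin.isBounded.exists_norm_le
  have h1 : Tendsto (fun z : ℍ => etaQuotient (etaExponents M) z *
      Complex.exp (2 * π * Complex.I * z)) atImInfty (𝓝 1) := by
    rw [← hu0]
    exact (hu.continuousAt_zero.tendsto.comp tendsto_exp_atImInfty).congr fun z =>
      (hut z z.im_pos).symm
  have h2 : Tendsto (fun z : ℍ => etaQuotient (etaExponents M) z *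
      Complex.exp (2 * π * Complex.I * z)) atImInfty (𝓝 0) :=
    isBoundedUnder_le_mul_tendsto_zero (isBoundedUnder_of ⟨K, fun z => hK _ ⟨z, rfl⟩⟩)
      tendsto_exp_atImInfty
  exact one_ne_zero (tendsto_nhds_unique h1 h2)

/-! ### Polynomials in two variables -/

/-- The bivariate polynomial attached to a polynomial in `X = X 0` over the polynomials in
`Y = X 1`. -/
noncomputable def toMvPolynomial : Polynomial (Polynomial ℤ) →+* MvPolynomial (Fin 2) ℤ :=
  Polynomial.eval₂RingHom (Polynomial.eval₂RingHom MvPolynomial.C (MvPolynomial.X 1))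
    (MvPolynomial.X 0)

/-- A univariate polynomial as a polynomial in a family of one variable. -/
noncomputable def toMvPolynomialOne : Polynomial ℤ →+* MvPolynomial (Fin 1) ℤ :=
  Polynomial.eval₂RingHom MvPolynomial.C (MvPolynomial.X 0)

lemma finSuccEquiv_toMvPolynomialOne (P : Polynomial ℤ) :
    MvPolynomial.finSuccEquiv ℤ 0 (toMvPolynomialOne P) = P.map MvPolynomial.C := by
  have h : ((MvPolynomial.finSuccEquiv ℤ 0 : MvPolynomial (Fin 1) ℤ →+*
      Polynomial (MvPolynomial (Fin 0) ℤ)).comp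
      toMvPolynomialOne) = Polynomial.mapRingHom MvPolynomial.C := by
    ext <;> simp [toMvPolynomialOne, MvPolynomial.finSuccEquiv_X_zero]
  exact congrArg (fun f => f P) h

lemma degreeOf_toMvPolynomialOne (P : Polynomial ℤ) :
    (toMvPolynomialOne P).degreeOf 0 = P.natDegree := by
  rw [← MvPolynomial.natDegree_finSuccEquiv, finSuccEquiv_toMvPolynomialOne,
    Polynomial.natDegree_map_eq_of_injective (MvPolynomial.C_injective _ _)]

lemma toMvPolynomialOne_injective : Function.Injective toMvPolynomialOne := by
  intro P Q h
  refine Polynomial.map_injective _ (MvPolynomial.C_injective (Fin 0) ℤ) ?_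
  rw [← finSuccEquiv_toMvPolynomialOne, h, finSuccEquiv_toMvPolynomialOne]

lemma finSuccEquiv_toMvPolynomial (P : Polynomial (Polynomial ℤ)) :
    MvPolynomial.finSuccEquiv ℤ 1 (toMvPolynomial P) = P.map toMvPolynomialOne := by
  have h1 : MvPolynomial.finSuccEquiv ℤ 1 (MvPolynomial.X 1) =
      Polynomial.C (MvPolynomial.X 0) := MvPolynomial.finSuccEquiv_X_succ (j := 0)
  have h : ((MvPolynomial.finSuccEquiv ℤ 1 : MvPolynomial (Fin 2) ℤ →+*
      Polynomial (MvPolynomial (Fin 1) ℤ)).comp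
      toMvPolynomial) = Polynomial.mapRingHom toMvPolynomialOne := by
    ext <;> simp [toMvPolynomial, toMvPolynomialOne, MvPolynomial.finSuccEquiv_X_zero, h1]
  exact congrArg (fun f => f P) h

lemma degreeOf_zero_toMvPolynomial (P : Polynomial (Polynomial ℤ)) :
    (toMvPolynomial P).degreeOf 0 = P.natDegree := by
  rw [← MvPolynomial.natDegree_finSuccEquiv, finSuccEquiv_toMvPolynomial,
    Polynomial.natDegree_map_eq_of_injective toMvPolynomialOne_injective]

lemma toMvPolynomial_ne_zero {P : Polynomial (Polynomial ℤ)} (hP : P ≠ 0) :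
    toMvPolynomial P ≠ 0 := by
  intro h
  have h1 := finSuccEquiv_toMvPolynomial P
  rw [h, map_zero] at h1
  exact hP (Polynomial.map_injective _ toMvPolynomialOne_injective
    (by rw [← h1, Polynomial.map_zero]))

lemma degreeOf_one_toMvPolynomial {P : Polynomial (Polynomial ℤ)} {s : ℕ}
    (hs : ∀ j, (P.coeff j).natDegree ≤ s) (h0 : (P.coeff 0).natDegree = s) :
    (toMvPolynomial P).degreeOf 1 = s := by
  refine le_antisymm (MvPolynomial.degreeOf_le_iff.2 fun m hm => ?_) ?_
  · rw [← Finsupp.cons_tail m, ← MvPolynomial.mem_support_coeff_finSuccEquiv,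
      finSuccEquiv_toMvPolynomial, Polynomial.coeff_map] at hm
    exact (MvPolynomial.degreeOf_le_iff.1 (degreeOf_toMvPolynomialOne _).le _ hm).trans (hs _)
  · have := MvPolynomial.degreeOf_coeff_finSuccEquiv (toMvPolynomial P) 0 0
    rwa [finSuccEquiv_toMvPolynomial, Polynomial.coeff_map, degreeOf_toMvPolynomialOne, h0] at this

lemma eval_toMvPolynomial (P : Polynomial (Polynomial ℤ)) (x y : ℂ) :
    MvPolynomial.eval ![x, y] (MvPolynomial.map (Int.castRingHom ℂ) (toMvPolynomial P)) =
      (P.map ((Polynomial.aeval y : Polynomial ℤ →ₐ[ℤ] ℂ) : Polynomial ℤ →+* ℂ)).eval x := by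
  have h : ((MvPolynomial.eval ![x, y]).comp
      (MvPolynomial.map (Int.castRingHom ℂ))).comp toMvPolynomial =
      (Polynomial.evalRingHom x).comp (Polynomial.mapRingHom
        ((Polynomial.aeval y : Polynomial ℤ →ₐ[ℤ] ℂ) : Polynomial ℤ →+* ℂ)) := by
    ext <;> simp [toMvPolynomial]
  exact congrArg (fun f => f P) h

/-- A polynomial over `ℤ[Y]` is determined by its values at infinitely many complex `Y`. -/
lemma eq_of_map_aeval_eq {S : Set ℂ} (hS : S.Infinite) {P Q : Polynomial (Polynomial ℤ)}
    (h : ∀ y ∈ S, P.map ((Polynomial.aeval y : Polynomial ℤ →ₐ[ℤ] ℂ) : Polynomial ℤ →+* ℂ) =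
      Q.map ((Polynomial.aeval y : Polynomial ℤ →ₐ[ℤ] ℂ) : Polynomial ℤ →+* ℂ)) : P = Q := by
  ext1 j
  refine Polynomial.map_injective (Int.castRingHom ℂ) Int.cast_injective
    (Polynomial.eq_of_infinite_eval_eq _ _ (hS.mono fun y hy => ?_))
  have := congrArg (fun R => R.coeff j) (h y hy)
  simpa [Polynomial.coeff_map, Polynomial.aeval_def, Polynomial.eval_map] using this

/-! ### The modular polynomials -/

/-- The integral polynomial `Ψ_N` is the quotient of `Φ_N` by the product of the `Ψ_{N / e²}` with
`e ≠ 1`; in particular its two degrees agree. -/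
lemma exists_primitiveModularPolynomial {M N : ℕ} (hM : M ∈ genusZeroLevels) (hN : 0 < N)
    (hMN : Nat.Coprime M N) : ∃ Ψ : Polynomial (Polynomial ℤ), Ψ.Monic ∧
      (toMvPolynomial Ψ).degreeOf 0 = (toMvPolynomial Ψ).degreeOf 1 ∧
      ∀ z : ℂ, 0 < z.im → Ψ.map ((Polynomial.aeval (etaQuotient (etaExponents M) z) :
        Polynomial ℤ →ₐ[ℤ] ℂ) : Polynomial ℤ →+* ℂ) =
          heckePolynomial M N (primitiveIndex N) z := by
  classical
  induction N using Nat.strong_induction_on with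
  | _ N ih =>
  set E := N.divisors.filter fun e => e ^ 2 ∣ N with hE
  have h1E : 1 ∈ E := by simp [hE, hN.ne']
  have key : ∀ e ∈ E.erase 1, ∃ Ψ : Polynomial (Polynomial ℤ), Ψ.Monic ∧
      (toMvPolynomial Ψ).degreeOf 0 = (toMvPolynomial Ψ).degreeOf 1 ∧
      ∀ z : ℂ, 0 < z.im → Ψ.map ((Polynomial.aeval (etaQuotient (etaExponents M) z) :
        Polynomial ℤ →ₐ[ℤ] ℂ) : Polynomial ℤ →+* ℂ) =
          heckePolynomial M (N / e ^ 2) (primitiveIndex (N / e ^ 2)) z := by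
    intro e he
    rw [Finset.mem_erase, hE, Finset.mem_filter] at he
    obtain ⟨he1, he2, he3⟩ := he
    have he0 : 0 < e := Nat.pos_of_mem_divisors he2
    refine ih _ (Nat.div_lt_self hN (Nat.one_lt_pow two_ne_zero (by omega)))
      (Nat.div_pos (Nat.le_of_dvd hN he3) (by positivity))
      (hMN.coprime_dvd_right (Nat.div_dvd_of_dvd he3))
  choose! ψ hψ1 hψ2 hψ3 using key
  set R := ∏ e ∈ E.erase 1, ψ e with hR
  have hRm : R.Monic := Polynomial.monic_prod_of_monic _ _ hψ1
  obtain ⟨Φ, hΦm, hΦ1, hΦ2, hΦ3, hΦ⟩ := exists_modularPolynomial hM hN hMN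
  have hmap : ∀ z : ℂ, 0 < z.im → Φ.map ((Polynomial.aeval (etaQuotient (etaExponents M) z) :
        Polynomial ℤ →ₐ[ℤ] ℂ) : Polynomial ℤ →+* ℂ) =
      R.map ((Polynomial.aeval (etaQuotient (etaExponents M) z) :
        Polynomial ℤ →ₐ[ℤ] ℂ) : Polynomial ℤ →+* ℂ) *
        heckePolynomial M N (primitiveIndex N) z := by
    intro z hz
    rw [hΦ z hz, heckePolynomial_hermiteIndex M hN, hR, Polynomial.map_prod,
      ← Finset.prod_erase_mul _ _ h1E, one_pow, Nat.div_one]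
    congr 1
    exact Finset.prod_congr rfl fun e he => (hψ3 e he z hz).symm
  have hquot : ∀ z : ℂ, 0 < z.im → (Φ /ₘ R).map
      ((Polynomial.aeval (etaQuotient (etaExponents M) z) :
        Polynomial ℤ →ₐ[ℤ] ℂ) : Polynomial ℤ →+* ℂ) =
          heckePolynomial M N (primitiveIndex N) z := by
    intro z hz
    rw [Polynomial.map_divByMonic _ hRm, hmap z hz,
      Polynomial.mul_divByMonic_cancel_left _ (hRm.map _)]
  have hmul : Φ = R * (Φ /ₘ R) := by
    refine eq_of_map_aeval_eq (infinite_range_etaQuotient hM) ?_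
    rintro _ ⟨z, rfl⟩
    rw [Polynomial.map_mul, hquot z z.im_pos, hmap z z.im_pos]
  have hΨm : (Φ /ₘ R).Monic := hRm.of_mul_monic_left (hmul ▸ hΦm)
  refine ⟨Φ /ₘ R, hΨm, ?_, hquot⟩
  have hdeg : ∀ i, (toMvPolynomial Φ).degreeOf i = (∑ e ∈ E.erase 1,
      (toMvPolynomial (ψ e)).degreeOf i) + (toMvPolynomial (Φ /ₘ R)).degreeOf i := by
    intro i
    conv_lhs => rw [hmul]
    rw [map_mul, MvPolynomial.degreeOf_mul_eq (toMvPolynomial_ne_zero hRm.ne_zero)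
      (toMvPolynomial_ne_zero hΨm.ne_zero), hR, map_prod, MvPolynomial.degreeOf_prod_eq]
    exact fun e he => toMvPolynomial_ne_zero (hψ1 e he).ne_zero
  have h0 := hdeg 0
  have h1 := hdeg 1
  rw [degreeOf_zero_toMvPolynomial, hΦ1] at h0
  rw [degreeOf_one_toMvPolynomial hΦ2 hΦ3] at h1
  rw [Finset.sum_congr rfl hψ2] at h0
  -- The two degrees of `Φ` agree, as do those of all factors but `Φ /ₘ R`.
  omega

namespace Gamma0Curve

lemma infinite_range_t {M : ℕ} (hM : M ∈ genusZeroLevels) :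
    (Set.range (t : Gamma0Curve M → ℂ)).Infinite := by
  refine (infinite_range_etaQuotient hM).mono ?_
  rintro _ ⟨τ, rfl⟩
  exact ⟨standard M (pos_of_mem_genusZeroLevels hM) τ,
    t_eq_of_isRepresentedBy hM (standard_isRepresentedBy _ _)⟩

/-- A bivariate polynomial is determined by its values at the pairs `(t(E, C), t(E', C'))`. -/
lemma eq_of_eval_t_eq {M : ℕ} (hM : M ∈ genusZeroLevels) {P Q : MvPolynomial (Fin 2) ℂ}
    (h : ∀ X X' : Gamma0Curve M,
      MvPolynomial.eval ![X.t, X'.t] P = MvPolynomial.eval ![X.t, X'.t] Q) : P = Q := by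
  refine MvPolynomial.funext_set (fun _ => Set.range (t : Gamma0Curve M → ℂ))
    (fun _ => infinite_range_t hM) fun x hx => ?_
  obtain ⟨X, hX⟩ := hx 0 (Set.mem_univ _)
  obtain ⟨X', hX'⟩ := hx 1 (Set.mem_univ _)
  have : x = ![X.t, X'.t] := by
    funext i
    fin_cases i
    · exact hX.symm
    · exact hX'.symm
  rw [this]
  exact h X X'

end Gamma0Curve

theorem theorem2p9 (M N : ℕ)
    (hM : M ∈ ({2, 3, 4, 5, 6, 7, 8, 9, 10, 12, 13, 16, 18, 25} : Finset ℕ))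
    (hN : 0 < N) (hMN : Nat.Coprime M N) :
    ∃ Φ Ψ : MvPolynomial (Fin 2) ℤ,
      (∀ P : MvPolynomial (Fin 2) ℂ,
        IsModularPolynomialPhi M N P ↔ P = MvPolynomial.map (Int.castRingHom ℂ) Φ) ∧
      (∀ P : MvPolynomial (Fin 2) ℂ,
        IsModularPolynomialPsi M N P ↔ P = MvPolynomial.map (Int.castRingHom ℂ) Ψ) ∧
      Φ.degreeOf 0 = Φ.degreeOf 1 ∧
      Ψ.degreeOf 0 = Ψ.degreeOf 1 ∧
      Ψ.degreeOf 0 = (CongruenceSubgroup.Gamma0 N).index := by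
  have hM' : M ∈ genusZeroLevels := hM
  have hM0 : 0 < M := pos_of_mem_genusZeroLevels hM'
  obtain ⟨Φ, -, hΦ1, hΦ2, hΦ3, hΦ⟩ := exists_modularPolynomial hM' hN hMN
  obtain ⟨Ψ, hΨm, hΨ1, hΨ⟩ := exists_primitiveModularPolynomial hM' hN hMN
  have hΦv : IsModularPolynomialPhi M N
      (MvPolynomial.map (Int.castRingHom ℂ) (toMvPolynomial Φ)) := by
    intro X X'
    obtain ⟨τ, hτ⟩ := Gamma0Curve.exists_isRepresentedBy hM0 X'
    rw [eval_toMvPolynomial, Gamma0Curve.t_eq_of_isRepresentedBy hM' hτ, hΦ _ τ.im_pos,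
      Gamma0Curve.phiValue_eq_prod hM' hN hMN hτ, heckePolynomial, Polynomial.eval_prod]
    simp
  have hΨv : IsModularPolynomialPsi M N
      (MvPolynomial.map (Int.castRingHom ℂ) (toMvPolynomial Ψ)) := by
    intro X X'
    obtain ⟨τ, hτ⟩ := Gamma0Curve.exists_isRepresentedBy hM0 X'
    rw [eval_toMvPolynomial, Gamma0Curve.t_eq_of_isRepresentedBy hM' hτ, hΨ _ τ.im_pos,
      Gamma0Curve.psiValue_eq_prod hM' hN hMN hτ, heckePolynomial, Polynomial.eval_prod]
    simp
  refine ⟨toMvPolynomial Φ, toMvPolynomial Ψ, fun P => ⟨fun h => ?_, ?_⟩,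
    fun P => ⟨fun h => ?_, ?_⟩, ?_, hΨ1, ?_⟩
  · exact Gamma0Curve.eq_of_eval_t_eq hM' fun X X' => (h X X').trans (hΦv X X').symm
  · rintro rfl
    exact hΦv
  · exact Gamma0Curve.eq_of_eval_t_eq hM' fun X X' => (h X X').trans (hΨv X X').symm
  · rintro rfl
    exact hΨv
  · rw [degreeOf_zero_toMvPolynomial, degreeOf_one_toMvPolynomial hΦ2 hΦ3, hΦ1]
  · have hI := hΨ Complex.I (by simp)
    rw [degreeOf_zero_toMvPolynomial, ← card_primitiveIndex hN,
      ← natDegree_heckePolynomial M N (primitiveIndex N) Complex.I, ← hI, hΨm.natDegree_map]
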